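/- Let $f\in C^1([0,1);[0,\infty))$ be nondecreasing with $f^{-1}(0)=\{0\}$, put $f_1(s):=s\,f(1-s)$ for $s\in(0,1]$, and assume that $f_1$ is strictly decreasing and $s\mapsto f_1(\sqrt s)$ is convex on $(0,1]$, and that $f_1(s)=\ell-\ell_1 s+o(s)$ as $s\to0^+$ for some $\ell,\ell_1>0$. Set $f(1):=\infty$ and $0\cdot\infty:=0$. For $s\ge 0$ let $$g_0(s):=\inf_{(\alpha,\beta)\in\mathcal U_1}\mathcal G_s(\alpha,\beta),\qquad \mathcal G_s(\alpha,\beta):=\int_{-\infty}^{\infty}\Big(s^2f^2(\beta)|\alpha'|^2+\frac{(1-\beta)^2}{4}+|\beta'|^2\Big)\,dt,$$ $$\mathcal U_1:=\Big\{(\alpha,\beta)\in H^1_{\rm loc}(\mathbb R)^2:\ \alpha'\in L^1(\mathbb R),\ \Big|\int_{-\infty}^\infty\alpha'\,dt\Big|=1,\ 0\le\beta\le1,\ \lim_{|t|\to\infty}\beta(t)=1\Big\},$$ where elements of $H^1_{\rm loc}(\mathbb R)$ are identified with their continuous representatives, and let $s_{\rm frac}:=\sup\{s\ge0: g_0(s)<1\}\in[0,\infty]$.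 Then the following hold. (i) For all $0\le s<s_{\rm frac}$ one has $g_0(s)<1$, and there is a pair $(\alpha_s,\beta_s)\in\mathcal U_1$ with $g_0(s)=\mathcal G_s(\alpha_s,\beta_s)$. If $0<s<s_{\rm frac}$, this minimizer is unique up to translations and the sign of $\alpha$: if $(\alpha_s,\beta_s)$ and $(\hat\alpha_s,\hat\beta_s)$ are minimizers, then there are $a_1,t_1\in\mathbb R$ and $\sigma\in\{1,-1\}$ such that $\alpha_s(t)=a_1+\sigma\hat\alpha_s(t-t_1)$ and $\beta_s(t)=\hat\beta_s(t-t_1)$ for all $t\in\mathbb R$. (ii) For all $s\ge s_{\rm frac}$ (with $s<\infty$) one has $g_0(s)=1$ and $g_0(s)=\mathcal G_s(0,\beta_s)$, where $\beta_s(t):=1-e^{-|t|/2}$. Moreover, the minimum value $m_s:=\min_{t\in\mathbb R}\beta_s(t)$, where $\beta_s$ is the second component of any minimizer if $s<s_{\rm frac}$ and the function in (ii) if $s\ge s_{\rm frac}$, exists and is uniquely determined by $s$. The map $s\mapsto m_s$ is continuous on $[0,\infty)$ and strictly decreasing on $[0,s_{\rm frac})$, with $m_0=1$ and $m_s=0$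 for all $s\ge s_{\rm frac}$. -/

import Mathlib

open Set Filter Topology MeasureTheory Asymptotics
open scoped NNReal ENNReal ContDiff

namespace CohesiveFracture

noncomputable section

/-- The function `f₁(s) = s f(1 - s)`, used for `s ∈ (0, 1]`. -/
def f₁ (f : ℝ → ℝ) (s : ℝ) : ℝ := s * f (1 - s)

/-- The assumptions on the degradation function `f : [0, 1) → [0, ∞)`; values of `f` outside
`[0, 1)` are irrelevant. -/
structure Admissible (f : ℝ → ℝ) : Prop where
  contDiffOn : ContDiffOn ℝ 1 f (Ico 0 1)
  nonneg : ∀ x ∈ Ico (0 : ℝ) 1, 0 ≤ f x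
  monotoneOn : MonotoneOn f (Ico 0 1)
  eq_zero_iff : ∀ x ∈ Ico (0 : ℝ) 1, f x = 0 ↔ x = 0
  strictAntiOn_f₁ : StrictAntiOn (f₁ f) (Ioc 0 1)
  convexOn_f₁_sqrt : ConvexOn ℝ (Ioc 0 1) (fun x => f₁ f (Real.sqrt x))
  expansion : ∃ ℓ ℓ₁ : ℝ, 0 < ℓ ∧ 0 < ℓ₁ ∧
    (fun s => f₁ f s - (ℓ - ℓ₁ * s)) =o[𝓝[>] (0 : ℝ)] (fun s => s)

/-- The extension of `f` to `x = 1` by its limit `f(1) = ∞`. -/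
def fExt (f : ℝ → ℝ) (x : ℝ) : ℝ≥0∞ := if x < 1 then ENNReal.ofReal (f x) else ⊤

/-- `u ∈ L²_loc(ℝ)`. -/
def MemL2loc (u : ℝ → ℝ) : Prop := ∀ K : Set ℝ, IsCompact K → MemLp u 2 (volume.restrict K)

/-- `v` is a weak (distributional) derivative of `u` on `ℝ`. -/
def HasWeakDeriv (u v : ℝ → ℝ) : Prop :=
  LocallyIntegrable u volume ∧ LocallyIntegrable v volume ∧
    ∀ φ : ℝ → ℝ, ContDiff ℝ ∞ φ → HasCompactSupport φ →
      ∫ t, u t * deriv φ t = - ∫ t, v t * φ t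

/-- `u ∈ H¹_loc(ℝ)`. -/
def MemH1loc (u : ℝ → ℝ) : Prop := MemL2loc u ∧ ∃ v, HasWeakDeriv u v ∧ MemL2loc v

open Classical in
/-- The weak derivative `u'` (unique up to null sets), if there is one. -/
def weakDeriv (u : ℝ → ℝ) : ℝ → ℝ := if h : ∃ v, HasWeakDeriv u v then h.choose else 0

/-- The class `𝒰₁` of admissible pairs `(α, β)`. As usual in dimension one, elements of
`H¹_loc(ℝ)` are identified with their continuous representatives. -/
structure U₁ (α β : ℝ → ℝ) : Prop where
  continuous_left : Continuous α
  continuous_right : Continuous β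
  memH1loc_left : MemH1loc α
  memH1loc_right : MemH1loc β
  integrable : Integrable (weakDeriv α) volume
  abs_integral : |∫ t, weakDeriv α t| = 1
  mem_Icc : ∀ t, β t ∈ Icc (0 : ℝ) 1
  tendsto : Tendsto β (cocompact ℝ) (𝓝 1)

/-- The functional `𝒢_s(α, β) = ∫ (s² f(β)² |α'|² + (1 - β)² / 4 + |β'|²) dt ∈ [0, ∞]`, with the
usual convention `0 * ∞ = 0` on the set where `β = 1`. -/
def G (f : ℝ → ℝ) (s : ℝ≥0) (α β : ℝ → ℝ) : ℝ≥0∞ :=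
  ∫⁻ t, ((s : ℝ≥0∞) ^ 2 * fExt f (β t) ^ 2 * ENNReal.ofReal (weakDeriv α t ^ 2)
    + ENNReal.ofReal ((1 - β t) ^ 2 / 4) + ENNReal.ofReal (weakDeriv β t ^ 2))

/-- The cohesive energy density `g₀(s) = inf {𝒢_s(α, β) : (α, β) ∈ 𝒰₁}`. -/
def g₀ (f : ℝ → ℝ) (s : ℝ≥0) : ℝ≥0∞ := ⨅ (α : ℝ → ℝ) (β : ℝ → ℝ) (_ : U₁ α β), G f s α β

/-- The fracture threshold `s_frac = sup {s ≥ 0 : g₀(s) < 1} ∈ [0, ∞]`. -/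
def sFrac (f : ℝ → ℝ) : ℝ≥0∞ := ⨆ (s : ℝ≥0) (_ : g₀ f s < 1), (s : ℝ≥0∞)

/-- `(α, β)` is a minimizer of `𝒢_s` in `𝒰₁`. -/
def IsMinimizer (f : ℝ → ℝ) (s : ℝ≥0) (α β : ℝ → ℝ) : Prop := U₁ α β ∧ G f s α β = g₀ f s

/-- The profile `t ↦ 1 - exp (-|t| / 2)`. -/
def brittleProfile (t : ℝ) : ℝ := 1 - Real.exp (-|t| / 2)

end

end CohesiveFracture

/-! Put h(x) = f₁(√x), so that f(β) = h(x) / (1 - β) with x = (1 - β)². For a competitor let X be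
the maximum of x, c = h(X) and k(x) = √(1 - (c / h(x))²) (`cosFactor`). Since h(x) ≥ c along the
curve, completing two squares (`density_eq_add_sq`) bounds the energy density below by s c |α'| + (1
- β) k |β'|. The first term integrates to at least s c. The second is the modulus of the derivative
of ½ ∫₀ˣ k, and x runs between 0 and X on both sides of a minimum point of β, so it contributes at
least K(c) = ∫₀^X k (`phaseEnergy`). Hence 𝒢_s ≥ s c + K(c) (`U₁.le_G`), and a minimization over one
number c ∈ [0, h(0)] remains.

Both squares vanish when |x'| = x k and s |α'| = c x / (2 h(x)²). For the decaying solution on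
either side of the minimum point the latter has integral A(c) = ∫₀^X c / (h² k) dx, the `opening`;
so the bound is attained when A(c) = s (`exists_U₁_G_eq`). The substitution sin θ = c / h(x) gives
A(c) = ∫₀^{π/2} R(c / sin θ) dθ, where R is 1 / |h'| as a function of the value of h, extended by 0.
Convexity of h makes R nonincreasing; the linear term in the expansion of f₁ forces h'(0+) = -∞,
which makes R continuous. Therefore A is continuous and strictly decreasing. By Tonelli K' = -A
(`lintegral_opening`), so c ↦ s c + K(c) is strictly convex, with value 1 at c = 0. If s is a value
of A, its minimum is unique and below 1; otherwise s exceeds every value of A and the infimum is 1,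
approached by competitors with c → 0. Thus s_frac = sup A (`lt_sFrac_iff`), and m_s inverts A
written in terms of min β.

For uniqueness, equality forces x' = -x k to the right of the minimum point and its mirror image to
the left. Uniqueness for this equation fails only at x = X, where k = 0 and the solution may rest. A
plateau would add slip, but the decaying parts already use up A(c) = s (`U₁.sq_eq_decay`). -/

namespace CohesiveFracture

/-! ### Primitives and weak derivatives in one dimension. -/

/-- `u` is a primitive of the locally integrable function `v`. -/
structure IsPrimitive (u v : ℝ → ℝ) : Prop where
  locallyIntegrable : LocallyIntegrable v volume
  sub_eq : ∀ x y, u y - u x = ∫ t in x..y, v t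

theorem _root_.MeasureTheory.LocallyIntegrable.intervalIntegrable_real {v : ℝ → ℝ}
    (hv : LocallyIntegrable v volume) (x y : ℝ) : IntervalIntegrable v volume x y :=
  intervalIntegrable_iff.mpr <|
    (hv.integrableOn_isCompact isCompact_uIcc).mono_set uIoc_subset_uIcc

namespace IsPrimitive

variable {u v : ℝ → ℝ}

theorem eq_add (h : IsPrimitive u v) (x : ℝ) : u = fun y => u x + ∫ t in x..y, v t := by
  funext y
  linarith [h.sub_eq x y]

theorem absolutelyContinuousOnInterval (h : IsPrimitive u v) (a b : ℝ) :
    AbsolutelyContinuousOnInterval u a b := by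
  have h1 : AbsolutelyContinuousOnInterval (fun _ : ℝ => u a) a b :=
    (LipschitzWith.const (u a)).lipschitzOnWith (s := uIcc a b)
      |>.absolutelyContinuousOnInterval
  have h2 := (h.locallyIntegrable.intervalIntegrable_real a
    b).absolutelyContinuousOnInterval_intervalIntegral (c := a) left_mem_uIcc
  rw [h.eq_add a]
  exact h1.add h2

theorem ae_hasDerivAt (h : IsPrimitive u v) : ∀ᵐ t, HasDerivAt u (v t) t := by
  filter_upwards [_root_.LocallyIntegrable.ae_hasDerivAt_integral h.locallyIntegrable] with t ht
  rw [h.eq_add 0]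
  exact (ht 0).const_add _

theorem continuous (h : IsPrimitive u v) : Continuous u := by
  rw [h.eq_add 0]
  exact continuous_const.add (intervalIntegral.continuous_primitive
    (fun a b => h.locallyIntegrable.intervalIntegrable_real a b) 0)

/-- `Q` is Lipschitz on a compact interval containing the values of `u`, so the composition is
absolutely continuous and is recovered from its a.e. derivative. -/
theorem comp_contDiff (h : IsPrimitive u v) {Q : ℝ → ℝ} (hQ : ContDiff ℝ 1 Q) :
    IsPrimitive (fun t => Q (u t)) (fun t => deriv Q (u t) * v t) := by
  have hQ' : Continuous (deriv Q) := hQ.continuous_deriv le_rfl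
  refine ⟨?_, fun x y => ?_⟩
  · rw [← locallyIntegrableOn_univ]
    exact (locallyIntegrableOn_univ.2 h.locallyIntegrable).continuousOn_mul
      (hQ'.comp h.continuous).continuousOn isOpen_univ.isLocallyClosed
  · obtain ⟨C, hC⟩ := (isCompact_uIcc (a := x) (b := y)).exists_bound_of_continuousOn
      h.continuous.continuousOn
    have hC0 : -C ≤ C := by
      have := (norm_nonneg _).trans (hC x left_mem_uIcc); linarith
    obtain ⟨K, hK⟩ := (hQ.contDiffOn (s := Icc (-C) C)).exists_lipschitzOnWith (by decide)
      (convex_Icc _ _) isCompact_Icc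
    have hac : AbsolutelyContinuousOnInterval (fun t => Q (u t)) x y := by
      rw [absolutelyContinuousOnInterval_iff]
      intro ε hε
      obtain ⟨δ, hδ, H⟩ := (absolutelyContinuousOnInterval_iff u x y).1
        (h.absolutelyContinuousOnInterval x y) (ε / (K + 1)) (by positivity)
      refine ⟨δ, hδ, fun E hE hE' => ?_⟩
      have h1 := H E hE hE'
      have hmem : ∀ i < E.1, (E.2 i).1 ∈ uIcc x y ∧ (E.2 i).2 ∈ uIcc x y := by
        intro i hi
        have := hE.1 i (Finset.mem_range.2 hi)
        exact this
      calc _ ≤ ∑ i ∈ Finset.range E.1, (K + 1 : ℝ) * dist (u (E.2 i).1) (u (E.2 i).2) := by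
            refine Finset.sum_le_sum fun i hi => ?_
            obtain ⟨h1, h2⟩ := hmem i (Finset.mem_range.1 hi)
            have := hK.dist_le_mul (u (E.2 i).1) (abs_le.1 (hC _ h1)) (u (E.2 i).2)
              (abs_le.1 (hC _ h2))
            refine this.trans ?_
            gcongr
            linarith
        _ = (K + 1 : ℝ) * ∑ i ∈ Finset.range E.1, dist (u (E.2 i).1) (u (E.2 i).2) := by
            rw [Finset.mul_sum]
        _ < (K + 1 : ℝ) * (ε / (K + 1)) := by gcongr
        _ = ε := by field_simp
    rw [← hac.integral_deriv_eq_sub]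
    refine intervalIntegral.integral_congr_ae ?_
    filter_upwards [h.ae_hasDerivAt] with t ht _
    exact (((hQ.differentiable (by decide)) (u t)).hasDerivAt.comp t ht).deriv

theorem integral_mul_deriv (h : IsPrimitive u v) {φ : ℝ → ℝ} (hφ : ContDiff ℝ ∞ φ)
    (hs : HasCompactSupport φ) : ∫ t, u t * deriv φ t = - ∫ t, v t * φ t := by
  obtain ⟨R, hR⟩ := hs.isCompact.isBounded.subset_closedBall 0
  rw [Real.closedBall_eq_Icc, zero_sub, zero_add] at hR
  set a := -(|R| + 1)
  set b := |R| + 1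
  have hab : a ≤ b := by simp only [a, b]; linarith [abs_nonneg R]
  have hR' : tsupport φ ⊆ Ioo a b := hR.trans fun t ht => by
    have := le_abs_self R
    exact ⟨by simp only [a]; linarith [ht.1], by simp only [b]; linarith [ht.2]⟩
  have hφa : φ a = 0 := image_eq_zero_of_notMem_tsupport fun hc => (hR' hc).1.false
  have hφb : φ b = 0 := image_eq_zero_of_notMem_tsupport fun hc => (hR' hc).2.false
  have hac : AbsolutelyContinuousOnInterval φ a b :=
    (hφ.of_le (by exact_mod_cast le_top)).contDiffOn.absolutelyContinuousOnInterval
  have key := (h.absolutelyContinuousOnInterval a b).integral_mul_deriv_eq_deriv_mul hac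
  rw [hφa, hφb] at key
  rw [← setIntegral_eq_integral_of_forall_compl_eq_zero (s := Ioc a b),
    ← setIntegral_eq_integral_of_forall_compl_eq_zero (s := Ioc a b) (f := fun t => v t * φ t),
    ← intervalIntegral.integral_of_le hab, ← intervalIntegral.integral_of_le hab, key]
  · have : ∫ t in a..b, deriv u t * φ t = ∫ t in a..b, v t * φ t := by
      refine intervalIntegral.integral_congr_ae ?_
      filter_upwards [h.ae_hasDerivAt] with t ht _
      rw [ht.deriv]
    rw [this]; ring
  · intro t ht
    rw [image_eq_zero_of_notMem_tsupport fun hc => ht (Ioo_subset_Ioc_self (hR' hc)), mul_zero]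
  · intro t ht
    rw [image_eq_zero_of_notMem_tsupport (f := deriv φ) fun hc =>
      ht (Ioo_subset_Ioc_self (hR' (tsupport_deriv_subset hc))), mul_zero]

theorem hasWeakDeriv (h : IsPrimitive u v) : HasWeakDeriv u v :=
  ⟨h.continuous.locallyIntegrable, h.locallyIntegrable,
    fun _ hφ hs => h.integral_mul_deriv hφ hs⟩

theorem of_hasDerivAt {S : Set ℝ} (hS : S.Countable) (hu : Continuous u)
    (hd : ∀ t ∉ S, HasDerivAt u (v t) t) (hv : LocallyIntegrable v volume) :
    IsPrimitive u v := by
  refine ⟨hv, fun x y => ?_⟩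
  rw [integral_eq_of_hasDerivAt_off_countable u v hS hu.continuousOn
    (fun t ht => hd t ht.2) (hv.intervalIntegrable_real x y)]

end IsPrimitive

/-- The primitive from -∞ vanishes to the right of the support because the total integral is zero.
-/
theorem exists_isPrimitive_hasCompactSupport {θ : ℝ → ℝ} (hθ : ContDiff ℝ ∞ θ)
    (hs : HasCompactSupport θ) (h0 : ∫ t, θ t = 0) :
    ∃ φ : ℝ → ℝ, ContDiff ℝ ∞ φ ∧ HasCompactSupport φ ∧ deriv φ = θ := by
  obtain ⟨R, hR⟩ := hs.isCompact.isBounded.subset_closedBall 0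
  rw [Real.closedBall_eq_Icc, zero_sub, zero_add] at hR
  have hθ0 : ∀ t, t ∉ Icc (-R) R → θ t = 0 := fun t ht =>
    image_eq_zero_of_notMem_tsupport fun hc => ht (hR hc)
  have hint : Integrable θ := hθ.continuous.integrable_of_hasCompactSupport hs
  set φ : ℝ → ℝ := fun x => ∫ t in Iic x, θ t
  have hφ : φ = fun x => φ 0 + ∫ t in (0 : ℝ)..x, θ t := by
    funext x
    have := intervalIntegral.integral_Iic_sub_Iic (f := θ) (μ := volume) (a := 0) (b := x)
      hint.integrableOn hint.integrableOn
    simp only [φ]; linarith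
  have hd : ∀ x, HasDerivAt φ (θ x) x := by
    intro x
    rw [hφ]
    exact (intervalIntegral.integral_hasDerivAt_right (hθ.continuous.intervalIntegrable _ _)
      hθ.continuous.stronglyMeasurable.stronglyMeasurableAtFilter
      hθ.continuous.continuousAt).const_add _
  have hderiv : deriv φ = θ := funext fun x => (hd x).deriv
  refine ⟨φ, ?_, HasCompactSupport.intro (isCompact_Icc (a := -R) (b := R)) fun x hx => ?_, hderiv⟩
  · rw [contDiff_infty_iff_deriv]
    exact ⟨fun x => (hd x).differentiableAt, hderiv ▸ hθ⟩
  · by_cases hxR : x < -R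
    · refine setIntegral_eq_zero_of_forall_eq_zero fun t ht => hθ0 t fun hc => ?_
      exact absurd (hc.1.trans ht) (not_le.2 hxR)
    · have hxR' : R < x := by
        by_contra hc
        exact hx ⟨not_lt.1 hxR, not_lt.1 hc⟩
      have : ∫ t in Iic x, θ t = ∫ t, θ t :=
        setIntegral_eq_integral_of_forall_compl_eq_zero fun t ht => hθ0 t fun hc =>
          ht (hc.2.trans hxR'.le)
      simp only [φ]
      rw [this, h0]

/-- The du Bois-Reymond argument. Subtracting a primitive of `v` leaves a continuous `w` orthogonal
to derivatives of test functions. With `η` of mass one, ψ - (∫ψ) η is such a derivative, so `w`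
minus a constant is orthogonal to every test function ψ. -/
theorem HasWeakDeriv.isPrimitive {u v : ℝ → ℝ} (h : HasWeakDeriv u v) (hu : Continuous u) :
    IsPrimitive u v := by
  obtain ⟨-, hv, hw⟩ := h
  set V : ℝ → ℝ := fun x => ∫ t in (0 : ℝ)..x, v t
  have hV : IsPrimitive V v := ⟨hv, fun x y => by
    simp only [V]
    rw [intervalIntegral.integral_interval_sub_left (hv.intervalIntegrable_real _ _)
      (hv.intervalIntegrable_real _ _)]⟩
  set w : ℝ → ℝ := fun t => u t - V t
  have hwc : Continuous w := hu.sub hV.continuous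
  have hint : ∀ g ψ : ℝ → ℝ, Continuous g → Continuous ψ → HasCompactSupport ψ →
      Integrable fun t => g t * ψ t := fun g ψ hg hψ hs =>
    (hg.mul hψ).integrable_of_hasCompactSupport hs.mul_left
  have h0 : ∀ φ : ℝ → ℝ, ContDiff ℝ ∞ φ → HasCompactSupport φ → ∫ t, w t * deriv φ t = 0 := by
    intro φ hφ hs
    have hc : Continuous (deriv φ) := hφ.continuous_deriv (by exact_mod_cast le_top)
    have e : ∀ t, w t * deriv φ t = u t * deriv φ t - V t * deriv φ t := fun t => by
      simp only [w]; ring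
    simp_rw [e]
    rw [integral_sub (hint _ _ hu hc hs.deriv) (hint _ _ hV.continuous hc hs.deriv), hw φ hφ hs,
      hV.integral_mul_deriv hφ hs, sub_self]
  let bump : ContDiffBump (0 : ℝ) := ⟨1, 2, by norm_num, by norm_num⟩
  set η : ℝ → ℝ := bump.normed volume
  have hη : ContDiff ℝ ∞ η := bump.contDiff_normed
  have hηs : HasCompactSupport η := bump.hasCompactSupport_normed
  have hη1 : ∫ t, η t = 1 := bump.integral_normed
  set c : ℝ := ∫ t, w t * η t
  have hae : ∀ᵐ t, w t - c = 0 := by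
    refine ae_eq_zero_of_integral_contDiff_smul_eq_zero
      (hwc.sub continuous_const).locallyIntegrable fun ψ hψ hs => ?_
    set I : ℝ := ∫ t, ψ t
    have hθs : HasCompactSupport fun t => ψ t - I * η t := hs.sub hηs.mul_left
    have hψi : Integrable ψ := hψ.continuous.integrable_of_hasCompactSupport hs
    have hηi : Integrable η := hη.continuous.integrable_of_hasCompactSupport hηs
    obtain ⟨φ, hφ, hφs, hφd⟩ := exists_isPrimitive_hasCompactSupport
      (θ := fun t => ψ t - I * η t) (hψ.sub (contDiff_const.mul hη)) hθs (by
        rw [integral_sub hψi (hηi.const_mul I), integral_const_mul, hη1, mul_one, sub_self])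
    have h1 := h0 φ hφ hφs
    rw [hφd] at h1
    have e1 : ∀ t, w t * (ψ t - I * η t) = w t * ψ t - I * (w t * η t) := fun t => by ring
    simp_rw [e1] at h1
    rw [integral_sub (hint _ _ hwc hψ.continuous hs)
      ((hint _ _ hwc hη.continuous hηs).const_mul I), integral_const_mul] at h1
    have e2 : ∀ t, ψ t • (w t - c) = w t * ψ t - c * ψ t := fun t => by
      rw [smul_eq_mul]; ring
    simp_rw [e2]
    rw [integral_sub (hint _ _ hwc hψ.continuous hs) (hψi.const_mul c), integral_const_mul]
    linarith
  have hall : (fun t => w t - c) = fun _ => 0 :=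
    Continuous.ae_eq_iff_eq volume (hwc.sub continuous_const) continuous_const |>.1 hae
  refine ⟨hv, fun x y => ?_⟩
  have hx := congrFun hall x
  have hy := congrFun hall y
  have := hV.sub_eq x y
  simp only [w] at hx hy
  linarith

theorem IsPrimitive.ae_eq {u v v' : ℝ → ℝ} (h : IsPrimitive u v) (h' : IsPrimitive u v') :
    v =ᵐ[volume] v' := by
  filter_upwards [h.ae_hasDerivAt, h'.ae_hasDerivAt] with t h1 h2
  exact h1.unique h2

theorem HasWeakDeriv.isPrimitive_weakDeriv {u v : ℝ → ℝ} (h : HasWeakDeriv u v)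
    (hu : Continuous u) : IsPrimitive u (weakDeriv u) := by
  have hex : ∃ v, HasWeakDeriv u v := ⟨v, h⟩
  have : HasWeakDeriv u (weakDeriv u) := by
    rw [weakDeriv, dif_pos hex]; exact hex.choose_spec
  exact this.isPrimitive hu

theorem IsPrimitive.weakDeriv_ae_eq {u v : ℝ → ℝ} (h : IsPrimitive u v) :
    weakDeriv u =ᵐ[volume] v :=
  (h.hasWeakDeriv.isPrimitive_weakDeriv h.continuous).ae_eq h

theorem memL2loc_of_continuous {u : ℝ → ℝ} (hu : Continuous u) : MemL2loc u := by
  intro K hK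
  obtain ⟨C, hC⟩ := hK.exists_bound_of_continuousOn hu.continuousOn
  have : IsFiniteMeasure (volume.restrict K) := ⟨by
    rw [Measure.restrict_apply_univ]; exact hK.measure_lt_top⟩
  exact MemLp.of_bound hu.aestronglyMeasurable C
    ((ae_restrict_iff' hK.measurableSet).2 (.of_forall hC))

theorem memL2loc_of_bound {v : ℝ → ℝ} (hv : AEStronglyMeasurable v volume) {C : ℝ}
    (hC : ∀ t, |v t| ≤ C) : MemL2loc v := by
  intro K hK
  have : IsFiniteMeasure (volume.restrict K) := ⟨by
    rw [Measure.restrict_apply_univ]; exact hK.measure_lt_top⟩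
  exact MemLp.of_bound hv.restrict C (.of_forall hC)

theorem locallyIntegrable_of_bound {v : ℝ → ℝ} (hv : AEStronglyMeasurable v volume) {C : ℝ}
    (hC : ∀ t, |v t| ≤ C) : LocallyIntegrable v volume := by
  have : LocallyIntegrable (fun _ : ℝ => C) volume := continuous_const.locallyIntegrable
  exact this.mono hv (.of_forall fun t => (hC t).trans (le_abs_self C))

/-! ### The profile h(x) = f₁(√x) and its reciprocal slope. -/

/-- The properties of `x ↦ f₁(√x)`, extended continuously to `ℝ`, on which the analysis rests. -/
structure Profile (h : ℝ → ℝ) : Prop where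
  continuous : Continuous h
  strictAntiOn : StrictAntiOn h (Icc 0 1)
  map_one : h 1 = 0
  contDiffOn : ContDiffOn ℝ 1 h (Ioo 0 1)
  convexOn : ConvexOn ℝ (Ioc 0 1) h
  tendsto_deriv : Tendsto (deriv h) (𝓝[>] 0) atBot

theorem Admissible.exists_profile {f : ℝ → ℝ} (hf : Admissible f) :
    ∃ h : ℝ → ℝ, Profile h ∧ ∀ y ∈ Ico (0 : ℝ) 1, h ((1 - y) ^ 2) = (1 - y) * f y := by
  obtain ⟨ℓ, ℓ₁, hℓ, hℓ₁, hexp⟩ := hf.expansion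
  have hf1 : ∀ {x : ℝ}, 0 < x → x ≤ 1 → √x ∈ Ioc (0 : ℝ) 1 := fun hx hx1 =>
    ⟨Real.sqrt_pos.2 hx, Real.sqrt_le_one.2 hx1⟩
  have htends : Tendsto (f₁ f) (𝓝[>] 0) (𝓝 ℓ) := by
    have h1 : Tendsto (fun s : ℝ => ℓ - ℓ₁ * s) (𝓝[>] 0) (𝓝 ℓ) := by
      have : Tendsto (fun s : ℝ => ℓ - ℓ₁ * s) (𝓝 0) (𝓝 (ℓ - ℓ₁ * 0)) :=
        (continuous_const.sub (continuous_const.mul continuous_id)).tendsto 0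
      rw [mul_zero, sub_zero] at this
      exact this.mono_left nhdsWithin_le_nhds
    have h2 := (hexp.trans_tendsto (tendsto_id.mono_left nhdsWithin_le_nhds)).add h1
    simpa using h2
  have hlt : ∀ s ∈ Ioc (0 : ℝ) 1, f₁ f s < ℓ := by
    intro s hs
    have hs2 : s / 2 ∈ Ioc (0 : ℝ) 1 := ⟨by linarith [hs.1], by linarith [hs.2, hs.1]⟩
    refine (hf.strictAntiOn_f₁ hs2 hs (by linarith [hs.1])).trans_le (ge_of_tendsto htends ?_)
    filter_upwards [Ioo_mem_nhdsGT hs2.1] with r hr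
    exact hf.strictAntiOn_f₁.antitoneOn ⟨hr.1, hr.2.le.trans hs2.2⟩ hs2 hr.2.le
  set g : ℝ → ℝ := fun x => if x = 0 then ℓ else f₁ f (√x)
  have hgpos : ∀ {x : ℝ}, 0 < x → g x = f₁ f (√x) := fun hx => by simp [g, hx.ne']
  have hg : ContinuousOn g (Icc 0 1) := by
    intro x hx
    rcases hx.1.eq_or_lt with rfl | hx0
    · have : ContinuousWithinAt g (Ioi 0) 0 := by
        have e : Tendsto (fun x => f₁ f (√x)) (𝓝[>] 0) (𝓝 ℓ) := by
          refine htends.comp (tendsto_nhdsWithin_iff.2 ⟨?_, ?_⟩)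
          · have := (Real.continuous_sqrt.tendsto 0).mono_left (nhdsWithin_le_nhds (s := Ioi 0))
            simpa using this
          · filter_upwards [self_mem_nhdsWithin] with x hx using Real.sqrt_pos.2 hx
        have e0 : g 0 = ℓ := by simp [g]
        rw [ContinuousWithinAt, e0]
        refine e.congr' ?_
        filter_upwards [self_mem_nhdsWithin] with x hx using (hgpos hx).symm
      exact (continuousWithinAt_Ioi_iff_Ici.1 this).mono Icc_subset_Ici_self
    · have hc : ContinuousWithinAt (fun x => √x * f (1 - √x)) (Icc 0 1 ∩ Ioi 0) x := by
        refine Real.continuous_sqrt.continuousWithinAt.mul ?_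
        refine ContinuousWithinAt.comp (t := Ico 0 1) (hf.contDiffOn.continuousOn _ ?_)
          (continuous_const.sub Real.continuous_sqrt).continuousWithinAt ?_
        · have := hf1 hx0 hx.2
          exact ⟨by linarith [this.2], by linarith [this.1]⟩
        · intro y hy
          have := hf1 hy.2 hy.1.2
          exact ⟨by linarith [this.2], by linarith [this.1]⟩
      have hc' := hc.congr (g := g) (fun y hy => hgpos hy.2) (hgpos hx0)
      exact (continuousWithinAt_inter (Ioi_mem_nhds hx0)).1 hc'
  -- Clamping to [0, 1] gives continuity on all of ℝ without changing the values that matter.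
  set h : ℝ → ℝ := fun x => g (max 0 (min x 1))
  have hh : ∀ x ∈ Icc (0 : ℝ) 1, h x = g x := fun x hx => by simp [h, hx.1, hx.2]
  have hh' : ∀ x ∈ Ioc (0 : ℝ) 1, h x = f₁ f (√x) := fun x hx => by
    rw [hh x ⟨hx.1.le, hx.2⟩, hgpos hx.1]
  have hh0 : h 0 = ℓ := by rw [hh 0 ⟨le_rfl, zero_le_one⟩]; simp [g]
  have hcont : Continuous h := hg.comp_continuous (by fun_prop)
    fun x => ⟨le_max_left _ _, max_le zero_le_one (min_le_right _ _)⟩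
  have hconv : ConvexOn ℝ (Ioc 0 1) h :=
    ⟨convex_Ioc _ _, fun x hx y hy a b ha hb hab => by
      have hxy := convex_Ioc (0 : ℝ) 1 hx hy ha hb hab
      rw [hh' x hx, hh' y hy, hh' _ hxy]
      exact hf.convexOn_f₁_sqrt.2 hx hy ha hb hab⟩
  have hcd : ContDiffOn ℝ 1 h (Ioo 0 1) := by
    have hs : ContDiffOn ℝ 1 Real.sqrt (Ioo 0 1) := fun x hx =>
      (Real.contDiffAt_sqrt hx.1.ne').contDiffWithinAt
    have h2 : ContDiffOn ℝ 1 (fun x => √x * f (1 - √x)) (Ioo 0 1) := by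
      refine hs.mul (hf.contDiffOn.comp (contDiffOn_const.sub hs) fun x hx => ?_)
      have := hf1 hx.1 hx.2.le
      exact ⟨by linarith [this.2], by linarith [this.1]⟩
    exact h2.congr fun x hx => hh' x ⟨hx.1, hx.2.le⟩
  refine ⟨h, ⟨hcont, ?_, ?_, hcd, hconv, ?_⟩, ?_⟩
  · intro x hx y hy hxy
    have hy0 : 0 < y := hx.1.trans_lt hxy
    rcases hx.1.eq_or_lt with rfl | hx0
    · rw [hh0, hh' y ⟨hy0, hy.2⟩]
      exact hlt _ (hf1 hy0 hy.2)
    · rw [hh' y ⟨hy0, hy.2⟩, hh' x ⟨hx0, hx.2⟩]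
      exact hf.strictAntiOn_f₁ (hf1 hx0 hx.2) (hf1 hy0 hy.2) (Real.sqrt_lt_sqrt hx0.le hxy)
  · rw [hh' 1 ⟨one_pos, le_rfl⟩, f₁, Real.sqrt_one, sub_self,
      (hf.eq_zero_iff 0 ⟨le_rfl, one_pos⟩).2 rfl, mul_zero]
  · rw [tendsto_atBot]
    intro M
    -- The difference f₁(s) - ℓ is of order -ℓ₁ s, which lies below any multiple of s². In the
    -- variable s² the chords of `h` from 0 thus have arbitrarily negative slope.
    have hev : ∀ᶠ s in 𝓝[>] (0 : ℝ), (f₁ f s - ℓ) < (M - 1) * s ^ 2 := by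
      filter_upwards [hexp.bound (half_pos hℓ₁),
        Ioo_mem_nhdsGT (show 0 < ℓ₁ / (2 * (|M - 1| + 1)) by positivity)] with s hs hs'
      rw [Real.norm_eq_abs, Real.norm_eq_abs, abs_of_pos hs'.1] at hs
      have h1 := (abs_le.1 hs).2
      have h2 : s * (2 * (|M - 1| + 1)) < ℓ₁ := (lt_div_iff₀ (by positivity)).1 hs'.2
      have h3 := neg_abs_le (M - 1)
      have h4 : -(|M - 1| + 1) * s ^ 2 ≤ (M - 1) * s ^ 2 :=
        mul_le_mul_of_nonneg_right (by linarith) (sq_nonneg s)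
      have h5 : s * (s * (2 * (|M - 1| + 1))) < s * ℓ₁ := mul_lt_mul_of_pos_left h2 hs'.1
      nlinarith
    obtain ⟨s, hs, hs1⟩ := (hev.and (Ioo_mem_nhdsGT one_pos)).exists
    set z := s ^ 2
    have hz0 : 0 < z := pow_pos hs1.1 2
    have hz1 : z < 1 := pow_lt_one₀ hs1.1.le hs1.2 two_ne_zero
    have hz : h z - h 0 < (M - 1) * z := by
      rw [hh' z ⟨hz0, hz1.le⟩, hh0, Real.sqrt_sq hs1.1.le]
      exact hs
    -- The chord bound is moved from 0 to a nearby `x`. The slope M - 1 leaves room for the error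
    -- `x`, since x ≤ z - x once x < z / 2; by convexity the derivative at `x` is at most the chord
    -- slope.
    have hlim : ∀ᶠ x in 𝓝 (0 : ℝ), h z - h x < (M - 1) * (z - x) + x := by
      refine ContinuousAt.eventually_lt (by fun_prop) (by fun_prop) ?_
      simpa using hz
    filter_upwards [Ioo_mem_nhdsGT hz0, nhdsWithin_le_nhds hlim,
      nhdsWithin_le_nhds (Iio_mem_nhds (show (0 : ℝ) < z / 2 by linarith))] with x hx hxl hx2
    have hx1 : x ∈ Ioo (0 : ℝ) 1 := ⟨hx.1, hx.2.trans hz1⟩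
    have hd : DifferentiableAt ℝ h x :=
      (hcd.differentiableOn (by decide)).differentiableAt (Ioo_mem_nhds hx1.1 hx1.2)
    refine (hconv.deriv_le_slope ⟨hx.1, hx1.2.le⟩ ⟨hz0, hz1.le⟩ hx.2 hd).trans ?_
    rw [slope_def_field, div_le_iff₀ (by linarith [hx.2])]
    have : x < z / 2 := hx2
    nlinarith
  · intro y hy
    have h0 : 0 < 1 - y := by linarith [hy.2]
    rw [hh' _ ⟨by positivity, pow_le_one₀ h0.le (by linarith [hy.1])⟩, Real.sqrt_sq h0.le, f₁,
      sub_sub_cancel]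

namespace Profile

variable {h : ℝ → ℝ}

theorem antitoneOn (H : Profile h) : AntitoneOn h (Icc 0 1) := H.strictAntiOn.antitoneOn

theorem pos (H : Profile h) {x : ℝ} (hx : x ∈ Ico (0 : ℝ) 1) : 0 < h x := by
  have := H.strictAntiOn ⟨hx.1, hx.2.le⟩ ⟨zero_le_one, le_rfl⟩ hx.2
  rwa [H.map_one] at this

theorem nonneg (H : Profile h) {x : ℝ} (hx : x ∈ Icc (0 : ℝ) 1) : 0 ≤ h x := by
  have := H.antitoneOn hx ⟨zero_le_one, le_rfl⟩ hx.2
  rwa [H.map_one] at this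

theorem hasDerivAt (H : Profile h) {x : ℝ} (hx : x ∈ Ioo (0 : ℝ) 1) :
    HasDerivAt h (deriv h x) x :=
  ((H.contDiffOn.differentiableOn (by decide)).differentiableAt
    (Ioo_mem_nhds hx.1 hx.2)).hasDerivAt

theorem deriv_neg (H : Profile h) {x : ℝ} (hx : x ∈ Ioo (0 : ℝ) 1) : deriv h x < 0 := by
  refine (H.convexOn.deriv_le_slope ⟨hx.1, hx.2.le⟩ ⟨one_pos, le_rfl⟩ hx.2
    (H.hasDerivAt hx).differentiableAt).trans_lt ?_
  rw [slope_def_field]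
  exact div_neg_of_neg_of_pos
    (by linarith [H.strictAntiOn ⟨hx.1.le, hx.2.le⟩ ⟨zero_le_one, le_rfl⟩ hx.2])
    (by linarith [hx.2])

theorem monotoneOn_deriv (H : Profile h) : MonotoneOn (deriv h) (Ioo 0 1) :=
  (H.convexOn.subset Ioo_subset_Ioc_self (convex_Ioo _ _)).monotoneOn_deriv
    fun _ hx => (H.hasDerivAt hx).differentiableAt

theorem continuousOn_deriv (H : Profile h) : ContinuousOn (deriv h) (Ioo 0 1) :=
  H.contDiffOn.continuousOn_deriv_of_isOpen isOpen_Ioo le_rfl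

theorem exists_eq (H : Profile h) {u : ℝ} (hu : u ∈ Icc 0 (h 0)) : ∃ x ∈ Icc (0 : ℝ) 1, h x = u :=
  intermediate_value_Icc' zero_le_one H.continuous.continuousOn (by rwa [H.map_one])

theorem exists_eq_Ioo (H : Profile h) {u : ℝ} (hu : u ∈ Ioo 0 (h 0)) :
    ∃ x ∈ Ioo (0 : ℝ) 1, h x = u := by
  obtain ⟨x, hx, rfl⟩ := H.exists_eq (Ioo_subset_Icc_self hu)
  refine ⟨x, ⟨hx.1.lt_of_ne ?_, hx.2.lt_of_ne ?_⟩, rfl⟩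
  · rintro rfl; exact hu.2.false
  · rintro rfl; rw [H.map_one] at hu; exact hu.1.false

/-- The reciprocal `1 / |h'|` as a function of the value of `h`. -/
noncomputable def recipSlope (h : ℝ → ℝ) (u : ℝ) : ℝ :=
  if u < h 0 then -(deriv h (Function.invFunOn h (Icc 0 1) u))⁻¹ else 0

theorem invFunOn_eq (H : Profile h) {x : ℝ} (hx : x ∈ Icc (0 : ℝ) 1) :
    Function.invFunOn h (Icc 0 1) (h x) = x :=
  H.strictAntiOn.injOn.leftInvOn_invFunOn hx

theorem recipSlope_apply (H : Profile h) {x : ℝ} (hx : x ∈ Ioo (0 : ℝ) 1) :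
    recipSlope h (h x) = -(deriv h x)⁻¹ := by
  rw [recipSlope, if_pos (H.strictAntiOn ⟨le_rfl, zero_le_one⟩ ⟨hx.1.le, hx.2.le⟩ hx.1),
    H.invFunOn_eq ⟨hx.1.le, hx.2.le⟩]

theorem recipSlope_of_le {u : ℝ} (hu : h 0 ≤ u) : recipSlope h u = 0 :=
  if_neg hu.not_gt

theorem recipSlope_pos (H : Profile h) {u : ℝ} (hu : u ∈ Ioo 0 (h 0)) : 0 < recipSlope h u := by
  obtain ⟨x, hx, rfl⟩ := H.exists_eq_Ioo hu
  rw [H.recipSlope_apply hx, neg_pos]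
  exact inv_lt_zero.2 (H.deriv_neg hx)

theorem recipSlope_nonneg (H : Profile h) {u : ℝ} (hu : 0 < u) : 0 ≤ recipSlope h u := by
  rcases lt_or_ge u (h 0) with h1 | h1
  · exact (H.recipSlope_pos ⟨hu, h1⟩).le
  · rw [recipSlope_of_le h1]

/-- By convexity h' increases with x while h decreases; the extension by 0 beyond h(0) is compatible
because the reciprocal slope is nonnegative. -/
theorem antitoneOn_recipSlope (H : Profile h) : AntitoneOn (recipSlope h) (Ioi 0) := by
  intro u hu v hv huv
  rcases lt_or_ge v (h 0) with h1 | h1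
  · obtain ⟨x, hx, rfl⟩ := H.exists_eq_Ioo ⟨hu, huv.trans_lt h1⟩
    obtain ⟨y, hy, rfl⟩ := H.exists_eq_Ioo ⟨hv, h1⟩
    rw [H.recipSlope_apply hx, H.recipSlope_apply hy, neg_le_neg_iff]
    have hyx : y ≤ x := (H.strictAntiOn.le_iff_ge ⟨hx.1.le, hx.2.le⟩ ⟨hy.1.le, hy.2.le⟩).1 huv
    exact (inv_le_inv_of_neg (H.deriv_neg hx) (H.deriv_neg hy)).2 (H.monotoneOn_deriv hy hx hyx)
  · rw [recipSlope_of_le h1]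
    exact H.recipSlope_nonneg hu

/-- A monotone function whose image is a neighbourhood of the value is continuous there; the sign
change turns the decreasing inverse into an increasing function. -/
theorem continuousAt_invFunOn (H : Profile h) {u : ℝ} (hu : u ∈ Ioo 0 (h 0)) :
    ContinuousAt (Function.invFunOn h (Icc 0 1)) u := by
  set φ := Function.invFunOn h (Icc 0 1)
  have hmono : MonotoneOn (fun u => -φ u) (Ioo 0 (h 0)) := by
    intro u hu v hv huv
    obtain ⟨x, hx, rfl⟩ := H.exists_eq_Ioo hu
    obtain ⟨y, hy, rfl⟩ := H.exists_eq_Ioo hv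
    simp only [φ]
    rw [H.invFunOn_eq (Ioo_subset_Icc_self hx), H.invFunOn_eq (Ioo_subset_Icc_self hy)]
    have := (H.strictAntiOn.le_iff_ge ⟨hx.1.le, hx.2.le⟩ ⟨hy.1.le, hy.2.le⟩).1 huv
    linarith
  have himg : Ioo (-1 : ℝ) 0 ⊆ (fun u => -φ u) '' Ioo 0 (h 0) := by
    intro y hy
    have hy' : -y ∈ Ioo (0 : ℝ) 1 := ⟨by linarith [hy.2], by linarith [hy.1]⟩
    refine ⟨h (-y), ⟨H.pos ⟨hy'.1.le, hy'.2⟩,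
      H.strictAntiOn ⟨le_rfl, zero_le_one⟩ ⟨hy'.1.le, hy'.2.le⟩ hy'.1⟩, ?_⟩
    simp only [φ]
    rw [H.invFunOn_eq (Ioo_subset_Icc_self hy'), neg_neg]
  have hc := continuousAt_of_monotoneOn_of_image_mem_nhds hmono (Ioo_mem_nhds hu.1 hu.2)
    (mem_of_superset (Ioo_mem_nhds (a := -1) (b := 0) ?_ ?_) himg)
  · simpa only [neg_neg] using (show ContinuousAt (fun u => - -φ u) u from hc.neg)
  all_goals
    obtain ⟨x, hx, rfl⟩ := H.exists_eq_Ioo hu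
    simp only [φ]
    rw [H.invFunOn_eq (Ioo_subset_Icc_self hx)]
    linarith [hx.1, hx.2]

theorem continuousOn_recipSlope (H : Profile h) : ContinuousOn (recipSlope h) (Ioi 0) := by
  intro u hu
  have hu : 0 < u := hu
  refine ContinuousAt.continuousWithinAt ?_
  rcases lt_trichotomy u (h 0) with h1 | h1 | h1
  · have hu' : u ∈ Ioo 0 (h 0) := ⟨hu, h1⟩
    have hφ := H.continuousAt_invFunOn hu'
    obtain ⟨x, hx, hxu⟩ := H.exists_eq_Ioo hu'
    have hφx : Function.invFunOn h (Icc 0 1) u = x := by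
      rw [← hxu, H.invFunOn_eq (Ioo_subset_Icc_self hx)]
    have hd : ContinuousAt (deriv h) (Function.invFunOn h (Icc 0 1) u) := by
      rw [hφx]; exact H.continuousOn_deriv.continuousAt (Ioo_mem_nhds hx.1 hx.2)
    have : ContinuousAt (fun u => -(deriv h (Function.invFunOn h (Icc 0 1) u))⁻¹) u := by
      refine ((ContinuousAt.comp hd hφ).inv₀ ?_).neg
      rw [Function.comp_apply, hφx]
      exact (H.deriv_neg hx).ne
    refine this.congr ?_
    filter_upwards [Iio_mem_nhds h1] with v hv
    rw [recipSlope, if_pos (show v < h 0 from hv)]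
  -- The junction with the zero extension is where the blow-up of h' at 0 enters: one point with
  -- steep slope, together with monotonicity, controls all larger arguments.
  · have h00 : recipSlope h u = 0 := recipSlope_of_le h1.ge
    rw [ContinuousAt, h00, Metric.tendsto_nhds]
    intro ε hε
    have hev := H.tendsto_deriv.eventually (eventually_lt_atBot (-ε⁻¹))
    obtain ⟨x, hx, hx1⟩ := (hev.and (Ioo_mem_nhdsGT one_pos)).exists
    have hxu : h x < u := h1 ▸ H.strictAntiOn ⟨le_rfl, zero_le_one⟩ ⟨hx1.1.le, hx1.2.le⟩ hx1.1
    have hxp := H.pos ⟨hx1.1.le, hx1.2⟩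
    filter_upwards [Ioi_mem_nhds hxu] with v hv
    have hv : h x < v := hv
    rw [Real.dist_eq, sub_zero, abs_of_nonneg (H.recipSlope_nonneg (hxp.trans hv))]
    refine (H.antitoneOn_recipSlope hxp (hxp.trans hv) hv.le).trans_lt ?_
    rw [H.recipSlope_apply hx1, ← inv_neg]
    exact inv_lt_of_inv_lt₀ hε (by linarith)
  · refine (continuousAt_const (y := (0 : ℝ))).congr ?_
    filter_upwards [Ioi_mem_nhds h1] with v hv
    rw [recipSlope_of_le (le_of_lt hv)]

end Profile

/-! ### Phase energy and opening as functions of the parameter c. -/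

theorem lintegral_Ioo_ofReal_deriv {g g' : ℝ → ℝ} {a b : ℝ} (hab : a ≤ b)
    (hc : ContinuousOn g (Icc a b)) (hd : ∀ x ∈ Ioo a b, HasDerivAt g (g' x) x)
    (h0 : ∀ x ∈ Ioo a b, 0 ≤ g' x) :
    ∫⁻ x in Ioo a b, ENNReal.ofReal (g' x) = ENNReal.ofReal (g b - g a) := by
  have hi := intervalIntegral.integrableOn_deriv_of_nonneg hc hd h0
  have hi' : IntegrableOn g' (Ioo a b) := hi.mono_set Ioo_subset_Ioc_self
  rw [← ofReal_integral_eq_lintegral_ofReal hi'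
    ((ae_restrict_iff' measurableSet_Ioo).2 (.of_forall h0)), ← integral_Ioc_eq_integral_Ioo,
    ← intervalIntegral.integral_of_le hab,
    intervalIntegral.integral_eq_sub_of_hasDerivAt_of_le hab hc hd
      ((intervalIntegrable_iff_integrableOn_Ioc_of_le hab).2 hi)]

theorem setLIntegral_eq_of_subset {s t : Set ℝ} (hs : MeasurableSet s) (ht : MeasurableSet t)
    (hst : s ⊆ t) {g : ℝ → ℝ≥0∞} (hg : ∀ x ∈ t, x ∉ s → g x = 0) :
    ∫⁻ x in t, g x = ∫⁻ x in s, g x := by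
  rw [← lintegral_indicator ht, ← lintegral_indicator hs]
  refine lintegral_congr fun x => ?_
  by_cases hxs : x ∈ s
  · rw [indicator_of_mem hxs, indicator_of_mem (hst hxs)]
  · rw [indicator_of_notMem hxs]
    by_cases hxt : x ∈ t
    · rw [indicator_of_mem hxt, hg x hxt hxs]
    · rw [indicator_of_notMem hxt]

/-- The cosine of the angle between an optimal curve with parameter `c` and the `x`-axis. -/
noncomputable def cosFactor (h : ℝ → ℝ) (c x : ℝ) : ℝ := √(1 - (c / max (h x) c) ^ 2)

/-- The part of the energy of an optimal curve which is due to `x`. -/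
noncomputable def phaseEnergy (h : ℝ → ℝ) (c : ℝ) : ℝ := ∫ x in (0 : ℝ)..1, cosFactor h c x

/-- The opening of the optimal curve with parameter `c`. -/
noncomputable def opening (h : ℝ → ℝ) (c : ℝ) : ℝ :=
  ∫ θ in (0 : ℝ)..Real.pi / 2, Profile.recipSlope h (c / Real.sin θ)

namespace Profile

variable {h : ℝ → ℝ}

theorem cosFactor_nonneg (c x : ℝ) : 0 ≤ cosFactor h c x := Real.sqrt_nonneg _

theorem cosFactor_le_one (c x : ℝ) : cosFactor h c x ≤ 1 :=
  Real.sqrt_le_one.2 (by linarith [sq_nonneg (c / max (h x) c)])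

theorem cosFactor_zero (x : ℝ) : cosFactor h 0 x = 1 := by simp [cosFactor]

theorem cosFactor_of_le {c x : ℝ} (hc : 0 < c) (hx : h x ≤ c) : cosFactor h c x = 0 := by
  rw [cosFactor, max_eq_right hx, div_self hc.ne']; simp

theorem cosFactor_of_ge {c x : ℝ} (hx : c ≤ h x) : cosFactor h c x = √(1 - (c / h x) ^ 2) := by
  rw [cosFactor, max_eq_left hx]

theorem sq_cosFactor {c x : ℝ} (hc : 0 ≤ c) (hx : c ≤ h x) :
    cosFactor h c x ^ 2 = 1 - (c / h x) ^ 2 := by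
  rw [cosFactor_of_ge hx, Real.sq_sqrt]
  have h1 : c / h x ≤ 1 := div_le_one_of_le₀ hx (hc.trans hx)
  have h0 : 0 ≤ c / h x := div_nonneg hc (hc.trans hx)
  have := pow_le_one₀ (n := 2) h0 h1
  linarith

theorem cosFactor_pos {c x : ℝ} (hc : 0 ≤ c) (hx : c < h x) : 0 < cosFactor h c x := by
  rw [cosFactor_of_ge hx.le, Real.sqrt_pos]
  have h0 : 0 ≤ c / h x := div_nonneg hc (hc.trans hx.le)
  have h1 : c / h x < 1 := (div_lt_one (hc.trans_lt hx)).2 hx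
  have := pow_lt_one₀ h0 h1 two_ne_zero
  linarith

theorem continuous_cosFactor (H : Profile h) {c : ℝ} (hc : 0 ≤ c) :
    Continuous (cosFactor h c) := by
  rcases hc.eq_or_lt with rfl | hc
  · have : cosFactor h 0 = fun _ => 1 := funext cosFactor_zero
    rw [this]; exact continuous_const
  · have h1 : Continuous fun x => max (h x) c := H.continuous.max continuous_const
    exact Real.continuous_sqrt.comp (continuous_const.sub
      ((continuous_const.div h1 fun x => (lt_max_of_lt_right hc).ne').pow 2))

theorem cosFactor_anti {c d x : ℝ} (hc : 0 ≤ c) (hcd : c ≤ d) (hx : 0 < h x) :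
    cosFactor h d x ≤ cosFactor h c x := by
  refine Real.sqrt_le_sqrt ?_
  have hmc : 0 < max (h x) c := lt_max_of_lt_left hx
  have hmd : 0 < max (h x) d := lt_max_of_lt_left hx
  have : c / max (h x) c ≤ d / max (h x) d := by
    rw [div_le_div_iff₀ hmc hmd]
    rcases le_total (h x) c with h1 | h1
    · rw [max_eq_right h1, max_eq_right (h1.trans hcd), mul_comm]
    · rw [max_eq_left h1]
      rcases le_total (h x) d with h2 | h2
      · rw [max_eq_right h2, mul_comm]; exact mul_le_mul_of_nonneg_left h1 (hc.trans hcd)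
      · rw [max_eq_left h2]; exact mul_le_mul_of_nonneg_right hcd hx.le
  have h0 : 0 ≤ c / max (h x) c := div_nonneg hc hmc.le
  have := pow_le_pow_left₀ h0 this 2
  linarith

theorem phaseEnergy_zero : phaseEnergy h 0 = 1 := by
  simp [phaseEnergy, cosFactor_zero]

theorem phaseEnergy_nonneg (c : ℝ) : 0 ≤ phaseEnergy h c :=
  intervalIntegral.integral_nonneg zero_le_one fun x _ => cosFactor_nonneg c x

theorem phaseEnergy_le_one (H : Profile h) {c : ℝ} (hc : 0 ≤ c) : phaseEnergy h c ≤ 1 := by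
  have := intervalIntegral.integral_mono_on (μ := volume) zero_le_one
    ((H.continuous_cosFactor hc).intervalIntegrable 0 1)
    (continuous_const.intervalIntegrable 0 1) fun x _ => cosFactor_le_one c x
  simpa [phaseEnergy] using this

theorem phaseEnergy_eq_integral (H : Profile h) {X : ℝ} (hX : X ∈ Icc (0 : ℝ) 1) :
    phaseEnergy h (h X) = ∫ x in (0 : ℝ)..X, cosFactor h (h X) x := by
  have hi := fun a b => (H.continuous_cosFactor (H.nonneg hX)).intervalIntegrable
    (μ := volume) a b
  rw [phaseEnergy, ← intervalIntegral.integral_add_adjacent_intervals (hi 0 X) (hi X 1)]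
  rcases hX.2.eq_or_lt with rfl | hX1
  · simp
  have : ∫ x in X..1, cosFactor h (h X) x = ∫ x in X..1, (0 : ℝ) := by
    refine intervalIntegral.integral_congr fun x hx => ?_
    rw [uIcc_of_le hX.2] at hx
    exact cosFactor_of_le (H.pos ⟨hX.1, hX1⟩) (H.antitoneOn hX ⟨hX.1.trans hx.1, hx.2⟩ hx.1)
  rw [this]; simp

theorem sin_pos_of_mem {θ : ℝ} (hθ : θ ∈ Ioc 0 (Real.pi / 2)) : 0 < Real.sin θ :=
  Real.sin_pos_of_pos_of_lt_pi hθ.1 (by linarith [hθ.2, Real.pi_pos])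

theorem le_div_sin {c θ : ℝ} (hc : 0 ≤ c) (hθ : θ ∈ Ioc 0 (Real.pi / 2)) : c ≤ c / Real.sin θ := by
  rw [le_div_iff₀ (sin_pos_of_mem hθ)]
  exact mul_le_of_le_one_right hc (Real.sin_le_one θ)

theorem aestronglyMeasurable_recipSlope_div_sin (H : Profile h) {c : ℝ} (hc : 0 < c) :
    AEStronglyMeasurable (fun θ => recipSlope h (c / Real.sin θ))
      (volume.restrict (Ioc 0 (Real.pi / 2))) := by
  refine ContinuousOn.aestronglyMeasurable ?_ measurableSet_Ioc
  exact H.continuousOn_recipSlope.comp (continuousOn_const.div Real.continuous_sin.continuousOn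
    fun θ hθ => (sin_pos_of_mem hθ).ne') fun θ hθ => div_pos hc (sin_pos_of_mem hθ)

theorem recipSlope_div_sin_mem (H : Profile h) {c d θ : ℝ} (hd : 0 < d) (hdc : d ≤ c)
    (hθ : θ ∈ Ioc 0 (Real.pi / 2)) :
    recipSlope h (c / Real.sin θ) ∈ Icc 0 (recipSlope h d) := by
  have h1 := hdc.trans (le_div_sin (hd.le.trans hdc) hθ)
  exact ⟨H.recipSlope_nonneg (hd.trans_le h1),
    H.antitoneOn_recipSlope hd (hd.trans_le h1) h1⟩

theorem intervalIntegrable_recipSlope (H : Profile h) {c : ℝ} (hc : 0 < c) :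
    IntervalIntegrable (fun θ => recipSlope h (c / Real.sin θ)) volume 0 (Real.pi / 2) := by
  have hπ : (0 : ℝ) ≤ Real.pi / 2 := by positivity
  refine (intervalIntegrable_const (c := recipSlope h c)).mono_fun' ?_ ?_
  · rw [uIoc_of_le hπ]
    exact H.aestronglyMeasurable_recipSlope_div_sin hc
  · refine (ae_restrict_iff' measurableSet_uIoc).2 (.of_forall fun θ hθ => ?_)
    rw [uIoc_of_le hπ] at hθ
    have := H.recipSlope_div_sin_mem hc le_rfl hθ
    simp only [Real.norm_eq_abs, abs_of_nonneg this.1]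
    exact this.2

theorem opening_nonneg (H : Profile h) {c : ℝ} (hc : 0 < c) : 0 ≤ opening h c := by
  rw [opening, intervalIntegral.integral_of_le (by positivity)]
  exact setIntegral_nonneg measurableSet_Ioc fun θ hθ =>
    (H.recipSlope_div_sin_mem hc le_rfl hθ).1

theorem opening_map_zero (H : Profile h) : opening h (h 0) = 0 := by
  have h0 : 0 < h 0 := H.pos ⟨le_rfl, one_pos⟩
  rw [opening, intervalIntegral.integral_of_le (by positivity)]
  exact setIntegral_eq_zero_of_forall_eq_zero fun θ hθ =>
    recipSlope_of_le (le_div_sin h0.le hθ)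

/-- In the angular form the domain is fixed and the integrand is bounded locally uniformly in `c`,
so dominated convergence applies. The form in x has a moving singular endpoint. -/
theorem continuousOn_opening (H : Profile h) : ContinuousOn (opening h) (Ioi 0) := by
  intro c hc
  have hc : 0 < c := hc
  have hπ : (0 : ℝ) ≤ Real.pi / 2 := by positivity
  have hev : ∀ᶠ d in 𝓝 c, c / 2 < d := Ioi_mem_nhds (by linarith)
  refine (intervalIntegral.continuousAt_of_dominated_interval
    (bound := fun _ => recipSlope h (c / 2)) ?_ ?_ intervalIntegrable_const
    (.of_forall fun θ hθ => ?_)).continuousWithinAt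
  · filter_upwards [hev] with d hd
    rw [uIoc_of_le hπ]
    exact H.aestronglyMeasurable_recipSlope_div_sin (by linarith)
  · filter_upwards [hev] with d hd
    refine .of_forall fun θ hθ => ?_
    rw [uIoc_of_le hπ] at hθ
    have := H.recipSlope_div_sin_mem (half_pos hc) hd.le hθ
    simp only [Real.norm_eq_abs, abs_of_nonneg this.1]
    exact this.2
  · rw [uIoc_of_le hπ] at hθ
    have h1 : 0 < c / Real.sin θ := div_pos hc (sin_pos_of_mem hθ)
    exact ContinuousAt.comp (f := fun d => d / Real.sin θ)
      (H.continuousOn_recipSlope.continuousAt (Ioi_mem_nhds h1))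
      (continuousAt_id.div_const _)

/-- The integrand is only weakly monotone in the parameter. Strictness comes from the angles with c
/ h(0) < sin θ < d / h(0): there the term of `d` is already 0 while that of `c` is positive. -/
theorem strictAntiOn_opening (H : Profile h) : StrictAntiOn (opening h) (Ioc 0 (h 0)) := by
  intro c hc d hd hcd
  have hπ : (0 : ℝ) ≤ Real.pi / 2 := by positivity
  have h0 : 0 < h 0 := H.pos ⟨le_rfl, one_pos⟩
  rw [← sub_pos, opening, opening, ← intervalIntegral.integral_sub
    (H.intervalIntegrable_recipSlope hc.1) (H.intervalIntegrable_recipSlope hd.1),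
    intervalIntegral.integral_of_le hπ, setIntegral_pos_iff_support_of_nonneg_ae]
  · have hsub : Ioo (Real.arcsin (c / h 0)) (Real.arcsin (d / h 0)) ⊆
        (Function.support fun θ =>
          recipSlope h (c / Real.sin θ) - recipSlope h (d / Real.sin θ)) ∩
          Ioc 0 (Real.pi / 2) := by
      intro θ hθ
      have hθ' : θ ∈ Ioc 0 (Real.pi / 2) :=
        ⟨(Real.arcsin_nonneg.2 (div_pos hc.1 h0).le).trans_lt hθ.1,
          hθ.2.le.trans (Real.arcsin_le_pi_div_two _)⟩
      refine ⟨?_, hθ'⟩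
      have hs := sin_pos_of_mem hθ'
      have hmem : θ ∈ Ioc (-(Real.pi / 2)) (Real.pi / 2) := ⟨by linarith [hθ'.1], hθ'.2⟩
      have h1 : c / h 0 < Real.sin θ :=
        (Real.arcsin_lt_iff_lt_sin' hmem).1 hθ.1
      have h2 : Real.sin θ < d / h 0 :=
        (Real.lt_arcsin_iff_sin_lt' ⟨by linarith [hθ'.1],
          hθ.2.trans_le (Real.arcsin_le_pi_div_two _)⟩).1 hθ.2
      have h3 : c / Real.sin θ < h 0 := by
        rw [div_lt_iff₀ hs, mul_comm, ← div_lt_iff₀ h0]; exact h1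
      have h4 : h 0 ≤ d / Real.sin θ := by
        rw [le_div_iff₀ hs, mul_comm, ← le_div_iff₀ h0]; exact h2.le
      rw [Function.mem_support, recipSlope_of_le h4, sub_zero]
      exact (H.recipSlope_pos ⟨div_pos hc.1 hs, h3⟩).ne'
    refine lt_of_lt_of_le ?_ (measure_mono hsub)
    rw [Real.volume_Ioo, ENNReal.ofReal_pos, sub_pos]
    refine Real.strictMonoOn_arcsin ⟨?_, ?_⟩ ⟨?_, ?_⟩ (div_lt_div_of_pos_right hcd h0)
    · linarith [div_pos hc.1 h0]
    · exact (div_le_one h0).2 hc.2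
    · linarith [div_pos hd.1 h0]
    · exact (div_le_one h0).2 hd.2
  · refine (ae_restrict_iff' measurableSet_Ioc).2 (.of_forall fun θ hθ => ?_)
    have hs := sin_pos_of_mem hθ
    exact sub_nonneg.2 (H.antitoneOn_recipSlope (div_pos hc.1 hs) (div_pos hd.1 hs)
      (div_le_div_of_nonneg_right hcd.le hs.le))
  · exact ((H.intervalIntegrable_recipSlope hc.1).sub (H.intervalIntegrable_recipSlope hd.1)).1

/-- Substituting sin θ = c / h(x) absorbs the factor k, which vanishes at X. Angles below arcsin(c /
h(0)) correspond to no x, and there the zero extension of `recipSlope` contributes nothing. -/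
theorem lintegral_eq_opening (H : Profile h) {X : ℝ} (hX : X ∈ Ico (0 : ℝ) 1) :
    ∫⁻ x in Ioo 0 X, ENNReal.ofReal (h X / (h x ^ 2 * cosFactor h (h X) x)) =
      ENNReal.ofReal (opening h (h X)) := by
  set c := h X with hcdef
  have hc : 0 < c := H.pos hX
  have hX' : X ∈ Icc (0 : ℝ) 1 := ⟨hX.1, hX.2.le⟩
  have hπ : (0 : ℝ) ≤ Real.pi / 2 := by positivity
  have h0 : 0 < h 0 := H.pos ⟨le_rfl, one_pos⟩
  have hmem : ∀ x ∈ Ioo 0 X, x ∈ Ioo (0 : ℝ) 1 := fun x hx => ⟨hx.1, hx.2.trans hX.2⟩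
  have hcx : ∀ x ∈ Ioo 0 X, c < h x := fun x hx =>
    H.strictAntiOn (Ioo_subset_Icc_self (hmem x hx)) hX' hx.2
  have hr : ∀ x ∈ Ioo 0 X, 0 < c / h x ∧ c / h x < 1 := fun x hx =>
    ⟨div_pos hc (hc.trans (hcx x hx)), (div_lt_one (hc.trans (hcx x hx))).2 (hcx x hx)⟩
  set Θ : ℝ → ℝ := fun x => Real.arcsin (c / h x)
  set Θ' : ℝ → ℝ := fun x => -(c * deriv h x) / (h x ^ 2 * cosFactor h c x)
  have hderiv : ∀ x ∈ Ioo 0 X, HasDerivWithinAt Θ (Θ' x) (Ioo 0 X) x := by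
    intro x hx
    have hpx := hc.trans (hcx x hx)
    have hd := ((H.hasDerivAt (hmem x hx)).fun_inv hpx.ne').const_mul c
    have ha := Real.hasDerivAt_arcsin (x := c / h x) (by linarith [(hr x hx).1])
      (hr x hx).2.ne
    have := HasDerivAt.comp x (h := fun y => c * (h y)⁻¹) (h₂ := Real.arcsin) (by
      rw [← div_eq_mul_inv]; exact ha) hd
    refine (this.congr_deriv ?_).hasDerivWithinAt
    have hk := cosFactor_pos hc.le (hcx x hx)
    simp only [Θ']
    rw [← cosFactor_of_ge (hcx x hx).le]
    field_simp
  have hinj : InjOn Θ (Ioo 0 X) := by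
    intro x hx y hy hxy
    have h1 := (Real.arcsin_inj (by linarith [(hr x hx).1]) (hr x hx).2.le
      (by linarith [(hr y hy).1]) (hr y hy).2.le).1 hxy
    have hpx := hc.trans (hcx x hx)
    have hpy := hc.trans (hcx y hy)
    rw [div_eq_div_iff hpx.ne' hpy.ne'] at h1
    exact (H.strictAntiOn.injOn (Ioo_subset_Icc_self (hmem y hy))
      (Ioo_subset_Icc_self (hmem x hx)) (mul_left_cancel₀ hc.ne' h1)).symm
  have himg : Θ '' Ioo 0 X = Ioo (Real.arcsin (c / h 0)) (Real.pi / 2) := by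
    ext θ
    constructor
    · rintro ⟨x, hx, rfl⟩
      have hx0 : h x < h 0 := H.strictAntiOn ⟨le_rfl, zero_le_one⟩
        (Ioo_subset_Icc_self (hmem x hx)) hx.1
      refine ⟨Real.strictMonoOn_arcsin ⟨by linarith [div_pos hc h0], ?_⟩
        ⟨by linarith [(hr x hx).1], (hr x hx).2.le⟩
        (div_lt_div_of_pos_left hc (hc.trans (hcx x hx)) hx0), ?_⟩
      · exact (div_le_one h0).2 (H.antitoneOn ⟨le_rfl, zero_le_one⟩ hX' hX.1)
      · exact Real.arcsin_lt_pi_div_two.2 (hr x hx).2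
    · intro hθ
      have hθ' : θ ∈ Ioc 0 (Real.pi / 2) :=
        ⟨(Real.arcsin_nonneg.2 (div_pos hc h0).le).trans_lt hθ.1, hθ.2.le⟩
      have hs := sin_pos_of_mem hθ'
      have h1 : c / h 0 < Real.sin θ :=
        (Real.arcsin_lt_iff_lt_sin' ⟨by linarith [hθ'.1], hθ'.2⟩).1 hθ.1
      have h2 : Real.sin θ < 1 := by
        rw [← Real.sin_pi_div_two]
        exact Real.sin_lt_sin_of_lt_of_le_pi_div_two (by linarith [hθ'.1]) le_rfl hθ.2
      have h3 : c / Real.sin θ < h 0 := by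
        rw [div_lt_iff₀ hs, mul_comm, ← div_lt_iff₀ h0]; exact h1
      obtain ⟨x, hx, hxe⟩ := H.exists_eq_Ioo ⟨div_pos hc hs, h3⟩
      have hcs : c < c / Real.sin θ := by
        rw [lt_div_iff₀ hs]; exact mul_lt_of_lt_one_right hc h2
      refine ⟨x, ⟨hx.1, (H.strictAntiOn.lt_iff_gt hX' (Ioo_subset_Icc_self hx)).1
        (by rw [hxe]; exact hcs)⟩, ?_⟩
      simp only [Θ]
      rw [hxe, div_div_cancel₀ hc.ne', Real.arcsin_sin (by linarith [hθ'.1]) hθ'.2]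
  have hcv := lintegral_image_eq_lintegral_abs_deriv_mul measurableSet_Ioo hderiv hinj
    (fun θ => ENNReal.ofReal (recipSlope h (c / Real.sin θ)))
  have hlhs : ∫⁻ x in Ioo 0 X, ENNReal.ofReal |Θ' x| *
      ENNReal.ofReal (recipSlope h (c / Real.sin (Θ x))) =
      ∫⁻ x in Ioo 0 X, ENNReal.ofReal (c / (h x ^ 2 * cosFactor h c x)) := by
    refine setLIntegral_congr_fun measurableSet_Ioo fun x hx => ?_
    have hpx := hc.trans (hcx x hx)
    have hk := cosFactor_pos hc.le (hcx x hx)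
    have hneg := H.deriv_neg (hmem x hx)
    have hsin : c / Real.sin (Θ x) = h x := by
      simp only [Θ]
      rw [Real.sin_arcsin (by linarith [(hr x hx).1]) (hr x hx).2.le, div_div_cancel₀ hc.ne']
    have habs : |Θ' x| = Θ' x := abs_of_nonneg
      (div_nonneg (by nlinarith) (by positivity))
    rw [hsin, H.recipSlope_apply (hmem x hx), habs, ← ENNReal.ofReal_mul (by
      rw [← habs]; exact abs_nonneg _)]
    congr 1
    simp only [Θ']
    have := hneg.ne
    field_simp
  rw [← hlhs, ← hcv, himg, opening, intervalIntegral.integral_of_le hπ,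
    ofReal_integral_eq_lintegral_ofReal (H.intervalIntegrable_recipSlope hc).1
      ((ae_restrict_iff' measurableSet_Ioc).2 (.of_forall fun θ hθ =>
        (H.recipSlope_div_sin_mem hc le_rfl hθ).1)), ← setLIntegral_congr Ioo_ae_eq_Ioc]
  have ha0 : 0 ≤ Real.arcsin (c / h 0) := Real.arcsin_nonneg.2 (div_pos hc h0).le
  refine (setLIntegral_eq_of_subset measurableSet_Ioo measurableSet_Ioo
    (Ioo_subset_Ioo_left ha0) fun θ hθ hθn => ?_).symm
  have hs := sin_pos_of_mem (Ioo_subset_Ioc_self hθ)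
  have hle : θ ≤ Real.arcsin (c / h 0) := not_lt.1 fun hc => hθn ⟨hc, hθ.2⟩
  rw [Real.le_arcsin_iff_sin_le' ⟨by linarith [hθ.1], hθ.2.le⟩, le_div_iff₀ h0, mul_comm,
    ← le_div_iff₀ hs] at hle
  rw [recipSlope_of_le hle, ENNReal.ofReal_zero]

end Profile

/-! ### The derivative of the phase energy and the minimization in c. -/

/-- For fixed u = h(x) this is the fundamental theorem for e ↦ -√(1 - (e/u)²), which is constant
once e ≥ u. It is the inner integral in the proof that K' = -A. -/
theorem lintegral_deriv_sqrt_one_sub_sq {u c d : ℝ} (hu : 0 < u) (hc : 0 ≤ c) (hcd : c ≤ d) :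
    ∫⁻ e in Ioo c d, (if e < u then
      ENNReal.ofReal (e / (u ^ 2 * √(1 - (e / max u e) ^ 2))) else 0) =
    ENNReal.ofReal (√(1 - (c / max u c) ^ 2) - √(1 - (d / max u d) ^ 2)) := by
  have hzero : ∀ {e : ℝ}, u ≤ e → √(1 - (e / max u e) ^ 2) = 0 := fun he => by
    rw [max_eq_right he, div_self (hu.trans_le he).ne']; simp
  rcases le_or_gt u c with huc | huc
  · rw [hzero huc, hzero (huc.trans hcd), sub_self, ENNReal.ofReal_zero]
    refine (setLIntegral_congr_fun measurableSet_Ioo fun e he => ?_).trans lintegral_zero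
    exact if_neg (by linarith [he.1])
  · set b := min d u
    have hcb : c ≤ b := le_min hcd huc.le
    have hend : √(1 - (d / max u d) ^ 2) = √(1 - (b / u) ^ 2) := by
      rcases le_total d u with h1 | h1
      · simp only [b]; rw [min_eq_left h1, max_eq_left h1]
      · simp only [b]; rw [min_eq_right h1, hzero h1, div_self hu.ne']; simp
    rw [hend, max_eq_left huc.le,
      setLIntegral_eq_of_subset (s := Ioo c b) measurableSet_Ioo measurableSet_Ioo
        (Ioo_subset_Ioo_right (min_le_left _ _))]
    · have key := lintegral_Ioo_ofReal_deriv (g := fun e => -√(1 - (e / u) ^ 2))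
        (g' := fun e => e / (u ^ 2 * √(1 - (e / u) ^ 2))) hcb
        (by fun_prop) (fun e he => ?_) (fun e he => ?_)
      · rw [neg_sub_neg] at key
        rw [← key]
        refine setLIntegral_congr_fun measurableSet_Ioo fun e he => ?_
        have heu : e < u := he.2.trans_le (min_le_right _ _)
        simp only [if_pos heu, max_eq_left heu.le]
      · have heu : e < u := he.2.trans_le (min_le_right _ _)
        have he0 : 0 ≤ e := hc.trans he.1.le
        have hlt : (e / u) ^ 2 < 1 :=
          pow_lt_one₀ (div_nonneg he0 hu.le) ((div_lt_one hu).2 heu) two_ne_zero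
        have hs : 0 < √(1 - (e / u) ^ 2) := Real.sqrt_pos.2 (by linarith)
        have h1 : HasDerivAt (fun e : ℝ => 1 - (e / u) ^ 2)
            (0 - (2 : ℕ) * (e / u) ^ (2 - 1) * (1 / u)) e :=
          (hasDerivAt_const e (1 : ℝ)).sub (((hasDerivAt_id e).div_const u).pow 2)
        refine ((h1.sqrt (by linarith)).neg).congr_deriv ?_
        generalize √(1 - (e / u) ^ 2) = S at hs ⊢
        push_cast
        field_simp
        norm_num
      · have he0 : 0 ≤ e := hc.trans he.1.le
        exact div_nonneg he0 (by positivity)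
    · intro e he hen
      refine if_neg fun heu => hen ⟨he.1, lt_min he.2 heu⟩

namespace Profile

variable {h : ℝ → ℝ}

/-- This is K' = -A in integrated form. Writing A(e) as an integral over x and exchanging the
integrals by Tonelli avoids differentiating under the integral sign. -/
theorem lintegral_opening (H : Profile h) {c d : ℝ} (hc : 0 ≤ c) (hcd : c ≤ d) (hd : d ≤ h 0) :
    ∫⁻ e in Ioo c d, ENNReal.ofReal (opening h e) =
      ENNReal.ofReal (phaseEnergy h c - phaseEnergy h d) := by
  set p : ℝ → ℝ → ℝ≥0∞ := fun e x =>
    if e < h x then ENNReal.ofReal (e / (h x ^ 2 * cosFactor h e x)) else 0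
  have hmeas : Measurable (Function.uncurry p) := by
    have hm := H.continuous.measurable
    have h1 : Measurable fun q : ℝ × ℝ => h q.2 := hm.comp measurable_snd
    refine Measurable.ite (measurableSet_lt measurable_fst h1) ?_ measurable_const
    refine ENNReal.measurable_ofReal.comp (measurable_fst.div ((h1.pow_const 2).mul ?_))
    exact Real.continuous_sqrt.measurable.comp
      (((measurable_fst.div (h1.max measurable_fst)).pow_const 2).const_sub 1)
  have hinner : ∀ e ∈ Ioo c d, ENNReal.ofReal (opening h e) = ∫⁻ x in Ioo 0 1, p e x := by
    intro e he
    obtain ⟨X, hX, rfl⟩ := H.exists_eq_Ioo ⟨hc.trans_lt he.1, he.2.trans_le hd⟩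
    rw [← H.lintegral_eq_opening ⟨hX.1.le, hX.2⟩,
      setLIntegral_eq_of_subset (s := Ioo 0 X) measurableSet_Ioo measurableSet_Ioo
        (Ioo_subset_Ioo_right hX.2.le) (g := p (h X))]
    · refine setLIntegral_congr_fun measurableSet_Ioo fun x hx => ?_
      simp only [p]
      rw [if_pos (H.strictAntiOn ⟨hx.1.le, (hx.2.trans hX.2).le⟩ ⟨hX.1.le, hX.2.le⟩ hx.2)]
    · intro x hx hxn
      refine if_neg fun hlt => hxn ⟨hx.1, ?_⟩
      exact (H.strictAntiOn.lt_iff_gt ⟨hX.1.le, hX.2.le⟩ ⟨hx.1.le, hx.2.le⟩).1 hlt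
  rw [setLIntegral_congr_fun measurableSet_Ioo hinner, lintegral_lintegral_swap hmeas.aemeasurable]
  have houter : ∀ x ∈ Ioo (0 : ℝ) 1, ∫⁻ e in Ioo c d, p e x =
      ENNReal.ofReal (cosFactor h c x - cosFactor h d x) := fun x hx =>
    lintegral_deriv_sqrt_one_sub_sq (H.pos ⟨hx.1.le, hx.2⟩) hc hcd
  have hi := fun {e : ℝ} (he : 0 ≤ e) => (H.continuous_cosFactor he).intervalIntegrable
    (μ := volume) 0 1
  have hd0 := hc.trans hcd
  rw [setLIntegral_congr_fun measurableSet_Ioo houter, phaseEnergy, phaseEnergy,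
    ← intervalIntegral.integral_sub (hi hc) (hi hd0),
    intervalIntegral.integral_of_le zero_le_one, integral_Ioc_eq_integral_Ioo,
    ofReal_integral_eq_lintegral_ofReal]
  · exact (((hi hc).sub (hi hd0)).1).mono_set Ioo_subset_Ioc_self
  · refine (ae_restrict_iff' measurableSet_Ioo).2 (.of_forall fun x hx => ?_)
    exact sub_nonneg.2 (cosFactor_anti hc hcd (H.pos ⟨hx.1.le, hx.2⟩))

theorem phaseEnergy_anti (H : Profile h) {c d : ℝ} (hc : 0 ≤ c) (hcd : c ≤ d) :
    phaseEnergy h d ≤ phaseEnergy h c := by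
  refine intervalIntegral.integral_mono_on_of_le_Ioo zero_le_one
    ((H.continuous_cosFactor (hc.trans hcd)).intervalIntegrable 0 1)
    ((H.continuous_cosFactor hc).intervalIntegrable 0 1) fun x hx => ?_
  exact cosFactor_anti hc hcd (H.pos ⟨hx.1.le, hx.2⟩)

theorem phaseEnergy_sub_le (H : Profile h) {c d M : ℝ} (hc : 0 ≤ c) (hcd : c ≤ d) (hd : d ≤ h 0)
    (hM : ∀ e ∈ Ioo c d, opening h e ≤ M) (hM0 : 0 ≤ M) :
    phaseEnergy h c - phaseEnergy h d ≤ (d - c) * M := by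
  have h1 : ∫⁻ e in Ioo c d, ENNReal.ofReal (opening h e) ≤
      ∫⁻ e in Ioo c d, ENNReal.ofReal M :=
    setLIntegral_mono measurable_const fun e he => ENNReal.ofReal_le_ofReal (hM e he)
  rw [H.lintegral_opening hc hcd hd, setLIntegral_const, Real.volume_Ioo,
    ← ENNReal.ofReal_mul hM0, ENNReal.ofReal_le_ofReal_iff
      (mul_nonneg hM0 (sub_nonneg.2 hcd))] at h1
  linarith

theorem le_phaseEnergy_sub (H : Profile h) {c d : ℝ} (hc : 0 ≤ c) (hcd : c < d) (hd : d ≤ h 0) :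
    (d - c) * opening h d ≤ phaseEnergy h c - phaseEnergy h d := by
  have hd0 := hc.trans_lt hcd
  have h1 : ∫⁻ e in Ioo c d, ENNReal.ofReal (opening h d) ≤
      ∫⁻ e in Ioo c d, ENNReal.ofReal (opening h e) := by
    refine setLIntegral_mono' measurableSet_Ioo fun e he => ENNReal.ofReal_le_ofReal ?_
    exact H.strictAntiOn_opening.antitoneOn ⟨hc.trans_lt he.1, he.2.le.trans hd⟩ ⟨hd0, hd⟩ he.2.le
  rw [H.lintegral_opening hc hcd.le hd, setLIntegral_const, Real.volume_Ioo,
    ← ENNReal.ofReal_mul (H.opening_nonneg hd0), ENNReal.ofReal_le_ofReal_iff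
      (sub_nonneg.2 (H.phaseEnergy_anti hc hcd.le))] at h1
  linarith

/-- Strict convexity of K with slope -A(c) at `c`. The interval between `c` and `d` is halved: on
the half away from `c` the slope is strictly separated from -A(c), on the other half the weak bound
suffices. -/
theorem opening_mul_add_phaseEnergy_lt (H : Profile h) {c d : ℝ} (hc : c ∈ Ioc 0 (h 0))
    (hd : d ∈ Icc 0 (h 0)) (hcd : d ≠ c) :
    opening h c * c + phaseEnergy h c < opening h c * d + phaseEnergy h d := by
  set e := (c + d) / 2
  rcases hcd.lt_or_gt with hlt | hlt
  · have h1 : d < e := by simp only [e]; linarith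
    have h2 : e < c := by simp only [e]; linarith
    have he : 0 < e := hd.1.trans_lt h1
    have h3 := H.le_phaseEnergy_sub hd.1 h1 (h2.le.trans hc.2)
    have h4 := H.le_phaseEnergy_sub he.le h2 hc.2
    have h5 := H.strictAntiOn_opening ⟨he, h2.le.trans hc.2⟩ hc h2
    nlinarith
  · have h1 : c < e := by simp only [e]; linarith
    have h2 : e < d := by simp only [e]; linarith
    have he : 0 < e := hc.1.trans h1
    have hanti := H.strictAntiOn_opening.antitoneOn
    have h3 := H.phaseEnergy_sub_le hc.1.le h1.le (h2.le.trans hd.2)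
      (fun x hx => hanti hc ⟨hc.1.trans hx.1, hx.2.le.trans (h2.le.trans hd.2)⟩ hx.1.le)
      (H.opening_nonneg hc.1)
    have h4 := H.phaseEnergy_sub_le he.le h2.le hd.2
      (fun x hx => hanti ⟨he, h2.le.trans hd.2⟩ ⟨he.trans hx.1, hx.2.le.trans hd.2⟩ hx.1.le)
      (H.opening_nonneg he)
    have h5 := H.strictAntiOn_opening hc ⟨he, h2.le.trans hd.2⟩ h1
    nlinarith

theorem one_le_mul_add_phaseEnergy (H : Profile h) {s c : ℝ} (hs : 0 ≤ s)
    (hA : ∀ e ∈ Ioc 0 (h 0), opening h e ≤ s) (hc : c ∈ Icc 0 (h 0)) :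
    1 ≤ s * c + phaseEnergy h c := by
  have := H.phaseEnergy_sub_le le_rfl hc.1 hc.2
    (fun e he => hA e ⟨he.1, he.2.le.trans hc.2⟩) hs
  rw [phaseEnergy_zero] at this
  linarith

end Profile

/-! ### The decay equation and integrals along its solution. -/

/-- `Z` solves `Z' = -1 / r(Z)` on `(0, ∞)`, starting from the value `X` and decaying to `0`. -/
structure IsDecay (r : ℝ → ℝ) (X : ℝ) (Z : ℝ → ℝ) : Prop where
  continuous : Continuous Z
  eq_of_nonpos : ∀ t ≤ 0, Z t = X
  mem : ∀ t, 0 < t → Z t ∈ Ioo 0 X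
  hasDerivAt : ∀ t, 0 < t → HasDerivAt Z (-(r (Z t))⁻¹) t
  image : Z '' Ioi 0 = Ioo 0 X
  injOn : InjOn Z (Ioi 0)
  tendsto : Tendsto Z atTop (𝓝 0)
  unique : ∀ y : ℝ → ℝ, ContinuousOn y (Ici 0) → y 0 = X → (∀ t, 0 < t → y t ∈ Ioo 0 X) →
    (∀ t, 0 < t → HasDerivAt y (-(r (y t))⁻¹) t) → ∀ t, 0 ≤ t → y t = Z t

/-- T(x) = ∫ₓ^X r is the time of descent from X to x, and Z is its inverse. Integrability at X lets
the descent start although r may blow up there; r ≥ 1/x gives T ≥ log(X/x), so 0 is not reached in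
finite time. Along a competing solution T(y(t)) - t is constant. -/
theorem exists_isDecay {r : ℝ → ℝ} {X : ℝ} (hX : 0 < X) (hr : ContinuousOn r (Ioo 0 X))
    (hint : ∀ x ∈ Ioo 0 X, IntervalIntegrable r volume x X)
    (hge : ∀ x ∈ Ioo 0 X, 1 / x ≤ r x) : ∃ Z : ℝ → ℝ, IsDecay r X Z := by
  have hrpos : ∀ x ∈ Ioo 0 X, 0 < r x := fun x hx => (one_div_pos.2 hx.1).trans_le (hge x hx)
  set T : ℝ → ℝ := fun x => ∫ ξ in x..X, r ξ
  have hTX : T X = 0 := by simp [T]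
  have hint' : ∀ x ∈ Ioc 0 X, IntervalIntegrable r volume x X := fun x hx => by
    rcases hx.2.eq_or_lt with rfl | hlt
    · exact IntervalIntegrable.refl
    · exact hint x ⟨hx.1, hlt⟩
  have hTd : ∀ x ∈ Ioo 0 X, HasDerivAt T (-r x) x := fun x hx =>
    intervalIntegral.integral_hasDerivAt_left (hint x hx)
      (hr.stronglyMeasurableAtFilter isOpen_Ioo x hx) (hr.continuousAt (Ioo_mem_nhds hx.1 hx.2))
  have hTc : ∀ a ∈ Ioc 0 X, ContinuousOn T (Icc a X) := fun a ha => by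
    have := intervalIntegral.continuousOn_primitive_interval_left
      (f := r) (μ := volume) (a := a) (b := X) (by
        rw [uIcc_of_le ha.2, integrableOn_Icc_iff_integrableOn_Ioc]; exact (hint' a ha).1)
    rwa [uIcc_of_le ha.2] at this
  have hTanti : StrictAntiOn T (Ioc 0 X) := by
    intro x hx y hy hxy
    refine strictAntiOn_of_deriv_neg (convex_Icc x X) (hTc x hx) (fun z hz => ?_)
      ⟨le_rfl, hx.2⟩ ⟨hxy.le, hy.2⟩ hxy
    rw [interior_Icc] at hz
    have hz' : z ∈ Ioo 0 X := ⟨hx.1.trans hz.1, hz.2⟩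
    rw [(hTd z hz').deriv]
    linarith [hrpos z hz']
  have hTlog : ∀ x ∈ Ioc 0 X, Real.log (X / x) ≤ T x := by
    intro x hx
    rw [← integral_one_div_of_pos hx.1 hX]
    refine intervalIntegral.integral_mono_on_of_le_Ioo hx.2 ?_ (hint' x hx) fun y hy =>
      hge y ⟨hx.1.trans hy.1, hy.2⟩
    refine intervalIntegral.intervalIntegrable_one_div (fun y hy => ?_) continuousOn_id
    rw [uIcc_of_le hx.2] at hy
    exact (hx.1.trans_le hy.1).ne'
  have hTsurj : ∀ t, 0 ≤ t → ∃ x ∈ Ioc 0 X, T x = t := by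
    intro t ht
    -- Chosen so that the lower bound log(X / a) equals t.
    set a := X * Real.exp (-t)
    have ha : a ∈ Ioc 0 X := ⟨by positivity,
      mul_le_of_le_one_right hX.le (Real.exp_le_one_iff.2 (by linarith))⟩
    have hta : t ≤ T a := by
      refine le_trans (le_of_eq ?_) (hTlog a ha)
      simp only [a]
      rw [div_mul_cancel_left₀ hX.ne', Real.exp_neg, inv_inv, Real.log_exp]
    obtain ⟨x, hx, hxt⟩ := intermediate_value_Icc' ha.2 (hTc a ha) ⟨hTX.le.trans ht, hta⟩
    exact ⟨x, ⟨ha.1.trans_le hx.1, hx.2⟩, hxt⟩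
  have hTnn : ∀ x ∈ Ioc 0 X, 0 ≤ T x := fun x hx => by
    rw [← hTX]; exact hTanti.antitoneOn hx ⟨hX, le_rfl⟩ hx.2
  choose Z₀ hZ₀ hTZ₀ using hTsurj
  set Z : ℝ → Ioc 0 X := fun t => ⟨Z₀ (max t 0) (le_max_right _ _), hZ₀ _ _⟩
  have hTZ : ∀ t, T (Z t) = max t 0 := fun t => hTZ₀ _ _
  have hZT : ∀ x (hx : x ∈ Ioc 0 X), Z (T x) = ⟨x, hx⟩ := fun x hx => by
    refine Subtype.ext (hTanti.injOn (Z (T x)).2 hx ?_)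
    rw [hTZ, max_eq_left (hTnn x hx)]
  have hZanti : ∀ s t, s ≤ t → Z t ≤ Z s := fun s t hst => by
    refine (hTanti.le_iff_ge (Z s).2 (Z t).2).1 ?_
    rw [hTZ, hTZ]
    exact max_le_max_right 0 hst
  have hZc : Continuous Z := by
    -- Monotone maps onto an ordered space are continuous; this is why `Z` takes values in the
    -- subtype (0, X] with the order reversed.
    have hm : Monotone fun t => OrderDual.toDual (Z t) := fun s t hst => hZanti s t hst
    have := hm.continuous_of_surjective fun x => ⟨T (OrderDual.ofDual x).1, by
      change OrderDual.toDual (Z (T (OrderDual.ofDual x).1)) = x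
      rw [hZT _ (OrderDual.ofDual x).2]; rfl⟩
    exact continuous_ofDual.comp this
  have hZmem : ∀ t, 0 < t → (Z t : ℝ) ∈ Ioo 0 X := fun t ht => by
    refine ⟨(Z t).2.1, (Z t).2.2.lt_of_ne fun he => ?_⟩
    have := hTZ t
    rw [he, hTX, max_eq_left ht.le] at this
    exact ht.ne this
  refine ⟨fun t => Z t, continuous_subtype_val.comp hZc, fun t ht => ?_, hZmem,
    fun t ht => ?_, ?_, ?_, ?_, ?_⟩
  · refine hTanti.injOn (Z t).2 ⟨hX, le_rfl⟩ ?_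
    rw [hTZ, hTX, max_eq_right ht]
  · have hcont : ContinuousAt (fun t => (Z t : ℝ)) t :=
      (continuous_subtype_val.comp hZc).continuousAt
    have := HasDerivAt.of_local_left_inverse hcont (hTd _ (hZmem t ht))
      (neg_ne_zero.2 (hrpos _ (hZmem t ht)).ne') (by
        filter_upwards [Ioi_mem_nhds ht] with s hs
        rw [hTZ, max_eq_left (le_of_lt (show 0 < s from hs))])
    rwa [inv_neg] at this
  · ext x
    constructor
    · rintro ⟨t, ht, rfl⟩
      exact hZmem t ht
    · intro hx
      have hx' : x ∈ Ioc 0 X := Ioo_subset_Ioc_self hx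
      refine ⟨T x, ?_, by simp only [hZT x hx']⟩
      rw [mem_Ioi, ← hTX]
      exact hTanti hx' ⟨hX, le_rfl⟩ hx.2
  · intro s hs t ht hst
    have hst' : (Z s : ℝ) = Z t := hst
    have h1 := hTZ s
    have h2 := hTZ t
    rw [hst', h2, max_eq_left (le_of_lt (mem_Ioi.1 hs)), max_eq_left (le_of_lt (mem_Ioi.1 ht))] at h1
    exact h1.symm
  · rw [Metric.tendsto_nhds]
    intro ε hε
    set x := min (ε / 2) X
    have hx : x ∈ Ioc 0 X := ⟨lt_min (by linarith) hX, min_le_right _ _⟩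
    filter_upwards [eventually_ge_atTop (T x)] with t ht
    have h1 := hZanti _ _ ht
    rw [hZT x hx] at h1
    have h2 : (Z t : ℝ) ≤ x := h1
    rw [Real.dist_eq, sub_zero, abs_of_pos (Z t).2.1]
    have h3 : x ≤ ε / 2 := min_le_left _ _
    linarith
  · intro y hyc hy0 hymem hyd t ht
    have hymem' : ∀ s, 0 ≤ s → y s ∈ Ioc 0 X := fun s hs => by
      rcases hs.eq_or_lt with rfl | hs
      · rw [hy0]; exact ⟨hX, le_rfl⟩
      · exact Ioo_subset_Ioc_self (hymem s hs)
    have hkey : T (y t) = t := by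
      rcases ht.eq_or_lt with rfl | ht
      · rw [hy0, hTX]
      -- The continuity of `T` is available on intervals staying away from 0; the minimum of `y` on
      -- [0, t] supplies one.
      obtain ⟨a, ha, hamin⟩ := isCompact_Icc.exists_isMinOn (nonempty_Icc.2 ht.le)
        (hyc.mono fun s hs => hs.1)
      have hcomp : ContinuousOn (fun s => T (y s) - s) (Icc 0 t) := by
        refine ContinuousOn.sub ?_ continuousOn_id
        refine ContinuousOn.comp (hTc (y a) (hymem' a ha.1))
          (hyc.mono fun s hs => hs.1) fun s hs => ⟨hamin hs, (hymem' s hs.1).2⟩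
      obtain ⟨ξ, hξ, he⟩ := exists_hasDerivAt_eq_slope (fun s => T (y s) - s) (fun _ => 0) ht hcomp
        fun s hs => by
          have h1 := HasDerivAt.comp s (hTd _ (hymem s hs.1)) (hyd s hs.1)
          refine (h1.sub (hasDerivAt_id s)).congr_deriv ?_
          have := hrpos _ (hymem s hs.1)
          field_simp
          ring
      rw [eq_comm, div_eq_zero_iff, hy0, hTX] at he
      rcases he with he | he <;> linarith
    refine hTanti.injOn (hymem' t ht) (Z t).2 ?_
    rw [hkey, hTZ, max_eq_left ht]

theorem lintegral_comp_abs (g : ℝ → ℝ≥0∞) : ∫⁻ t, g |t| = 2 * ∫⁻ t in Ioi 0, g t := by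
  have h1 : ∫⁻ t in Ioi (0 : ℝ), g |t| = ∫⁻ t in Ioi 0, g t :=
    setLIntegral_congr_fun measurableSet_Ioi fun t ht => by
      simp only [abs_of_pos (mem_Ioi.1 ht)]
  have h2 : ∫⁻ t in Iio (0 : ℝ), g |t| = ∫⁻ t in Ioi 0, g t := by
    have := (Measure.measurePreserving_neg (volume : Measure ℝ)).setLIntegral_comp_preimage_emb
      (MeasurableEquiv.neg ℝ).measurableEmbedding (fun t => g |t|) (Ioi 0)
    rw [← h1, ← this]
    simp [neg_preimage]
  rw [← lintegral_add_compl _ measurableSet_Ioi (A := Ioi (0 : ℝ)), h1, compl_Ioi,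
    ← setLIntegral_congr Iio_ae_eq_Iic, h2, two_mul]

namespace Profile

variable {h : ℝ → ℝ}

theorem lt_of_mem (H : Profile h) {X x : ℝ} (hX : X ∈ Ioo (0 : ℝ) 1) (hx : x ∈ Ioo 0 X) :
    h X < h x :=
  H.strictAntiOn ⟨hx.1.le, (hx.2.trans hX.2).le⟩ ⟨hX.1.le, hX.2.le⟩ hx.2

/-- The rate 1 / (x k) is singular at X, where k = 0. It is integrable there because it is
comparable with c / (h² k), whose integral is the finite opening. -/
theorem exists_isDecay (H : Profile h) {X : ℝ} (hX : X ∈ Ioo (0 : ℝ) 1) :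
    ∃ Z, IsDecay (fun x => (x * cosFactor h (h X) x)⁻¹) X Z := by
  have hc : 0 < h X := H.pos ⟨hX.1.le, hX.2⟩
  have hk : ∀ x ∈ Ioo 0 X, 0 < cosFactor h (h X) x := fun x hx =>
    cosFactor_pos hc.le (H.lt_of_mem hX hx)
  have hcont : ContinuousOn (fun x => (x * cosFactor h (h X) x)⁻¹) (Ioo 0 X) :=
    (continuousOn_id.mul (H.continuous_cosFactor hc.le).continuousOn).inv₀
      fun x hx => (mul_pos hx.1 (hk x hx)).ne'
  have hpc : ContinuousOn (fun x => h X / (h x ^ 2 * cosFactor h (h X) x)) (Ioo 0 X) :=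
    continuousOn_const.div ((H.continuous.continuousOn.pow 2).mul
      (H.continuous_cosFactor hc.le).continuousOn) fun x hx => by
        have := hc.trans (H.lt_of_mem hX hx)
        have := hk x hx
        positivity
  have hpi : IntegrableOn (fun x => h X / (h x ^ 2 * cosFactor h (h X) x)) (Ioo 0 X) := by
    refine ⟨hpc.aestronglyMeasurable measurableSet_Ioo, ?_⟩
    rw [hasFiniteIntegral_iff_ofReal, H.lintegral_eq_opening ⟨hX.1.le, hX.2⟩]
    · exact ENNReal.ofReal_lt_top
    · refine (ae_restrict_iff' measurableSet_Ioo).2 (.of_forall fun x hx => ?_)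
      have := hk x hx
      exact div_nonneg hc.le (by positivity)
  refine CohesiveFracture.exists_isDecay hX.1 hcont (fun x hx => ?_) fun x hx => ?_
  · rw [intervalIntegrable_iff_integrableOn_Ioo_of_le hx.2.le]
    have hsub : Ioo x X ⊆ Ioo 0 X := Ioo_subset_Ioo_left hx.1.le
    refine Integrable.mono' ((hpi.mono_set hsub).const_mul (h 0 ^ 2 / (h X * x)))
      ((hcont.mono hsub).aestronglyMeasurable measurableSet_Ioo)
      ((ae_restrict_iff' measurableSet_Ioo).2 (.of_forall fun y hy => ?_))
    have hy' := hsub hy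
    have hky := hk y hy'
    have hpy := hc.trans (H.lt_of_mem hX hy')
    have hy0 : h y ≤ h 0 := H.antitoneOn ⟨le_rfl, zero_le_one⟩
      ⟨hy'.1.le, (hy'.2.trans hX.2).le⟩ hy'.1.le
    have hyp := hy'.1
    have hxp := hx.1
    rw [Real.norm_of_nonneg (by positivity)]
    have e : h 0 ^ 2 / (h X * x) * (h X / (h y ^ 2 * cosFactor h (h X) y)) =
        (h 0 ^ 2 / h y ^ 2) * (x * cosFactor h (h X) y)⁻¹ := by
      field_simp
    rw [e]
    have h1 : 1 ≤ h 0 ^ 2 / h y ^ 2 := by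
      rw [one_le_div (by positivity)]
      exact pow_le_pow_left₀ hpy.le hy0 2
    have h2 : (y * cosFactor h (h X) y)⁻¹ ≤ (x * cosFactor h (h X) y)⁻¹ :=
      inv_anti₀ (by positivity) (mul_le_mul_of_nonneg_right hy.1.le hky.le)
    refine h2.trans (le_mul_of_one_le_left (by positivity) h1)
  · rw [one_div]
    have := hk x hx
    have hxp := hx.1
    exact inv_anti₀ (by positivity) (mul_le_of_le_one_right hx.1.le (cosFactor_le_one _ _))

theorem lintegral_cosFactor (H : Profile h) {X : ℝ} (hX : X ∈ Ioo (0 : ℝ) 1) :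
    ∫⁻ x in Ioo 0 X, ENNReal.ofReal (cosFactor h (h X) x) =
      ENNReal.ofReal (phaseEnergy h (h X)) := by
  have hc : 0 < h X := H.pos ⟨hX.1.le, hX.2⟩
  rw [H.phaseEnergy_eq_integral ⟨hX.1.le, hX.2.le⟩, intervalIntegral.integral_of_le hX.1.le,
    integral_Ioc_eq_integral_Ioo, ofReal_integral_eq_lintegral_ofReal]
  · exact ((H.continuous_cosFactor hc.le).integrableOn_Icc).mono_set Ioo_subset_Icc_self
  · exact .of_forall fun x => cosFactor_nonneg _ _

end Profile

namespace IsDecay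

open Profile

variable {h Z : ℝ → ℝ} {X : ℝ}

theorem mem_Ioc {r : ℝ → ℝ} (D : IsDecay r X Z) (hX : 0 < X) (t : ℝ) : Z t ∈ Ioc 0 X := by
  rcases le_or_gt t 0 with h | h
  · rw [D.eq_of_nonpos t h]; exact ⟨hX, le_rfl⟩
  · exact Ioo_subset_Ioc_self (D.mem t h)

theorem hasDerivAt' (D : IsDecay (fun x => (x * cosFactor h (h X) x)⁻¹) X Z) {t : ℝ}
    (ht : 0 < t) : HasDerivAt Z (-(Z t * cosFactor h (h X) (Z t))) t := by
  simpa only [inv_inv] using D.hasDerivAt t ht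

/-- Change of variables x = Z(t) with |Z'| = Z k; the factor 1/2 compensates for covering (0, X)
twice, once on each half-line. -/
theorem lintegral_eq
    (D : IsDecay (fun x => (x * cosFactor h (h X) x)⁻¹) X Z) (g : ℝ → ℝ≥0∞) :
    ∫⁻ t, ENNReal.ofReal (Z |t| * cosFactor h (h X) (Z |t|) / 2) * g (Z |t|) =
      ∫⁻ x in Ioo 0 X, g x := by
  rw [lintegral_comp_abs fun t => ENNReal.ofReal (Z t * cosFactor h (h X) (Z t) / 2) * g (Z t),
    ← D.image, lintegral_image_eq_lintegral_abs_deriv_mul measurableSet_Ioi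
      (fun t ht => (D.hasDerivAt' ht).hasDerivWithinAt) D.injOn,
    ← lintegral_const_mul' _ _ (by simp)]
  refine setLIntegral_congr_fun measurableSet_Ioi fun t ht => ?_
  have h0 : 0 ≤ Z t * cosFactor h (h X) (Z t) :=
    mul_nonneg (D.mem t ht).1.le (cosFactor_nonneg _ _)
  rw [abs_neg, abs_of_nonneg h0, ← mul_assoc, ← ENNReal.ofReal_ofNat, ← ENNReal.ofReal_mul (by simp)]
  congr 2
  ring

theorem lintegral_slip (H : Profile h) (hX : X ∈ Ioo (0 : ℝ) 1)
    (D : IsDecay (fun x => (x * cosFactor h (h X) x)⁻¹) X Z) :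
    ∫⁻ t, ENNReal.ofReal (h X * Z |t| / (2 * h (Z |t|) ^ 2)) =
      ENNReal.ofReal (opening h (h X)) := by
  have hc : 0 < h X := H.pos ⟨hX.1.le, hX.2⟩
  rw [← H.lintegral_eq_opening ⟨hX.1.le, hX.2⟩, ← D.lintegral_eq]
  have h0 : ∀ᵐ t : ℝ, t ≠ 0 := by simp [ae_iff, measure_singleton]
  refine lintegral_congr_ae ?_
  filter_upwards [h0] with t ht
  have hm := D.mem |t| (abs_pos.2 ht)
  have hl := H.lt_of_mem hX hm
  have hk := cosFactor_pos hc.le hl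
  have hp := hc.trans hl
  have hz := hm.1
  rw [← ENNReal.ofReal_mul (by positivity)]
  congr 1
  field_simp

theorem lintegral_phase (H : Profile h) (hX : X ∈ Ioo (0 : ℝ) 1)
    (D : IsDecay (fun x => (x * cosFactor h (h X) x)⁻¹) X Z) :
    ∫⁻ t, ENNReal.ofReal (Z |t| * cosFactor h (h X) (Z |t|) ^ 2 / 2) =
      ENNReal.ofReal (phaseEnergy h (h X)) := by
  rw [← H.lintegral_cosFactor hX, ← D.lintegral_eq]
  refine lintegral_congr fun t => ?_
  have hz := (D.mem_Ioc hX.1 |t|).1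
  have hk := cosFactor_nonneg (h := h) (h X) (Z |t|)
  rw [← ENNReal.ofReal_mul (by positivity)]
  congr 1
  ring

end IsDecay

/-! ### The energy density and the optimal competitors. -/

/-- The integrand of `𝒢_s`. -/
noncomputable def energyDensity (f : ℝ → ℝ) (s : ℝ≥0) (y a b : ℝ) : ℝ≥0∞ :=
  (s : ℝ≥0∞) ^ 2 * fExt f y ^ 2 * ENNReal.ofReal (a ^ 2) + ENNReal.ofReal ((1 - y) ^ 2 / 4)
    + ENNReal.ofReal (b ^ 2)

theorem energyDensity_eq {f h : ℝ → ℝ} (hf : Admissible f)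
    (hfh : ∀ y ∈ Ico (0 : ℝ) 1, h ((1 - y) ^ 2) = (1 - y) * f y) (s : ℝ≥0) {y : ℝ}
    (hy : y ∈ Ico (0 : ℝ) 1) (a b : ℝ) :
    energyDensity f s y a b = ENNReal.ofReal
      (s ^ 2 * h ((1 - y) ^ 2) ^ 2 / (1 - y) ^ 2 * a ^ 2 + (1 - y) ^ 2 / 4 + b ^ 2) := by
  have h1 : 1 - y ≠ 0 := by linarith [hy.2]
  have hfy := hf.nonneg y hy
  have e : (s : ℝ) ^ 2 * h ((1 - y) ^ 2) ^ 2 / (1 - y) ^ 2 = s ^ 2 * f y ^ 2 := by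
    rw [hfh y hy]; field_simp
  rw [e, energyDensity, fExt, if_pos hy.2, ENNReal.ofReal_add (by positivity) (by positivity),
    ENNReal.ofReal_add (by positivity) (by positivity), ENNReal.ofReal_mul (by positivity),
    ENNReal.ofReal_mul (by positivity), ENNReal.ofReal_pow hfy, ENNReal.ofReal_pow s.coe_nonneg,
    ENNReal.ofReal_coe_nnreal]

theorem G_eq_lintegral_energyDensity {f α β a b : ℝ → ℝ} (s : ℝ≥0) (hα : IsPrimitive α a)
    (hβ : IsPrimitive β b) : G f s α β = ∫⁻ t, energyDensity f s (β t) (a t) (b t) := by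
  refine lintegral_congr_ae ?_
  filter_upwards [hα.weakDeriv_ae_eq, hβ.weakDeriv_ae_eq] with t h1 h2
  rw [h1, h2, energyDensity]

theorem U₁.isPrimitive_left {α β : ℝ → ℝ} (h : U₁ α β) : IsPrimitive α (weakDeriv α) := by
  obtain ⟨-, v, hv, -⟩ := h.memH1loc_left
  exact hv.isPrimitive_weakDeriv h.continuous_left

theorem U₁.isPrimitive_right {α β : ℝ → ℝ} (h : U₁ α β) : IsPrimitive β (weakDeriv β) := by
  obtain ⟨-, v, hv, -⟩ := h.memH1loc_right
  exact hv.isPrimitive_weakDeriv h.continuous_right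

theorem U₁.of_isPrimitive {α β a b : ℝ → ℝ} (hα : IsPrimitive α a) (hβ : IsPrimitive β b)
    (ha : MemL2loc a) (hb : MemL2loc b) (hai : Integrable a) (ha1 : |∫ t, a t| = 1)
    (hmem : ∀ t, β t ∈ Icc (0 : ℝ) 1) (hlim : Tendsto β (cocompact ℝ) (𝓝 1)) : U₁ α β where
  continuous_left := hα.continuous
  continuous_right := hβ.continuous
  memH1loc_left := ⟨memL2loc_of_continuous hα.continuous, a, hα.hasWeakDeriv, ha⟩
  memH1loc_right := ⟨memL2loc_of_continuous hβ.continuous, b, hβ.hasWeakDeriv, hb⟩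
  integrable := hai.congr hα.weakDeriv_ae_eq.symm
  abs_integral := by rw [integral_congr_ae hα.weakDeriv_ae_eq, ha1]
  mem_Icc := hmem
  tendsto := hlim

theorem isPrimitive_integral {a : ℝ → ℝ} (ha : Continuous a) :
    IsPrimitive (fun t => ∫ τ in (0 : ℝ)..t, a τ) a :=
  ⟨ha.locallyIntegrable, fun _ _ => intervalIntegral.integral_interval_sub_left
    (ha.intervalIntegrable _ _) (ha.intervalIntegrable _ _)⟩

/-- A continuous even function which is smooth on the half-lines has a bounded weak derivative. -/
theorem isPrimitive_comp_abs {u g : ℝ → ℝ} (hu : Continuous u) (hg : Continuous g)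
    (hd : ∀ t, 0 < t → HasDerivAt u (g t) t) {C : ℝ} (hC : ∀ t, |g t| ≤ C) :
    IsPrimitive (fun t => u |t|) (fun t => if t < 0 then -g (-t) else g t) ∧
      MemL2loc (fun t => if t < 0 then -g (-t) else g t) := by
  have hm : AEStronglyMeasurable (fun t => if t < 0 then -g (-t) else g t) volume :=
    (Measurable.ite measurableSet_Iio (hg.comp continuous_neg).neg.measurable
      hg.measurable).aestronglyMeasurable
  have hb : ∀ t : ℝ, |if t < 0 then -g (-t) else g t| ≤ C := fun t => by
    split_ifs
    · rw [abs_neg]; exact hC _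
    · exact hC _
  refine ⟨.of_hasDerivAt (countable_singleton 0) (hu.comp continuous_abs) (fun t ht => ?_)
    (locallyIntegrable_of_bound hm hb), memL2loc_of_bound hm hb⟩
  have ht : t ≠ 0 := ht
  rcases ht.lt_or_gt with h | h
  · rw [if_pos h]
    have h1 := HasDerivAt.comp t (hd (-t) (by linarith)) (hasDerivAt_neg t)
    rw [mul_neg_one] at h1
    refine h1.congr_of_eventuallyEq ?_
    filter_upwards [Iio_mem_nhds h] with τ hτ
    simp [abs_of_neg (mem_Iio.1 hτ)]
  · rw [if_neg h.not_gt]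
    refine (hd t h).congr_of_eventuallyEq ?_
    filter_upwards [Ioi_mem_nhds h] with τ hτ
    simp [abs_of_pos (mem_Ioi.1 hτ)]

theorem tendsto_comp_abs_cocompact {u : ℝ → ℝ} {l : ℝ} (hu : Tendsto u atTop (𝓝 l)) :
    Tendsto (fun t => u |t|) (cocompact ℝ) (𝓝 l) :=
  hu.comp (tendsto_norm_cocompact_atTop (E := ℝ))

/-- The competitor is β = 1 - √(Z(|t|)), with α' the optimal slip divided by A(c) to have integral
one. When s = A(c), the first two terms of the energy add up to s c. General s is kept because the
case above the threshold uses these pairs with c → 0. -/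
theorem exists_U₁_G_eq {f h : ℝ → ℝ} (hf : Admissible f) (H : Profile h)
    (hfh : ∀ y ∈ Ico (0 : ℝ) 1, h ((1 - y) ^ 2) = (1 - y) * f y) {X : ℝ}
    (hX : X ∈ Ioo (0 : ℝ) 1) :
    ∃ α β : ℝ → ℝ, U₁ α β ∧ ∀ s : ℝ≥0, G f s α β = ENNReal.ofReal
      (s ^ 2 * h X / (2 * opening h (h X)) + h X * opening h (h X) / 2
        + phaseEnergy h (h X)) := by
  obtain ⟨Z, D⟩ := H.exists_isDecay hX
  set c := h X with hcdef
  have hc : 0 < c := H.pos ⟨hX.1.le, hX.2⟩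
  have hcℓ : c < h 0 := H.strictAntiOn ⟨le_rfl, zero_le_one⟩ ⟨hX.1.le, hX.2.le⟩ hX.1
  set A := opening h c
  have hA : 0 < A := by
    have := H.strictAntiOn_opening ⟨hc, hcℓ.le⟩ ⟨hc.trans hcℓ, le_rfl⟩ hcℓ
    rwa [H.opening_map_zero] at this
  have hZ := fun t => D.mem_Ioc hX.1 t
  have hZ1 : ∀ t, Z t ∈ Icc (0 : ℝ) 1 := fun t => ⟨(hZ t).1.le, (hZ t).2.trans hX.2.le⟩
  have hcZ : ∀ t, c ≤ h (Z t) := fun t =>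
    H.antitoneOn (hZ1 t) ⟨hX.1.le, hX.2.le⟩ (hZ t).2
  have hk := H.continuous_cosFactor hc.le
  set slip : ℝ → ℝ := fun t => c * Z |t| / (2 * h (Z |t|) ^ 2)
  have hslipc : Continuous slip := by
    have hZa : Continuous fun t => Z |t| := D.continuous.comp continuous_abs
    refine (continuous_const.mul hZa).div
      (continuous_const.mul ((H.continuous.comp hZa).pow 2)) fun t => ?_
    have := hc.trans_le (hcZ |t|)
    positivity
  have hslip0 : ∀ t, 0 ≤ slip t := fun t =>
    div_nonneg (mul_nonneg hc.le (hZ _).1.le) (by positivity)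
  have hslipA : ∫⁻ t, ENNReal.ofReal (slip t) = ENNReal.ofReal A := D.lintegral_slip H hX
  have hslipi : Integrable slip := by
    refine ⟨hslipc.aestronglyMeasurable, ?_⟩
    rw [hasFiniteIntegral_iff_ofReal (.of_forall hslip0), hslipA]
    exact ENNReal.ofReal_lt_top
  have hslipI : ∫ t, slip t = A := by
    rw [integral_eq_lintegral_of_nonneg_ae (.of_forall hslip0) hslipc.aestronglyMeasurable,
      hslipA, ENNReal.toReal_ofReal hA.le]
  set a : ℝ → ℝ := fun t => A⁻¹ * slip t
  have hac : Continuous a := continuous_const.mul hslipc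
  set g : ℝ → ℝ := fun t => √(Z t) * cosFactor h c (Z t) / 2
  have hgc : Continuous g :=
    ((Real.continuous_sqrt.comp D.continuous).mul (hk.comp D.continuous)).div_const 2
  have hg0 : ∀ t, 0 ≤ g t := fun t =>
    div_nonneg (mul_nonneg (Real.sqrt_nonneg _) (Profile.cosFactor_nonneg _ _)) zero_le_two
  have hg1 : ∀ t, |g t| ≤ 1 := fun t => by
    rw [abs_of_nonneg (hg0 t)]
    have h1 : √(Z t) ≤ 1 := Real.sqrt_le_one.2 (hZ1 t).2
    have h2 := Profile.cosFactor_le_one (h := h) c (Z t)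
    have := mul_le_one₀ h1 (Profile.cosFactor_nonneg _ _) h2
    simp only [g]; linarith
  obtain ⟨hβ, hb⟩ := isPrimitive_comp_abs (u := fun t => 1 - √(Z t)) (g := g)
    (continuous_const.sub (Real.continuous_sqrt.comp D.continuous)) hgc (fun t ht => by
      have h1 := (D.hasDerivAt' ht).sqrt (hZ t).1.ne'
      refine (h1.const_sub 1).congr_deriv ?_
      have h2 := Real.mul_self_sqrt (hZ t).1.le
      have h3 := Real.sqrt_pos.2 (hZ t).1
      simp only [g]
      rw [neg_div, neg_neg, div_eq_div_iff (by positivity) (by norm_num)]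
      linear_combination (-2 * cosFactor h c (Z t)) * h2) hg1
  refine ⟨_, _, U₁.of_isPrimitive (isPrimitive_integral hac) hβ (memL2loc_of_continuous hac) hb
    (hslipi.const_mul _) ?_ (fun t => ?_) ?_, fun s => ?_⟩
  · rw [integral_const_mul, hslipI, inv_mul_cancel₀ hA.ne', abs_one]
  · have h1 : √(Z |t|) ≤ 1 := Real.sqrt_le_one.2 (hZ1 _).2
    have h2 := Real.sqrt_nonneg (Z |t|)
    exact ⟨by linarith, by linarith⟩
  · refine tendsto_comp_abs_cocompact (u := fun t => 1 - √(Z t)) ?_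
    have := ((Real.continuous_sqrt.tendsto 0).comp D.tendsto).const_sub 1
    simpa using this
  · rw [G_eq_lintegral_energyDensity s (isPrimitive_integral hac) hβ]
    -- Writing p = c/h and η = 1 - β, the potential η²/4 splits into p²η²/4 and k²η²/4. The elastic
    -- term and the first part are multiples of the slip and give `q`; the second part equals |β'|²,
    -- and together they give Z k² / 2.
    set q := (s ^ 2 * A⁻¹ ^ 2 + 1) * c / 2 with hq
    have hq0 : 0 ≤ q := by positivity
    have hpt : ∀ t, energyDensity f s (1 - √(Z |t|)) (a t) (if t < 0 then -g (-t) else g t) =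
        ENNReal.ofReal q * ENNReal.ofReal (slip t) +
          ENNReal.ofReal (Z |t| * cosFactor h c (Z |t|) ^ 2 / 2) := by
      intro t
      have hz := (hZ |t|).1
      have hsq := Real.sq_sqrt hz.le
      have hb2 : (if t < 0 then -g (-t) else g t) ^ 2 = Z |t| * cosFactor h c (Z |t|) ^ 2 / 4 := by
        have : (if t < 0 then -g (-t) else g t) ^ 2 = g |t| ^ 2 := by
          split_ifs with h0
          · rw [neg_sq, abs_of_neg h0]
          · rw [abs_of_nonneg (not_lt.1 h0)]
        rw [this]
        simp only [g]
        rw [div_pow, mul_pow, hsq]; norm_num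
      have hy : 1 - √(Z |t|) ∈ Ico (0 : ℝ) 1 := by
        have h1 : √(Z |t|) ≤ 1 := Real.sqrt_le_one.2 (hZ1 _).2
        have h2 := Real.sqrt_pos.2 hz
        exact ⟨by linarith, by linarith⟩
      rw [energyDensity_eq hf hfh s hy, hb2, sub_sub_cancel, hsq, ← ENNReal.ofReal_mul hq0,
        ← ENNReal.ofReal_add (mul_nonneg hq0 (hslip0 t)) (by positivity)]
      congr 1
      have hk2 := Profile.sq_cosFactor hc.le (hcZ |t|)
      rw [hk2]
      have hp := hc.trans_le (hcZ |t|)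
      simp only [a, slip, hq]
      field_simp
      ring
    rw [lintegral_congr hpt, lintegral_add_left (by fun_prop), lintegral_const_mul _ (by fun_prop),
      hslipA, D.lintegral_phase H hX, ← ENNReal.ofReal_mul hq0,
      ← ENNReal.ofReal_add (by positivity) (Profile.phaseEnergy_nonneg _)]
    congr 2
    simp only [hq]
    field_simp

/-! ### Reflection and total variation on half-lines. -/

theorem IsPrimitive.comp_neg {u v : ℝ → ℝ} (h : IsPrimitive u v) :
    IsPrimitive (fun t => u (-t)) (fun t => -v (-t)) := by
  have hv : LocallyIntegrable (fun t => v (-t)) volume := by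
    intro x
    obtain ⟨U, hU, hi⟩ := h.locallyIntegrable (-x)
    exact ⟨Neg.neg ⁻¹' U, continuous_neg.continuousAt.preimage_mem_nhds hU,
      ((Measure.measurePreserving_neg (volume : Measure ℝ)).integrableOn_comp_preimage
        (MeasurableEquiv.neg ℝ).measurableEmbedding).2 hi⟩
  refine ⟨hv.neg, fun x y => ?_⟩
  rw [intervalIntegral.integral_neg, intervalIntegral.integral_comp_neg, h.sub_eq (-x) (-y),
    intervalIntegral.integral_symm]

theorem lintegral_Iio_eq_comp_neg (g : ℝ → ℝ≥0∞) (t₀ : ℝ) :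
    ∫⁻ t in Iio t₀, g t = ∫⁻ t in Ioi (-t₀), g (-t) := by
  have := (Measure.measurePreserving_neg (volume : Measure ℝ)).setLIntegral_comp_preimage_emb
    (MeasurableEquiv.neg ℝ).measurableEmbedding g (Iio t₀)
  rw [← this]
  simp

theorem lintegral_eq_Ioi_add_Iio (g : ℝ → ℝ≥0∞) (t₀ : ℝ) :
    ∫⁻ t, g t = (∫⁻ t in Ioi t₀, g t) + ∫⁻ t in Ioi (-t₀), g (-t) := by
  rw [← lintegral_Iio_eq_comp_neg, setLIntegral_congr (Iio_ae_eq_Iic (a := t₀)), ← compl_Ioi,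
    lintegral_add_compl _ measurableSet_Ioi]

/-- A bound for the total variation on a half-line by the net increment. -/
theorem ofReal_le_lintegral_Ioi_abs {e : ℝ → ℝ} {t₀ L : ℝ}
    (hL : Tendsto (fun T => ∫ t in t₀..T, e t) atTop (𝓝 L)) :
    ENNReal.ofReal L ≤ ∫⁻ t in Ioi t₀, ENNReal.ofReal |e t| := by
  refine le_of_tendsto (ENNReal.tendsto_ofReal hL) ?_
  filter_upwards [eventually_ge_atTop t₀] with T hT
  rw [intervalIntegral.integral_of_le hT]
  calc ENNReal.ofReal (∫ t in Ioc t₀ T, e t) ≤ ENNReal.ofReal ‖∫ t in Ioc t₀ T, e t‖ :=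
        ENNReal.ofReal_le_ofReal (le_abs_self _)
    _ = ‖∫ t in Ioc t₀ T, e t‖ₑ := ofReal_norm _
    _ ≤ ∫⁻ t in Ioc t₀ T, ‖e t‖ₑ := enorm_integral_le_lintegral_enorm _
    _ = ∫⁻ t in Ioc t₀ T, ENNReal.ofReal |e t| := by
        simp_rw [← Real.norm_eq_abs, ofReal_norm]
    _ ≤ _ := lintegral_mono_set Ioc_subset_Ioi_self

/-- The equality case of |∫ e| ≤ ∫ |e|: the nonnegative function |e| - e has integral zero. -/
theorem ae_nonneg_of_lintegral_Ioi_abs_eq {e : ℝ → ℝ} {t₀ L : ℝ} (he : LocallyIntegrable e volume)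
    (hL : Tendsto (fun T => ∫ t in t₀..T, e t) atTop (𝓝 L)) (hL0 : 0 ≤ L)
    (heq : ∫⁻ t in Ioi t₀, ENNReal.ofReal |e t| = ENNReal.ofReal L) :
    ∀ᵐ t, t₀ < t → 0 ≤ e t := by
  have hi : IntegrableOn e (Ioi t₀) := by
    refine ⟨he.aestronglyMeasurable.restrict, ?_⟩
    rw [hasFiniteIntegral_iff_norm]
    simp_rw [Real.norm_eq_abs]
    rw [heq]
    exact ENNReal.ofReal_lt_top
  have h1 : ∫ t in Ioi t₀, e t = L :=
    tendsto_nhds_unique (intervalIntegral_tendsto_integral_Ioi t₀ hi tendsto_id) hL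
  have h2 : ∫ t in Ioi t₀, |e t| = L := by
    rw [integral_eq_lintegral_of_nonneg_ae (.of_forall fun t => abs_nonneg _)
      hi.abs.aestronglyMeasurable, heq, ENNReal.toReal_ofReal hL0]
  have h3 : ∫ t in Ioi t₀, (|e t| - e t) = 0 := by
    rw [integral_sub hi.abs hi, h1, h2, sub_self]
  have h4 := (setIntegral_eq_zero_iff_of_nonneg_ae
    (.of_forall fun t => sub_nonneg.2 (le_abs_self (e t))) (hi.abs.sub hi)).1 h3
  rw [EventuallyEq, ae_restrict_iff' measurableSet_Ioi] at h4
  filter_upwards [h4] with t ht htt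
  have : |e t| - e t = 0 := ht htt
  rw [← sub_eq_zero.1 this]
  exact abs_nonneg _

theorem ae_eq_of_abs_integral_eq {a : ℝ → ℝ} (ha : Integrable a) (h1 : |∫ t, a t| = 1)
    (h2 : ∫⁻ t, ENNReal.ofReal |a t| = 1) :
    ∃ σ : ℝ, (σ = 1 ∨ σ = -1) ∧ ∀ᵐ t, a t = σ * |a t| := by
  have hσ : (∫ t, a t) = 1 ∨ (∫ t, a t) = -1 := eq_or_eq_neg_of_abs_eq h1
  refine ⟨∫ t, a t, hσ, ?_⟩
  set σ := ∫ t, a t with hσd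
  have hσ2 : σ * σ = 1 := by rcases hσ with h | h <;> rw [h] <;> norm_num
  have habs : ∫ t, |a t| = 1 := by
    rw [integral_eq_lintegral_of_nonneg_ae (.of_forall fun t => abs_nonneg _)
      ha.abs.aestronglyMeasurable, h2, ENNReal.toReal_one]
  have h3 : ∫ t, (|a t| - σ * a t) = 0 := by
    rw [integral_sub ha.abs (ha.const_mul σ), integral_const_mul, ← hσd, hσ2, habs, sub_self]
  have h4 := (integral_eq_zero_iff_of_nonneg_ae (.of_forall fun t => by
    refine sub_nonneg.2 ((le_abs_self _).trans_eq ?_)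
    rw [abs_mul, h1, one_mul]) (ha.abs.sub (ha.const_mul σ))).1 h3
  filter_upwards [h4] with t ht
  have : |a t| - σ * a t = 0 := ht
  rw [sub_eq_zero.1 this, ← mul_assoc, hσ2, one_mul]

/-! ### The calibration. -/

section HalfLine

variable {h β b : ℝ → ℝ} {t₀ : ℝ}

/-- The derivative, up to sign, of `t ↦ ½ ∫₀^{(1-β)²} cosFactor`. -/
noncomputable def phaseFlux (h : ℝ → ℝ) (c : ℝ) (β b : ℝ → ℝ) (t : ℝ) : ℝ :=
  (1 - β t) * cosFactor h c ((1 - β t) ^ 2) * b t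

theorem abs_phaseFlux (c : ℝ) {t : ℝ} (ht : β t ≤ 1) :
    |phaseFlux h c β b t| = (1 - β t) * cosFactor h c ((1 - β t) ^ 2) * |b t| := by
  rw [phaseFlux, abs_mul, abs_of_nonneg (mul_nonneg (sub_nonneg.2 ht)
    (Profile.cosFactor_nonneg _ _))]

theorem phaseFlux_spec (H : Profile h) {c : ℝ} (hc : 0 ≤ c) (hβ : IsPrimitive β b) :
    LocallyIntegrable (phaseFlux h c β b) volume ∧ ∀ x y, ∫ t in x..y, phaseFlux h c β b t =
      ((∫ ξ in (0 : ℝ)..(1 - β x) ^ 2, cosFactor h c ξ) -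
        ∫ ξ in (0 : ℝ)..(1 - β y) ^ 2, cosFactor h c ξ) / 2 := by
  have hk := H.continuous_cosFactor hc
  set Q : ℝ → ℝ := fun y => -(∫ ξ in (0 : ℝ)..(1 - y) ^ 2, cosFactor h c ξ) / 2
  have hd : ∀ y, HasDerivAt Q ((1 - y) * cosFactor h c ((1 - y) ^ 2)) y := by
    intro y
    have h1 : HasDerivAt (fun z => ∫ ξ in (0 : ℝ)..z, cosFactor h c ξ)
        (cosFactor h c ((1 - y) ^ 2)) ((1 - y) ^ 2) :=
      intervalIntegral.integral_hasDerivAt_right (hk.intervalIntegrable _ _)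
        hk.stronglyMeasurable.stronglyMeasurableAtFilter hk.continuousAt
    have h2 : HasDerivAt (fun y : ℝ => (1 - y) ^ 2) ((2 : ℕ) * (1 - y) ^ (2 - 1) * (0 - 1)) y :=
      ((hasDerivAt_const y (1 : ℝ)).sub (hasDerivAt_id y)).pow 2
    refine ((HasDerivAt.comp y h1 h2).neg.div_const 2).congr_deriv ?_
    push_cast
    ring
  have hdq : deriv Q = fun y => (1 - y) * cosFactor h c ((1 - y) ^ 2) :=
    funext fun y => (hd y).deriv
  have hQ : ContDiff ℝ 1 Q := by
    rw [contDiff_one_iff_deriv]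
    refine ⟨fun y => (hd y).differentiableAt, ?_⟩
    rw [hdq]
    exact (continuous_const.sub continuous_id).mul
      (hk.comp ((continuous_const.sub continuous_id).pow 2))
  have hp := hβ.comp_contDiff hQ
  rw [hdq] at hp
  refine ⟨hp.locallyIntegrable, fun x y => ?_⟩
  rw [show phaseFlux h c β b = fun t =>
    (1 - β t) * cosFactor h c ((1 - β t) ^ 2) * b t from rfl, ← hp.sub_eq]
  simp only [Q]
  ring

/-- The flux telescopes. The end at infinity vanishes since β → 1, and the initial primitive ∫₀^X k
is the whole phase energy because k = 0 beyond X. -/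
theorem tendsto_integral_phaseFlux (H : Profile h) (hβ : IsPrimitive β b)
    (hmem : β t₀ ∈ Icc (0 : ℝ) 1) (hlim : Tendsto β atTop (𝓝 1)) :
    Tendsto (fun T => ∫ t in t₀..T, phaseFlux h (h ((1 - β t₀) ^ 2)) β b t) atTop
      (𝓝 (phaseEnergy h (h ((1 - β t₀) ^ 2)) / 2)) := by
  have hX : (1 - β t₀) ^ 2 ∈ Icc (0 : ℝ) 1 :=
    ⟨sq_nonneg _, pow_le_one₀ (sub_nonneg.2 hmem.2) (by linarith [hmem.1])⟩
  set c := h ((1 - β t₀) ^ 2)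
  have hc : 0 ≤ c := H.nonneg hX
  have hk := H.continuous_cosFactor hc
  simp_rw [(phaseFlux_spec H hc hβ).2]
  rw [H.phaseEnergy_eq_integral hX]
  have hcont : Continuous fun y : ℝ => ∫ ξ in (0 : ℝ)..(1 - y) ^ 2, cosFactor h c ξ :=
    (intervalIntegral.continuous_primitive (fun _ _ => hk.intervalIntegrable _ _) 0).comp
      ((continuous_const.sub continuous_id).pow 2)
  have h1 := (hcont.tendsto 1).comp hlim
  have h2 := (h1.const_sub (∫ ξ in (0 : ℝ)..(1 - β t₀) ^ 2, cosFactor h c ξ)).div_const 2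
  simpa using h2

end HalfLine

theorem U₁.exists_forall_le {α β : ℝ → ℝ} (h : U₁ α β) : ∃ t₀, ∀ t, β t₀ ≤ β t := by
  by_cases h1 : ∀ t, β t = 1
  · exact ⟨0, fun t => by rw [h1, h1]⟩
  · push Not at h1
    obtain ⟨t₁, ht₁⟩ := h1
    refine h.continuous_right.exists_forall_le' t₁ ?_
    filter_upwards [h.tendsto.eventually (lt_mem_nhds ((h.mem_Icc t₁).2.lt_of_ne ht₁))] with t ht
      using ht.le

/-- Completing the squares in the energy density. -/
theorem density_eq_add_sq {s c p k η H₀ a b : ℝ} (hη : η ≠ 0) (hp : p * H₀ = c)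
    (hk : k ^ 2 = 1 - p ^ 2) :
    s ^ 2 * H₀ ^ 2 / η ^ 2 * a ^ 2 + η ^ 2 / 4 + b ^ 2 =
      s * c * a + η * k * b + ((s * H₀ / η * a - p * η / 2) ^ 2 + (b - η * k / 2) ^ 2) := by
  have : η ^ 2 / 4 = (p * η / 2) ^ 2 + (η * k / 2) ^ 2 := by
    rw [mul_div_assoc, mul_pow, mul_div_assoc, mul_pow, div_pow]
    linear_combination (-η ^ 2 / 4) * hk
  rw [this, ← hp]
  field_simp
  ring

section Density

variable {f h : ℝ → ℝ}

theorem energyDensity_one {s : ℝ≥0} (hs : 0 < s) {a : ℝ} (ha : a ≠ 0) (b : ℝ) :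
    energyDensity f s 1 a b = ⊤ := by
  have h1 : (s : ℝ≥0∞) ^ 2 * fExt f 1 ^ 2 * ENNReal.ofReal (a ^ 2) = ⊤ := by
    have h2 : fExt f 1 = ⊤ := if_neg (lt_irrefl _)
    rw [h2, ENNReal.top_pow two_ne_zero,
      ENNReal.mul_top (pow_ne_zero 2 (ENNReal.coe_ne_zero.2 hs.ne')),
      ENNReal.top_mul (by simpa using ha)]
  rw [energyDensity, h1, top_add, top_add]

theorem energyDensity_one_zero (s : ℝ≥0) (b : ℝ) :
    energyDensity f s 1 0 b = ENNReal.ofReal (b ^ 2) := by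
  simp [energyDensity]

/-- For y < 1 the two squares are dropped, using |a| and |b|. For y = 1 the density is infinite
unless a = 0, and then the left side vanishes. -/
theorem calibration_le_energyDensity (hf : Admissible f)
    (hfh : ∀ y ∈ Ico (0 : ℝ) 1, h ((1 - y) ^ 2) = (1 - y) * f y) {s : ℝ≥0} (hs : 0 < s)
    {y c : ℝ} (hy : y ∈ Icc (0 : ℝ) 1) (hc : 0 ≤ c) (hcy : c ≤ h ((1 - y) ^ 2)) (a b : ℝ) :
    ENNReal.ofReal (s * c * |a|) +
        ENNReal.ofReal ((1 - y) * cosFactor h c ((1 - y) ^ 2) * |b|) ≤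
      energyDensity f s y a b := by
  rcases hy.2.eq_or_lt with rfl | hy1
  · by_cases ha : a = 0
    · simp [ha]
    · rw [energyDensity_one hs ha]; exact le_top
  · have hk := Profile.cosFactor_nonneg (h := h) c ((1 - y) ^ 2)
    have hη : 0 < 1 - y := by linarith
    rw [energyDensity_eq hf hfh s ⟨hy.1, hy1⟩, ← ENNReal.ofReal_add (by positivity) (by positivity)]
    refine ENNReal.ofReal_le_ofReal ?_
    -- If h vanishes then c = 0 as well, and the convention 0 / 0 = 0 keeps the identity.
    have hp : c / h ((1 - y) ^ 2) * h ((1 - y) ^ 2) = c := by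
      rcases (hc.trans hcy).eq_or_lt with h0 | h0
      · rw [← h0] at hcy ⊢
        rw [mul_zero]; linarith
      · field_simp
    have := density_eq_add_sq (s := s) (a := |a|) (b := |b|) hη.ne' hp
      (Profile.sq_cosFactor hc hcy)
    rw [sq_abs, sq_abs] at this
    rw [this]
    nlinarith [sq_nonneg (s * h ((1 - y) ^ 2) / (1 - y) * |a|
      - c / h ((1 - y) ^ 2) * (1 - y) / 2),
      sq_nonneg (|b| - (1 - y) * cosFactor h c ((1 - y) ^ 2) / 2)]

theorem abs_eq_of_calibration_eq (hf : Admissible f)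
    (hfh : ∀ y ∈ Ico (0 : ℝ) 1, h ((1 - y) ^ 2) = (1 - y) * f y) {s : ℝ≥0} (hs : 0 < s)
    {y c : ℝ} (hy : y ∈ Icc (0 : ℝ) 1) (hc : 0 < c) (hcy : c ≤ h ((1 - y) ^ 2)) {a b : ℝ}
    (heq : ENNReal.ofReal (s * c * |a|) +
        ENNReal.ofReal ((1 - y) * cosFactor h c ((1 - y) ^ 2) * |b|) =
      energyDensity f s y a b) :
    |a| = (s : ℝ)⁻¹ * (c * (1 - y) ^ 2 / (2 * h ((1 - y) ^ 2) ^ 2)) ∧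
      |b| = (1 - y) * cosFactor h c ((1 - y) ^ 2) / 2 := by
  have hs' : (0 : ℝ) < s := hs
  rcases hy.2.eq_or_lt with rfl | hy1
  · by_cases ha : a = 0
    · rw [ha, energyDensity_one_zero] at heq
      have hb : b ^ 2 ≤ 0 := by simpa [eq_comm] using heq
      have : b = 0 := by nlinarith [sq_nonneg b, sq_eq_zero_iff.1 (le_antisymm hb (sq_nonneg b))]
      simp [ha, this]
    · rw [energyDensity_one hs ha] at heq
      exact absurd heq (by finiteness)
  · have hk := Profile.cosFactor_nonneg (h := h) c ((1 - y) ^ 2)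
    have hη : 0 < 1 - y := by linarith
    have h0 : 0 < h ((1 - y) ^ 2) := hc.trans_le hcy
    rw [energyDensity_eq hf hfh s ⟨hy.1, hy1⟩, ← ENNReal.ofReal_add (by positivity) (by positivity),
      ENNReal.ofReal_eq_ofReal_iff (by positivity) (by positivity)] at heq
    have := density_eq_add_sq (s := s) (a := |a|) (b := |b|) hη.ne'
      (div_mul_cancel₀ c h0.ne') (Profile.sq_cosFactor hc.le hcy)
    rw [sq_abs, sq_abs, ← heq] at this
    have h1 := sq_nonneg (s * h ((1 - y) ^ 2) / (1 - y) * |a| - c / h ((1 - y) ^ 2) * (1 - y) / 2)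
    have h2 := sq_nonneg (|b| - (1 - y) * cosFactor h c ((1 - y) ^ 2) / 2)
    have h3 := sq_eq_zero_iff.1 (le_antisymm (by linarith) h1)
    have h4 := sq_eq_zero_iff.1 (le_antisymm (by linarith) h2)
    refine ⟨?_, by linarith⟩
    field_simp at h3 ⊢
    linarith

theorem aemeasurable_energyDensity (H : Profile h)
    (hfh : ∀ y ∈ Ico (0 : ℝ) 1, h ((1 - y) ^ 2) = (1 - y) * f y) (s : ℝ≥0) {α β a b : ℝ → ℝ}
    (hα : IsPrimitive α a) (hβ : IsPrimitive β b) (hmem : ∀ t, β t ∈ Icc (0 : ℝ) 1) :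
    AEMeasurable fun t => energyDensity f s (β t) (a t) (b t) := by
  have hβm := hβ.continuous.measurable
  have hfe : Measurable fun t => fExt f (β t) := by
    -- Nothing is known about `f` off [0, 1), so measurability is obtained by expressing f(β)
    -- through the continuous `h`.
    have e : (fun t => fExt f (β t)) = fun t => if β t < 1 then
        ENNReal.ofReal (h ((1 - β t) ^ 2) / (1 - β t)) else ⊤ := by
      funext t
      rw [fExt]
      split_ifs with h1
      · rw [hfh _ ⟨(hmem t).1, h1⟩, mul_div_cancel_left₀ _ (by linarith)]
      · rfl
    rw [e]
    have h1 : Measurable fun t => 1 - β t := hβm.const_sub 1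
    exact Measurable.ite (measurableSet_lt hβm measurable_const)
      (ENNReal.measurable_ofReal.comp
        ((H.continuous.measurable.comp (h1.pow_const 2)).div h1)) measurable_const
  have ha := hα.locallyIntegrable.aestronglyMeasurable.aemeasurable
  have hb := hβ.locallyIntegrable.aestronglyMeasurable.aemeasurable
  exact ((((hfe.pow_const 2).const_mul _).aemeasurable.mul (ha.pow_const 2).ennreal_ofReal).add
    (((hβm.const_sub 1).pow_const 2).div_const 4).ennreal_ofReal.aemeasurable).add
    (hb.pow_const 2).ennreal_ofReal

end Density

/-! ### The lower bound and its equality case. -/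

section LowerBound

variable {f h α β : ℝ → ℝ} {t₀ : ℝ}

theorem one_le_lintegral_abs {a : ℝ → ℝ} (h1 : |∫ t, a t| = 1) :
    1 ≤ ∫⁻ t, ENNReal.ofReal |a t| := by
  have : ‖∫ t, a t‖ₑ ≤ ∫⁻ t, ‖a t‖ₑ := enorm_integral_le_lintegral_enorm _
  simp_rw [← ofReal_norm, Real.norm_eq_abs] at this
  rwa [h1, ENNReal.ofReal_one] at this

theorem U₁.tendsto_atTop (hU : U₁ α β) : Tendsto β atTop (𝓝 1) :=
  hU.tendsto.mono_left (cocompact_eq_atBot_atTop (α := ℝ) ▸ le_sup_right)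

theorem U₁.tendsto_neg_atTop (hU : U₁ α β) : Tendsto (fun t => β (-t)) atTop (𝓝 1) :=
  (hU.tendsto.mono_left (cocompact_eq_atBot_atTop (α := ℝ) ▸ le_sup_left)).comp
    tendsto_neg_atTop_atBot

theorem U₁.le_profile (hU : U₁ α β) (H : Profile h) (ht₀ : ∀ t, β t₀ ≤ β t) (t : ℝ) :
    h ((1 - β t₀) ^ 2) ≤ h ((1 - β t) ^ 2) := by
  have hX : ∀ t, (1 - β t) ^ 2 ∈ Icc (0 : ℝ) 1 := fun t =>
    ⟨sq_nonneg _, pow_le_one₀ (sub_nonneg.2 (hU.mem_Icc t).2) (by linarith [(hU.mem_Icc t).1])⟩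
  exact H.antitoneOn (hX t) (hX t₀)
    (pow_le_pow_left₀ (sub_nonneg.2 (hU.mem_Icc t).2) (by linarith [ht₀ t]) 2)

theorem lintegral_phaseFlux_eq (c : ℝ) (b : ℝ → ℝ) (t₀ : ℝ) :
    ∫⁻ t, ENNReal.ofReal |phaseFlux h c β b t| =
      (∫⁻ t in Ioi t₀, ENNReal.ofReal |phaseFlux h c β b t|) +
      ∫⁻ t in Ioi (-t₀), ENNReal.ofReal
        |phaseFlux h c (fun t => β (-t)) (fun t => -b (-t)) t| := by
  rw [lintegral_eq_Ioi_add_Iio _ t₀]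
  simp only [phaseFlux, mul_neg, abs_neg]

theorem U₁.half_phaseEnergy_le (hU : U₁ α β) (H : Profile h) (t₀ : ℝ) :
    ENNReal.ofReal (phaseEnergy h (h ((1 - β t₀) ^ 2)) / 2) ≤
        ∫⁻ t in Ioi t₀, ENNReal.ofReal
          |phaseFlux h (h ((1 - β t₀) ^ 2)) β (weakDeriv β) t| ∧
      ENNReal.ofReal (phaseEnergy h (h ((1 - β t₀) ^ 2)) / 2) ≤
        ∫⁻ t in Ioi (-t₀), ENNReal.ofReal
          |phaseFlux h (h ((1 - β t₀) ^ 2)) (fun t => β (-t)) (fun t => -weakDeriv β (-t)) t| := by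
  have hβ := hU.isPrimitive_right
  refine ⟨ofReal_le_lintegral_Ioi_abs
    (tendsto_integral_phaseFlux H hβ (hU.mem_Icc t₀) hU.tendsto_atTop), ?_⟩
  have := tendsto_integral_phaseFlux (t₀ := -t₀) H hβ.comp_neg
    (by rw [neg_neg]; exact hU.mem_Icc t₀) hU.tendsto_neg_atTop
  rw [neg_neg] at this
  exact ofReal_le_lintegral_Ioi_abs this

theorem U₁.lintegral_calibration_le_G (hU : U₁ α β) (hf : Admissible f) (H : Profile h)
    (hfh : ∀ y ∈ Ico (0 : ℝ) 1, h ((1 - y) ^ 2) = (1 - y) * f y) {s : ℝ≥0} (hs : 0 < s)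
    (ht₀ : ∀ t, β t₀ ≤ β t) :
    (∫⁻ t, (ENNReal.ofReal (s * h ((1 - β t₀) ^ 2) * |weakDeriv α t|) +
      ENNReal.ofReal |phaseFlux h (h ((1 - β t₀) ^ 2)) β (weakDeriv β) t|)) ≤ G f s α β := by
  have hc : 0 ≤ h ((1 - β t₀) ^ 2) := H.nonneg ⟨sq_nonneg _,
    pow_le_one₀ (sub_nonneg.2 (hU.mem_Icc t₀).2) (by linarith [(hU.mem_Icc t₀).1])⟩
  refine lintegral_mono fun t => ?_
  rw [abs_phaseFlux _ (hU.mem_Icc t).2]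
  exact calibration_le_energyDensity hf hfh hs (hU.mem_Icc t) hc (hU.le_profile H ht₀ t) _ _

theorem U₁.lintegral_calibration (hU : U₁ α β) {s : ℝ≥0} {c : ℝ} (hc : 0 ≤ c) (t₀ : ℝ) :
    (∫⁻ t, (ENNReal.ofReal (s * c * |weakDeriv α t|) +
      ENNReal.ofReal |phaseFlux h c β (weakDeriv β) t|)) =
    ENNReal.ofReal (s * c) * (∫⁻ t, ENNReal.ofReal |weakDeriv α t|) +
      ((∫⁻ t in Ioi t₀, ENNReal.ofReal |phaseFlux h c β (weakDeriv β) t|) +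
      ∫⁻ t in Ioi (-t₀), ENNReal.ofReal
        |phaseFlux h c (fun t => β (-t)) (fun t => -weakDeriv β (-t)) t|) := by
  have ha := hU.integrable.aestronglyMeasurable.aemeasurable
  rw [lintegral_add_left' (by fun_prop), lintegral_phaseFlux_eq _ _ t₀,
    ← lintegral_const_mul' _ _ ENNReal.ofReal_ne_top]
  congr 1
  refine lintegral_congr fun t => ?_
  rw [ENNReal.ofReal_mul (by positivity)]

/-- The calibration is integrated with c determined by the minimum of β. The slip part has mass at
least one, and each half-line carries at least half of the phase energy. -/
theorem U₁.le_G (hU : U₁ α β) (hf : Admissible f) (H : Profile h)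
    (hfh : ∀ y ∈ Ico (0 : ℝ) 1, h ((1 - y) ^ 2) = (1 - y) * f y) {s : ℝ≥0} (hs : 0 < s)
    (ht₀ : ∀ t, β t₀ ≤ β t) :
    ENNReal.ofReal (s * h ((1 - β t₀) ^ 2) + phaseEnergy h (h ((1 - β t₀) ^ 2))) ≤
      G f s α β := by
  have hc : 0 ≤ h ((1 - β t₀) ^ 2) := H.nonneg ⟨sq_nonneg _,
    pow_le_one₀ (sub_nonneg.2 (hU.mem_Icc t₀).2) (by linarith [(hU.mem_Icc t₀).1])⟩
  refine le_trans ?_ (hU.lintegral_calibration_le_G hf H hfh hs ht₀)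
  rw [hU.lintegral_calibration hc t₀, ENNReal.ofReal_add (by positivity)
    (Profile.phaseEnergy_nonneg _)]
  obtain ⟨h1, h2⟩ := hU.half_phaseEnergy_le H t₀
  refine add_le_add (le_mul_of_one_le_right' (one_le_lintegral_abs hU.abs_integral)) ?_
  refine le_trans (le_of_eq ?_) (add_le_add h1 h2)
  have := Profile.phaseEnergy_nonneg (h := h) (h ((1 - β t₀) ^ 2))
  rw [← ENNReal.ofReal_add (by positivity) (by positivity), add_halves]

/-- The weak derivatives of a pair which saturates the lower bound. -/
theorem U₁.weakDeriv_eq_of_G_eq (hU : U₁ α β) (hf : Admissible f) (H : Profile h)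
    (hfh : ∀ y ∈ Ico (0 : ℝ) 1, h ((1 - y) ^ 2) = (1 - y) * f y) {s : ℝ≥0} (hs : 0 < s)
    (ht₀ : ∀ t, β t₀ ≤ β t) {c : ℝ} (hcdef : h ((1 - β t₀) ^ 2) = c) (hc : 0 < c)
    (hG : G f s α β = ENNReal.ofReal (s * c + phaseEnergy h c)) :
    (∃ σ : ℝ, (σ = 1 ∨ σ = -1) ∧ ∀ᵐ t, weakDeriv α t =
      σ * ((s : ℝ)⁻¹ * (c * (1 - β t) ^ 2 / (2 * h ((1 - β t) ^ 2) ^ 2)))) ∧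
    (∀ᵐ t, t₀ < t → weakDeriv β t = (1 - β t) * cosFactor h c ((1 - β t) ^ 2) / 2) ∧
    (∀ᵐ t, -t₀ < t → -weakDeriv β (-t) =
      (1 - β (-t)) * cosFactor h c ((1 - β (-t)) ^ 2) / 2) ∧
    ∫⁻ t, ENNReal.ofReal |weakDeriv α t| = 1 := by
  have hs' : (0 : ℝ) < s := hs
  have hα := hU.isPrimitive_left
  have hβ := hU.isPrimitive_right
  have hK := Profile.phaseEnergy_nonneg (h := h) c
  obtain ⟨h1, h2⟩ := hU.half_phaseEnergy_le H t₀
  have hJ := hU.lintegral_calibration_le_G hf H hfh hs ht₀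
  have h0 := one_le_lintegral_abs hU.abs_integral
  have hcl := hU.le_profile H ht₀
  rw [hcdef] at h1 h2 hJ hcl
  have hJ' := hJ
  rw [hU.lintegral_calibration hc.le t₀] at hJ'
  set S := ∫⁻ t, ENNReal.ofReal |weakDeriv α t|
  set R := ∫⁻ t in Ioi t₀, ENNReal.ofReal |phaseFlux h c β (weakDeriv β) t|
  set L := ∫⁻ t in Ioi (-t₀), ENNReal.ofReal
        |phaseFlux h c (fun t => β (-t)) (fun t => -weakDeriv β (-t)) t|
  set κ := ENNReal.ofReal (phaseEnergy h c / 2)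
  have hq0 : ENNReal.ofReal (s * c) ≠ 0 := by
    rw [Ne, ENNReal.ofReal_eq_zero, not_le]; positivity
  have hGe : G f s α β = ENNReal.ofReal (s * c) * 1 + (κ + κ) := by
    rw [hG, mul_one, ← ENNReal.ofReal_add (by positivity) (by positivity), add_halves,
      ENNReal.ofReal_add (by positivity) hK]
  have hsq : ENNReal.ofReal (s * c) ≤ ENNReal.ofReal (s * c) * S := le_mul_of_one_le_right' h0
  have hκ : κ ≠ ⊤ := ENNReal.ofReal_ne_top
  -- Equality in the sum makes each of the three estimates, for the slip and the two half-lines, an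
  -- equality; cancelling the factor s c uses c > 0.
  have hS : S = 1 := by
    refine le_antisymm ?_ h0
    have h3 : ENNReal.ofReal (s * c) * S + (κ + κ) ≤ ENNReal.ofReal (s * c) * 1 + (κ + κ) :=
      (add_le_add le_rfl (add_le_add h1 h2)).trans (hJ'.trans_eq hGe)
    have h4 := (ENNReal.add_le_add_iff_right (by finiteness)).1 h3
    exact (ENNReal.mul_le_mul_iff_right hq0 ENNReal.ofReal_ne_top).1 h4
  rw [hS, hGe, ENNReal.add_le_add_iff_left (by finiteness)] at hJ'
  have hR : R = κ := by
    refine le_antisymm ?_ h1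
    have h3 : R + κ ≤ κ + κ := (add_le_add le_rfl h2).trans hJ'
    exact (ENNReal.add_le_add_iff_right hκ).1 h3
  have hL : L = κ := by
    refine le_antisymm ?_ h2
    have h3 : κ + L ≤ κ + κ := (add_le_add h1 le_rfl).trans hJ'
    exact (ENNReal.add_le_add_iff_left hκ).1 h3
  have hJeq := hU.lintegral_calibration (h := h) (s := s) hc.le t₀
  have hfin : (∫⁻ t, (ENNReal.ofReal (s * c * |weakDeriv α t|) +
      ENNReal.ofReal |phaseFlux h c β (weakDeriv β) t|)) = G f s α β := by
    rw [hJeq, hGe]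
    change _ * S + (R + L) = _
    rw [hS, hR, hL]
  -- Pointwise domination with equal finite integrals gives equality almost everywhere, hence both
  -- squares vanish.
  have hae := ae_eq_of_ae_le_of_lintegral_le (μ := volume)
    (f := fun t => ENNReal.ofReal (s * c * |weakDeriv α t|) +
      ENNReal.ofReal |phaseFlux h c β (weakDeriv β) t|)
    (g := fun t => energyDensity f s (β t) (weakDeriv α t) (weakDeriv β t))
    (.of_forall fun t => by
      simp only
      rw [abs_phaseFlux _ (hU.mem_Icc t).2]
      exact calibration_le_energyDensity hf hfh hs (hU.mem_Icc t) hc.le (hcl t) _ _)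
    (by rw [hfin, hG]; exact ENNReal.ofReal_ne_top)
    (aemeasurable_energyDensity H hfh s hα hβ hU.mem_Icc) hfin.ge
  have hpt : ∀ᵐ t, |weakDeriv α t| =
      (s : ℝ)⁻¹ * (c * (1 - β t) ^ 2 / (2 * h ((1 - β t) ^ 2) ^ 2)) ∧
      |weakDeriv β t| = (1 - β t) * cosFactor h c ((1 - β t) ^ 2) / 2 := by
    filter_upwards [hae] with t ht
    rw [abs_phaseFlux _ (hU.mem_Icc t).2] at ht
    exact abs_eq_of_calibration_eq hf hfh hs (hU.mem_Icc t) hc (hcl t) ht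
  have hpt' : ∀ᵐ t, |weakDeriv β (-t)| = (1 - β (-t)) * cosFactor h c ((1 - β (-t)) ^ 2) / 2 := by
    have := (Measure.measurePreserving_neg (volume : Measure ℝ)).quasiMeasurePreserving.ae hpt
    filter_upwards [this] with t ht using ht.2
  -- The modulus of β' is known; its sign follows from the sign of the flux where η k > 0, and β' =
  -- 0 where η k = 0.
  have hsign : ∀ {η k b : ℝ}, 0 ≤ η → 0 ≤ k → |b| = η * k / 2 → 0 ≤ η * k * b →
      b = η * k / 2 := by
    intro η k b hη hk hb hb0
    rcases (mul_nonneg hη hk).eq_or_lt with h3 | h3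
    · rw [← h3, zero_div] at hb ⊢; exact abs_eq_zero.1 hb
    · rw [← hb, abs_of_nonneg (nonneg_of_mul_nonneg_right hb0 h3)]
  refine ⟨?_, ?_, ?_, hS⟩
  · obtain ⟨σ, hσ, hσa⟩ := ae_eq_of_abs_integral_eq hU.integrable hU.abs_integral hS
    refine ⟨σ, hσ, ?_⟩
    filter_upwards [hσa, hpt] with t h3 h4
    rw [← h4.1]; exact h3
  · have hlim := tendsto_integral_phaseFlux H hβ (hU.mem_Icc t₀) hU.tendsto_atTop
    rw [hcdef] at hlim
    have := ae_nonneg_of_lintegral_Ioi_abs_eq (phaseFlux_spec H hc.le hβ).1 hlim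
      (by positivity) hR
    filter_upwards [this, hpt] with t h3 h4 ht
    exact hsign (sub_nonneg.2 (hU.mem_Icc t).2) (Profile.cosFactor_nonneg _ _) h4.2 (h3 ht)
  · have hlim := tendsto_integral_phaseFlux (t₀ := -t₀) H hβ.comp_neg
      (by rw [neg_neg]; exact hU.mem_Icc t₀) hU.tendsto_neg_atTop
    rw [neg_neg, hcdef] at hlim
    have := ae_nonneg_of_lintegral_Ioi_abs_eq (phaseFlux_spec H hc.le hβ.comp_neg).1 hlim
      (by positivity) hL
    filter_upwards [this, hpt'] with t h3 h4 ht
    exact hsign (sub_nonneg.2 (hU.mem_Icc _).2) (Profile.cosFactor_nonneg _ _)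
      (by rw [abs_neg]; exact h4) (h3 ht)

end LowerBound

/-! ### Rigidity of minimizers. -/

section Rigidity

variable {f h α β b Z : ℝ → ℝ} {t₀ X : ℝ}

/-- To the right of a minimum point, an optimal profile follows the decaying solution, possibly
after a plateau. -/
theorem exists_sq_eq_decay (H : Profile h) (hX : X ∈ Ioo (0 : ℝ) 1)
    (D : IsDecay (fun x => (x * cosFactor h (h X) x)⁻¹) X Z) (hβ : IsPrimitive β b)
    (hle : ∀ t, β t ≤ 1) (hmin : ∀ t, β t₀ ≤ β t) (hX₀ : (1 - β t₀) ^ 2 = X)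
    (hlim : Tendsto β atTop (𝓝 1))
    (hb : ∀ᵐ t, t₀ < t → b t = (1 - β t) * cosFactor h (h X) ((1 - β t) ^ 2) / 2) :
    ∃ t₁, t₀ ≤ t₁ ∧ ∀ t, t₀ ≤ t → (1 - β t) ^ 2 = Z (t - t₁) := by
  set c := h X
  have hc : 0 < c := H.pos ⟨hX.1.le, hX.2⟩
  have hk := H.continuous_cosFactor hc.le
  set g : ℝ → ℝ := fun t => (1 - β t) * cosFactor h c ((1 - β t) ^ 2) / 2
  have hβc := hβ.continuous
  have hgc : Continuous g := by
    have h1 : Continuous fun t => 1 - β t := continuous_const.sub hβc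
    exact (h1.mul (hk.comp (h1.pow 2))).div_const 2
  have hβeq : ∀ t, t₀ ≤ t → β t = β t₀ + ∫ τ in t₀..t, g τ := by
    intro t ht
    have h1 : ∫ τ in t₀..t, b τ = ∫ τ in t₀..t, g τ := by
      refine intervalIntegral.integral_congr_ae ?_
      filter_upwards [hb] with τ hτ hm
      rw [uIoc_of_le ht] at hm
      exact hτ hm.1
    rw [← h1, ← hβ.sub_eq]; ring
  have hβd : ∀ t, t₀ < t → HasDerivAt β (g t) t := by
    intro t ht
    have h1 : HasDerivAt (fun t => β t₀ + ∫ τ in t₀..t, g τ) (g t) t :=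
      (intervalIntegral.integral_hasDerivAt_right (hgc.intervalIntegrable _ _)
        hgc.stronglyMeasurable.stronglyMeasurableAtFilter hgc.continuousAt).const_add _
    refine h1.congr_of_eventuallyEq ?_
    filter_upwards [Ioi_mem_nhds ht] with τ hτ using hβeq τ (le_of_lt hτ)
  set x : ℝ → ℝ := fun t => (1 - β t) ^ 2
  have hxc : Continuous x := (continuous_const.sub hβc).pow 2
  have hxd : ∀ t, t₀ < t → HasDerivAt x (-(x t * cosFactor h c (x t))) t := by
    intro t ht
    refine (((hβd t ht).const_sub 1).pow 2).congr_deriv ?_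
    simp only [g, x]
    push_cast
    ring
  have hx0 : ∀ t, 0 ≤ x t := fun t => sq_nonneg _
  have hxX : ∀ t, x t ≤ X := fun t => by
    rw [← hX₀]
    exact pow_le_pow_left₀ (sub_nonneg.2 (hle t)) (by linarith [hmin t]) 2
  have hanti : AntitoneOn x (Ici t₀) := by
    refine antitoneOn_of_deriv_nonpos (convex_Ici _) hxc.continuousOn (fun t ht => ?_)
      fun t ht => ?_
    all_goals rw [interior_Ici] at ht
    · exact (hxd t ht).differentiableAt.differentiableWithinAt
    · rw [(hxd t ht).deriv, neg_nonpos]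
      exact mul_nonneg (hx0 t) (Profile.cosFactor_nonneg _ _)
  -- Since k ≤ 1, the product x eᵗ is nondecreasing, so x does not reach 0 in finite time.
  have hpos : ∀ t, t₀ ≤ t → 0 < x t := by
    have hd : ∀ t, t₀ < t → HasDerivAt (fun t => x t * Real.exp t)
        (-(x t * cosFactor h c (x t)) * Real.exp t + x t * Real.exp t) t := fun t ht =>
      (hxd t ht).mul (Real.hasDerivAt_exp t)
    have hm : MonotoneOn (fun t => x t * Real.exp t) (Ici t₀) := by
      refine monotoneOn_of_deriv_nonneg (convex_Ici _)
        (hxc.mul Real.continuous_exp).continuousOn (fun t ht => ?_) fun t ht => ?_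
      all_goals rw [interior_Ici] at ht
      · exact (hd t ht).differentiableAt.differentiableWithinAt
      · rw [(hd t ht).deriv]
        have h1 := mul_le_of_le_one_right (hx0 t) (Profile.cosFactor_le_one (h := h) c (x t))
        nlinarith [Real.exp_pos t]
    intro t ht
    have h1 := hm (mem_Ici.2 le_rfl) ht ht
    have h2 : 0 < x t₀ * Real.exp t₀ := mul_pos (hX.1.trans_eq hX₀.symm) (Real.exp_pos _)
    exact pos_of_mul_pos_left (h2.trans_le h1) (Real.exp_pos t).le
  have hxlim : Tendsto x atTop (𝓝 0) := by
    have := (hlim.const_sub 1).pow 2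
    simpa using this
  obtain ⟨T, hT⟩ := eventually_atTop.1 (hxlim.eventually (gt_mem_nhds hX.1))
  have hT₀ : t₀ ≤ T := by
    by_contra hcon
    exact (hT t₀ (not_le.1 hcon).le).ne hX₀
  -- The last time at height X. Up to it x is constant by monotonicity; after it x < X, as the
  -- uniqueness property of `Z` requires.
  obtain ⟨t₁, ⟨ht₁, hxt₁⟩, hgr⟩ := (isCompact_Icc.inter_right
    (isClosed_eq hxc continuous_const) : IsCompact (Icc t₀ T ∩ {t | x t = X})).exists_isGreatest
      ⟨t₀, ⟨le_rfl, hT₀⟩, hX₀⟩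
  refine ⟨t₁, ht₁.1, fun t ht => ?_⟩
  rcases le_or_gt t t₁ with h1 | h1
  · rw [D.eq_of_nonpos _ (by linarith)]
    exact le_antisymm (hxX t) (hxt₁.ge.trans (hanti ht ht₁.1 h1))
  · have key := D.unique (fun τ => x (t₁ + τ))
      (hxc.comp (continuous_const.add continuous_id)).continuousOn
      (by simp only [add_zero]; exact hxt₁)
      (fun τ hτ => by
        refine ⟨hpos _ (by linarith [ht₁.1]), (hxX _).lt_of_ne fun he => ?_⟩
        rcases le_or_gt (t₁ + τ) T with h2 | h2
        · have := hgr ⟨⟨by linarith [ht₁.1], h2⟩, he⟩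
          linarith
        · exact (hT _ h2.le).ne he)
      (fun τ hτ => by
        rw [inv_inv]
        exact (hxd (t₁ + τ) (by linarith [ht₁.1])).comp_const_add t₁ τ) (t - t₁) (by linarith)
    simpa using key

theorem lintegral_Ioi_sub (g : ℝ → ℝ≥0∞) (t₀ t₁ : ℝ) :
    ∫⁻ t in Ioi t₀, g (t - t₁) = ∫⁻ t in Ioi (t₀ - t₁), g t := by
  have := (measurePreserving_sub_right (volume : Measure ℝ) t₁).setLIntegral_comp_preimage_emb
    (MeasurableEquiv.subRight t₁).measurableEmbedding g (Ioi (t₀ - t₁))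
  rw [← this]
  simp

theorem IsDecay.lintegral_Ioi_sub {r : ℝ → ℝ} (D : IsDecay r X Z) (g : ℝ → ℝ≥0∞) {t₁ : ℝ}
    (ht : t₀ ≤ t₁) : ∫⁻ t in Ioi t₀, g (Z (t - t₁)) =
      g X * ENNReal.ofReal (t₁ - t₀) + ∫⁻ t in Ioi 0, g (Z t) := by
  rw [CohesiveFracture.lintegral_Ioi_sub (fun t => g (Z t)),
    ← Ioc_union_Ioi_eq_Ioi (sub_nonpos.2 ht),
    lintegral_union measurableSet_Ioi (Ioc_disjoint_Ioi le_rfl),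
    setLIntegral_congr_fun measurableSet_Ioc
      (fun t ht => congrArg g (D.eq_of_nonpos t ht.2) : EqOn (fun t => g (Z t)) (fun _ => g X) _),
    setLIntegral_const, Real.volume_Ioc, zero_sub, neg_sub]

/-- The profile of a pair saturating the lower bound is a translate of the optimal one. -/
theorem U₁.sq_eq_decay (hU : U₁ α β) (hf : Admissible f) (H : Profile h)
    (hfh : ∀ y ∈ Ico (0 : ℝ) 1, h ((1 - y) ^ 2) = (1 - y) * f y) {s : ℝ≥0}
    (hmin : ∀ t, β t₀ ≤ β t) (hX : X ∈ Ioo (0 : ℝ) 1) (hX₀ : (1 - β t₀) ^ 2 = X)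
    (D : IsDecay (fun x => (x * cosFactor h (h X) x)⁻¹) X Z)
    (hs : 0 < s) (hsA : (s : ℝ) = opening h (h X))
    (hG : G f s α β = ENNReal.ofReal (s * h X + phaseEnergy h (h X))) :
    (∀ t, (1 - β t) ^ 2 = Z |t - t₀|) ∧ ∃ σ : ℝ, (σ = 1 ∨ σ = -1) ∧ ∀ᵐ t, weakDeriv α t =
      σ * ((s : ℝ)⁻¹ * (h X * Z |t - t₀| / (2 * h (Z |t - t₀|) ^ 2))) := by
  have hs' : (0 : ℝ) < s := hs
  have hc : 0 < h X := H.pos ⟨hX.1.le, hX.2⟩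
  obtain ⟨⟨σ, hσ, hα⟩, hr, hl, hint⟩ :=
    hU.weakDeriv_eq_of_G_eq hf H hfh hs hmin (by rw [hX₀]) hc hG
  have hβ := hU.isPrimitive_right
  obtain ⟨t₁, ht₁, hr₁⟩ := exists_sq_eq_decay H hX D hβ (fun t => (hU.mem_Icc t).2) hmin hX₀
    hU.tendsto_atTop hr
  obtain ⟨t₂, ht₂, hl₂⟩ := exists_sq_eq_decay (t₀ := -t₀) H hX D hβ.comp_neg
    (fun t => (hU.mem_Icc _).2) (fun t => by rw [neg_neg]; exact hmin _)
    (by rw [neg_neg]; exact hX₀) hU.tendsto_neg_atTop hl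
  set F : ℝ → ℝ≥0∞ := fun z => ENNReal.ofReal (h X * z / (2 * h z ^ 2))
  have hF : ∫⁻ t, F ((1 - β t) ^ 2) = ENNReal.ofReal s := by
    have h1 : ∫⁻ t, ENNReal.ofReal s * ENNReal.ofReal |weakDeriv α t| = ENNReal.ofReal s := by
      rw [lintegral_const_mul' _ _ ENNReal.ofReal_ne_top, hint, mul_one]
    rw [← h1]
    refine lintegral_congr_ae ?_
    filter_upwards [hα] with t ht
    have hnn : 0 ≤ (s : ℝ)⁻¹ * (h X * (1 - β t) ^ 2 / (2 * h ((1 - β t) ^ 2) ^ 2)) := by positivity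
    rw [ht, abs_mul, show |σ| = 1 by rcases hσ with h | h <;> simp [h], one_mul,
      abs_of_nonneg hnn, ← ENNReal.ofReal_mul hs'.le, mul_inv_cancel_left₀ hs'.ne']
  have hA : 2 * ∫⁻ t in Ioi 0, F (Z t) = ENNReal.ofReal s := by
    rw [hsA, ← D.lintegral_slip H hX, lintegral_comp_abs fun t => F (Z t)]
  have hsplit := lintegral_eq_Ioi_add_Iio (fun t => F ((1 - β t) ^ 2)) t₀
  rw [hF, setLIntegral_congr_fun measurableSet_Ioi
      (fun t ht => congrArg F (hr₁ t (le_of_lt ht)) :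
        EqOn (fun t => F ((1 - β t) ^ 2)) (fun t => F (Z (t - t₁))) _),
    setLIntegral_congr_fun measurableSet_Ioi
      (fun t ht => congrArg F (hl₂ t (le_of_lt ht)) :
        EqOn (fun t => F ((1 - β (-t)) ^ 2)) (fun t => F (Z (t - t₂))) _),
    D.lintegral_Ioi_sub F ht₁, D.lintegral_Ioi_sub F ht₂, ← hA, two_mul] at hsplit
  set I := ∫⁻ t in Ioi 0, F (Z t)
  have hI : I ≠ ⊤ := fun hI => by rw [hI] at hA; simp at hA
  -- The decaying parts alone produce the total slip s = A(c), so the plateaus produce none; as F(X)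
  -- > 0, both have length zero.
  have hzero : F X * ENNReal.ofReal (t₁ - t₀) + F X * ENNReal.ofReal (t₂ - -t₀) = 0 := by
    have h1 : (F X * ENNReal.ofReal (t₁ - t₀) + F X * ENNReal.ofReal (t₂ - -t₀)) + (I + I) =
        0 + (I + I) := by rw [zero_add]; refine Eq.trans ?_ hsplit.symm; ring
    exact (ENNReal.add_left_inj (by finiteness)).1 h1
  have hFX : F X ≠ 0 := by
    have hX0 := hX.1
    rw [Ne, ENNReal.ofReal_eq_zero, not_le]; positivity
  rw [add_eq_zero, mul_eq_zero, mul_eq_zero, or_iff_right hFX, or_iff_right hFX,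
    ENNReal.ofReal_eq_zero, ENNReal.ofReal_eq_zero] at hzero
  have e1 : t₁ = t₀ := by linarith [hzero.1]
  have e2 : t₂ = -t₀ := by linarith [hzero.2]
  have hall : ∀ t, (1 - β t) ^ 2 = Z |t - t₀| := by
    intro t
    rcases le_total t₀ t with h1 | h1
    · rw [abs_of_nonneg (sub_nonneg.2 h1), hr₁ t h1, e1]
    · have := hl₂ (-t) (by linarith)
      rw [neg_neg, e2] at this
      rw [abs_of_nonpos (sub_nonpos.2 h1), this]
      congr 1; ring
  refine ⟨hall, σ, hσ, ?_⟩
  filter_upwards [hα] with t ht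
  rw [ht, hall]

/-- Both pairs are functions of the distance to their centres, so the shift is the difference of the
centres and the sign is the product of the two signs. -/
theorem U₁.eq_of_decay {α₂ β₂ : ℝ → ℝ} {t₂ κ : ℝ} {S : ℝ → ℝ} {σ σ₂ : ℝ}
    (hU : U₁ α β) (hU₂ : U₁ α₂ β₂) (hσ : σ = 1 ∨ σ = -1) (hσ₂ : σ₂ = 1 ∨ σ₂ = -1)
    (h1 : ∀ t, (1 - β t) ^ 2 = Z |t - t₀|) (h2 : ∀ t, (1 - β₂ t) ^ 2 = Z |t - t₂|)
    (ha : ∀ᵐ t, weakDeriv α t = σ * (κ * S |t - t₀|))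
    (ha₂ : ∀ᵐ t, weakDeriv α₂ t = σ₂ * (κ * S |t - t₂|)) :
    ∃ a₁ t₁ σ : ℝ, (σ = 1 ∨ σ = -1) ∧
      ∀ t, α t = a₁ + σ * α₂ (t - t₁) ∧ β t = β₂ (t - t₁) := by
  have key : ∀ {α : ℝ → ℝ} {a : ℝ → ℝ} {σ τ : ℝ}, IsPrimitive α a →
      (∀ᵐ t, a t = σ * (κ * S |t - τ|)) →
      ∀ t, α t = α τ + σ * ∫ u in (0 : ℝ)..(t - τ), κ * S |u| := by
    intro α a σ τ hp hae t
    have e1 : ∫ u in τ..t, a u = ∫ u in τ..t, σ * (κ * S |u - τ|) :=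
      intervalIntegral.integral_congr_ae (hae.mono fun u hu _ => hu)
    have e2 : ∫ u in τ..t, κ * S |u - τ| = ∫ u in (0 : ℝ)..(t - τ), κ * S |u| := by
      rw [intervalIntegral.integral_comp_sub_right (fun u => κ * S |u|) τ, sub_self]
    rw [← e2, ← intervalIntegral.integral_const_mul, ← e1, ← hp.sub_eq]
    ring
  have hσσ : σ₂ * σ₂ = 1 := by rcases hσ₂ with h | h <;> rw [h] <;> norm_num
  refine ⟨α t₀ - σ * σ₂ * α₂ t₂, t₀ - t₂, σ * σ₂, ?_, fun t => ⟨?_, ?_⟩⟩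
  · rcases hσ with h | h <;> rcases hσ₂ with h' | h' <;> rw [h, h'] <;> norm_num
  · rw [key hU.isPrimitive_left ha t, key hU₂.isPrimitive_left ha₂ (t - (t₀ - t₂)),
      show t - (t₀ - t₂) - t₂ = t - t₀ by ring]
    linear_combination (-σ * ∫ u in (0 : ℝ)..(t - t₀), κ * S |u|) * hσσ
  · have h3 : (1 - β t) ^ 2 = (1 - β₂ (t - (t₀ - t₂))) ^ 2 := by
      rw [h1, h2, show t - (t₀ - t₂) - t₂ = t - t₀ by ring]
    have := (pow_left_inj₀ (sub_nonneg.2 (hU.mem_Icc t).2)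
      (sub_nonneg.2 (hU₂.mem_Icc _).2) two_ne_zero).1 h3
    linarith

end Rigidity

/-! ### The brittle profile and the case s = 0. -/

theorem isPrimitive_const (a : ℝ) : IsPrimitive (fun _ => a) fun _ => 0 :=
  ⟨continuous_const.locallyIntegrable, fun x y => by simp⟩

/-- Potential and gradient each contribute e^{-|t|}/4. The pair has zero slip and so lies outside
`U₁`; it only represents the value 1. -/
theorem G_zero_brittleProfile (f : ℝ → ℝ) (s : ℝ≥0) : G f s 0 brittleProfile = 1 := by
  set g : ℝ → ℝ := fun t => Real.exp (-|t| / 2) / 2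
  have hg : Continuous g := by fun_prop
  obtain ⟨hβ, -⟩ := isPrimitive_comp_abs (u := fun t => 1 - Real.exp (-t / 2)) (g := g)
    (by fun_prop) hg (fun t ht => by
      have h1 : HasDerivAt (fun t : ℝ => -t / 2) (-1 / 2) t := (hasDerivAt_id t).neg.div_const 2
      refine (h1.exp.const_sub 1).congr_deriv ?_
      simp only [g, abs_of_pos ht]
      ring) (C := 1) (fun t => by
      have h1 : Real.exp (-|t| / 2) ≤ 1 := Real.exp_le_one_iff.2 (by linarith [abs_nonneg t])
      have h2 := Real.exp_pos (-|t| / 2)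
      simp only [g]
      rw [abs_of_pos (by positivity)]
      linarith)
  have hsq : ∀ τ : ℝ, Real.exp (-τ / 2) ^ 2 = Real.exp (-τ) := fun τ => by
    rw [← Real.exp_nat_mul]; congr 1; push_cast; ring
  rw [show (0 : ℝ → ℝ) = fun _ => 0 from rfl, show brittleProfile =
    fun t => (fun t => 1 - Real.exp (-t / 2)) |t| from rfl,
    G_eq_lintegral_energyDensity s (isPrimitive_const 0) hβ]
  have hpt : ∀ t : ℝ, energyDensity f s ((fun t => 1 - Real.exp (-t / 2)) |t|) 0
      (if t < 0 then -g (-t) else g t) = ENNReal.ofReal (Real.exp (-|t|) / 2) := by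
    intro t
    have h1 : (if t < 0 then -g (-t) else g t) ^ 2 = Real.exp (-|t|) / 4 := by
      have : (if t < 0 then -g (-t) else g t) ^ 2 = g t ^ 2 := by
        split_ifs
        · rw [neg_sq]; simp only [g, abs_neg]
        · rfl
      rw [this]
      simp only [g]
      rw [div_pow, hsq]; norm_num
    have h2 := Real.exp_pos (-|t|)
    rw [energyDensity, h1, sub_sub_cancel, hsq, zero_pow two_ne_zero, ENNReal.ofReal_zero,
      mul_zero, zero_add, ← ENNReal.ofReal_add (by positivity) (by positivity)]
    congr 1; ring
  rw [lintegral_congr hpt, lintegral_comp_abs fun t => ENNReal.ofReal (Real.exp (-t) / 2),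
    ← ofReal_integral_eq_lintegral_ofReal ((integrableOn_exp_neg_Ioi 0).div_const 2)
      (.of_forall fun t => by positivity), integral_div, integral_exp_neg_Ioi_zero,
    ← ENNReal.ofReal_ofNat, ← ENNReal.ofReal_mul (by norm_num)]
  norm_num

theorem isLeast_range_brittleProfile : IsLeast (range brittleProfile) 0 := by
  refine ⟨⟨0, by simp [brittleProfile]⟩, ?_⟩
  rintro _ ⟨t, rfl⟩
  have : Real.exp (-|t| / 2) ≤ 1 := Real.exp_le_one_iff.2 (by linarith [abs_nonneg t])
  simp only [brittleProfile]
  linarith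

theorem g₀_le {f : ℝ → ℝ} {s : ℝ≥0} {α β : ℝ → ℝ} (h : U₁ α β) : g₀ f s ≤ G f s α β :=
  iInf_le_of_le α (iInf_le_of_le β (iInf_le _ h))

theorem le_g₀ {f : ℝ → ℝ} {s : ℝ≥0} {C : ℝ≥0∞} (h : ∀ α β, U₁ α β → C ≤ G f s α β) :
    C ≤ g₀ f s :=
  le_iInf fun α => le_iInf fun β => le_iInf fun hU => h α β hU

/-- The opening of the optimal profile with minimum value `μ`. -/
noncomputable def minOpening (h : ℝ → ℝ) (μ : ℝ) : ℝ := opening h (h ((1 - μ) ^ 2))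

theorem U₁.const_one {α β : ℝ → ℝ} (h : U₁ α β) : U₁ α fun _ => 1 where
  continuous_left := h.continuous_left
  continuous_right := continuous_const
  memH1loc_left := h.memH1loc_left
  memH1loc_right := ⟨memL2loc_of_continuous continuous_const, _,
    (isPrimitive_const 1).hasWeakDeriv, memL2loc_of_continuous continuous_const⟩
  integrable := h.integrable
  abs_integral := h.abs_integral
  mem_Icc := fun _ => ⟨zero_le_one, le_rfl⟩
  tendsto := tendsto_const_nhds

theorem G_zero_const_one {α β : ℝ → ℝ} (f : ℝ → ℝ) (h : U₁ α β) : G f 0 α (fun _ => 1) = 0 := by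
  rw [G_eq_lintegral_energyDensity 0 h.isPrimitive_left (isPrimitive_const 1)]
  simp [energyDensity]

theorem eq_one_of_G_eq_zero {f h α β : ℝ → ℝ} (H : Profile h)
    (hfh : ∀ y ∈ Ico (0 : ℝ) 1, h ((1 - y) ^ 2) = (1 - y) * f y) {s : ℝ≥0} (hU : U₁ α β)
    (hG : G f s α β = 0) (t : ℝ) : β t = 1 := by
  rw [G_eq_lintegral_energyDensity s hU.isPrimitive_left hU.isPrimitive_right,
    lintegral_eq_zero_iff' (aemeasurable_energyDensity H hfh s hU.isPrimitive_left
      hU.isPrimitive_right hU.mem_Icc)] at hG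
  have hae : β =ᵐ[volume] fun _ => 1 := by
    filter_upwards [hG] with t ht
    simp only [energyDensity, Pi.zero_apply, add_eq_zero] at ht
    have h1 := ENNReal.ofReal_eq_zero.1 ht.1.2
    nlinarith [sq_nonneg (1 - β t), sq_eq_zero_iff.1 (le_antisymm
      (by linarith : (1 - β t) ^ 2 ≤ 0) (sq_nonneg _))]
  exact congrFun ((Continuous.ae_eq_iff_eq volume hU.continuous_right continuous_const).1 hae) t

/-! ### The value of g₀ and the threshold. -/

namespace Profile

variable {f h : ℝ → ℝ}

theorem sq_mem {μ : ℝ} (hμ : μ ∈ Icc (0 : ℝ) 1) : (1 - μ) ^ 2 ∈ Icc (0 : ℝ) 1 :=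
  ⟨sq_nonneg _, pow_le_one₀ (sub_nonneg.2 hμ.2) (by linarith [hμ.1])⟩

theorem apply_sq_mem (H : Profile h) {μ : ℝ} (hμ : μ ∈ Ioc (0 : ℝ) 1) :
    h ((1 - μ) ^ 2) ∈ Ioc 0 (h 0) := by
  have h1 := sq_mem (Ioc_subset_Icc_self hμ)
  exact ⟨H.pos ⟨h1.1, pow_lt_one₀ (sub_nonneg.2 hμ.2) (by linarith [hμ.1]) two_ne_zero⟩,
    H.antitoneOn ⟨le_rfl, zero_le_one⟩ h1 h1.1⟩

theorem apply_sq_lt (H : Profile h) {μ ν : ℝ} (hμ : μ ∈ Icc (0 : ℝ) 1) (hν : ν ∈ Icc (0 : ℝ) 1)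
    (hμν : μ < ν) : h ((1 - μ) ^ 2) < h ((1 - ν) ^ 2) :=
  H.strictAntiOn (sq_mem hν) (sq_mem hμ)
    (pow_lt_pow_left₀ (by linarith) (sub_nonneg.2 hν.2) two_ne_zero)

theorem strictAntiOn_minOpening (H : Profile h) : StrictAntiOn (minOpening h) (Ioc 0 1) :=
  fun _ hμ _ hν hμν => H.strictAntiOn_opening (H.apply_sq_mem hμ) (H.apply_sq_mem hν)
    (H.apply_sq_lt (Ioc_subset_Icc_self hμ) (Ioc_subset_Icc_self hν) hμν)

theorem continuousOn_minOpening (H : Profile h) : ContinuousOn (minOpening h) (Ioc 0 1) :=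
  H.continuousOn_opening.comp
    (H.continuous.comp ((continuous_const.sub continuous_id).pow 2)).continuousOn
    fun _ hμ => (H.apply_sq_mem hμ).1

theorem minOpening_one (H : Profile h) : minOpening h 1 = 0 := by
  rw [minOpening, sub_self, zero_pow two_ne_zero, H.opening_map_zero]

theorem minOpening_nonneg (H : Profile h) {μ : ℝ} (hμ : μ ∈ Ioc (0 : ℝ) 1) :
    0 ≤ minOpening h μ :=
  H.opening_nonneg (H.apply_sq_mem hμ).1

theorem exists_minOpening_eq (H : Profile h) {μ s : ℝ} (hμ : μ ∈ Ioc (0 : ℝ) 1) (hs : 0 ≤ s)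
    (hsμ : s ≤ minOpening h μ) : ∃ ν ∈ Ioc (0 : ℝ) 1, minOpening h ν = s := by
  obtain ⟨ν, hν, he⟩ := intermediate_value_Icc' hμ.2
    (H.continuousOn_minOpening.mono fun x hx => ⟨hμ.1.trans_le hx.1, hx.2⟩)
    ⟨H.minOpening_one.le.trans hs, hsμ⟩
  exact ⟨ν, ⟨hμ.1.trans_le hν.1, hν.2⟩, he⟩

theorem sq_mem_Ioo {μ : ℝ} (hμ : μ ∈ Ioo (0 : ℝ) 1) : (1 - μ) ^ 2 ∈ Ioo (0 : ℝ) 1 :=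
  ⟨pow_pos (by linarith [hμ.2]) 2,
    pow_lt_one₀ (by linarith [hμ.2]) (by linarith [hμ.1]) two_ne_zero⟩

theorem lt_one_of_minOpening_eq (H : Profile h) {μ : ℝ} {s : ℝ≥0} (hμ : μ ∈ Ioc (0 : ℝ) 1)
    (hs : 0 < s) (he : minOpening h μ = s) : μ ∈ Ioo (0 : ℝ) 1 := by
  refine ⟨hμ.1, hμ.2.lt_of_ne fun h1 => ?_⟩
  rw [h1, H.minOpening_one] at he
  exact hs.ne (by exact_mod_cast he)

theorem apply_min_mem (H : Profile h) {α β : ℝ → ℝ} (hU : U₁ α β) (t₀ : ℝ) :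
    h ((1 - β t₀) ^ 2) ∈ Icc 0 (h 0) :=
  ⟨H.nonneg (sq_mem (hU.mem_Icc t₀)), H.antitoneOn ⟨le_rfl, zero_le_one⟩
    (sq_mem (hU.mem_Icc t₀)) (sq_nonneg _)⟩

/-- The value of the cohesive energy for openings below the threshold. -/
theorem g₀_eq (H : Profile h) (hf : Admissible f)
    (hfh : ∀ y ∈ Ico (0 : ℝ) 1, h ((1 - y) ^ 2) = (1 - y) * f y) {μ : ℝ} {s : ℝ≥0}
    (hμ : μ ∈ Ioc (0 : ℝ) 1) (hs : 0 < s) (he : minOpening h μ = s) :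
    g₀ f s = ENNReal.ofReal (s * h ((1 - μ) ^ 2) + phaseEnergy h (h ((1 - μ) ^ 2))) ∧
      ∃ α β, IsMinimizer f s α β := by
  have hμ' := H.lt_one_of_minOpening_eq hμ hs he
  have hs' : (0 : ℝ) < s := hs
  have hc := H.apply_sq_mem hμ
  obtain ⟨α, β, hU, hG⟩ := exists_U₁_G_eq hf H hfh (sq_mem_Ioo hμ')
  have he' : opening h (h ((1 - μ) ^ 2)) = s := he
  have hGs := hG s
  -- With the opening equal to s, elastic term and potential share coincide, and the upper bound
  -- meets the lower one.
  rw [he', show (s : ℝ) ^ 2 * h ((1 - μ) ^ 2) / (2 * s) + h ((1 - μ) ^ 2) * s / 2 =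
    s * h ((1 - μ) ^ 2) by field_simp; ring] at hGs
  have hle : ENNReal.ofReal (s * h ((1 - μ) ^ 2) + phaseEnergy h (h ((1 - μ) ^ 2))) ≤ g₀ f s := by
    refine le_g₀ fun α β hU => ?_
    obtain ⟨t₀, ht₀⟩ := hU.exists_forall_le
    refine le_trans (ENNReal.ofReal_le_ofReal ?_) (hU.le_G hf H hfh hs ht₀)
    by_cases h1 : h ((1 - β t₀) ^ 2) = h ((1 - μ) ^ 2)
    · rw [h1]
    · rw [← he']
      exact (H.opening_mul_add_phaseEnergy_lt hc (H.apply_min_mem hU t₀) h1).le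
  have hg := le_antisymm ((g₀_le hU).trans_eq hGs) hle
  exact ⟨hg, α, β, hU, by rw [hGs, hg]⟩

/-- The minimum value of a minimizer. -/
theorem apply_min_eq (H : Profile h) (hf : Admissible f)
    (hfh : ∀ y ∈ Ico (0 : ℝ) 1, h ((1 - y) ^ 2) = (1 - y) * f y) {μ : ℝ} {s : ℝ≥0}
    (hμ : μ ∈ Ioc (0 : ℝ) 1) (hs : 0 < s) (he : minOpening h μ = s) {α β : ℝ → ℝ} {t₀ : ℝ}
    (hm : IsMinimizer f s α β) (ht₀ : ∀ t, β t₀ ≤ β t) : β t₀ = μ := by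
  have hc := H.apply_sq_mem hμ
  have hne : ¬ h ((1 - β t₀) ^ 2) ≠ h ((1 - μ) ^ 2) := by
    intro hne
    have h1 := H.opening_mul_add_phaseEnergy_lt hc (H.apply_min_mem hm.1 t₀) hne
    have h2 := hm.1.le_G hf H hfh hs ht₀
    have h3 := phaseEnergy_nonneg (h := h) (h ((1 - μ) ^ 2))
    have h4 := hc.1
    have h5 := H.opening_nonneg hc.1
    have he' : opening h (h ((1 - μ) ^ 2)) = s := he
    rw [hm.2, (H.g₀_eq hf hfh hμ hs he).1, ← he', ENNReal.ofReal_le_ofReal_iff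
      (add_nonneg (mul_nonneg h5 h4.le) h3)] at h2
    exact absurd h1 (not_lt.2 h2)
  have h1 := H.strictAntiOn.injOn (sq_mem (hm.1.mem_Icc t₀)) (sq_mem (Ioc_subset_Icc_self hμ))
    (not_not.1 hne)
  have h2 := (pow_left_inj₀ (sub_nonneg.2 (hm.1.mem_Icc t₀).2) (sub_nonneg.2 hμ.2)
    two_ne_zero).1 h1
  linarith

theorem exists_U₁ (H : Profile h) (hf : Admissible f)
    (hfh : ∀ y ∈ Ico (0 : ℝ) 1, h ((1 - y) ^ 2) = (1 - y) * f y) : ∃ α β, U₁ α β := by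
  obtain ⟨α, β, hU, -⟩ := exists_U₁_G_eq hf H hfh (X := 1 / 2) ⟨by norm_num, by norm_num⟩
  exact ⟨α, β, hU⟩

theorem g₀_zero (H : Profile h) (hf : Admissible f)
    (hfh : ∀ y ∈ Ico (0 : ℝ) 1, h ((1 - y) ^ 2) = (1 - y) * f y) :
    g₀ f 0 = 0 ∧ ∃ α β, IsMinimizer f 0 α β := by
  obtain ⟨α, β, hU⟩ := H.exists_U₁ hf hfh
  have h0 := G_zero_const_one f hU
  have hg : g₀ f 0 = 0 := le_antisymm ((g₀_le hU.const_one).trans_eq h0) zero_le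
  exact ⟨hg, α, _, hU.const_one, by rw [h0, hg]⟩

/-- For s > 0 the strict minimum of s c + K(c) is compared with its value K(0) = 1 at c = 0. -/
theorem g₀_lt_one (H : Profile h) (hf : Admissible f)
    (hfh : ∀ y ∈ Ico (0 : ℝ) 1, h ((1 - y) ^ 2) = (1 - y) * f y) {μ : ℝ} {s : ℝ≥0}
    (hμ : μ ∈ Ioc (0 : ℝ) 1) (he : minOpening h μ = s) :
    g₀ f s < 1 ∧ ∃ α β, IsMinimizer f s α β := by
  rcases (zero_le : 0 ≤ s).eq_or_lt with rfl | hs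
  · obtain ⟨h1, h2⟩ := H.g₀_zero hf hfh
    exact ⟨by rw [h1]; exact one_pos, h2⟩
  · obtain ⟨h1, h2⟩ := H.g₀_eq hf hfh hμ hs he
    refine ⟨?_, h2⟩
    have hc := H.apply_sq_mem hμ
    have h3 := H.opening_mul_add_phaseEnergy_lt hc ⟨le_rfl, hc.1.le.trans hc.2⟩ hc.1.ne
    rw [mul_zero, zero_add, phaseEnergy_zero] at h3
    rw [h1, ← he, ← ENNReal.ofReal_one]
    exact (ENNReal.ofReal_lt_ofReal_iff one_pos).2 h3

/-- By the intermediate value property s exceeds all openings, so s c + K(c) ≥ 1 for every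
admissible c. Conversely, rescaled optimal curves with c → 0 have energy bounded by a quantity
tending to 1. -/
theorem g₀_eq_one (H : Profile h) (hf : Admissible f)
    (hfh : ∀ y ∈ Ico (0 : ℝ) 1, h ((1 - y) ^ 2) = (1 - y) * f y) {s : ℝ≥0}
    (hn : ¬ ∃ μ ∈ Ioc (0 : ℝ) 1, minOpening h μ = s) : g₀ f s = 1 := by
  have hlt : ∀ μ ∈ Ioc (0 : ℝ) 1, minOpening h μ < s := fun μ hμ => by
    by_contra hcon
    exact hn (H.exists_minOpening_eq hμ s.coe_nonneg (not_lt.1 hcon))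
  have hs' : (0 : ℝ) < s := by
    have := hlt 1 ⟨one_pos, le_rfl⟩
    rwa [H.minOpening_one] at this
  have hs : 0 < s := hs'
  have h00 : 0 < h 0 := H.pos ⟨le_rfl, one_pos⟩
  have hA : ∀ e ∈ Ioc 0 (h 0), opening h e ≤ s := by
    intro e hed
    obtain ⟨x, hx, rfl⟩ := H.exists_eq (Ioc_subset_Icc_self hed)
    have hx1 : x < 1 := hx.2.lt_of_ne fun h1 => by
      rw [h1, H.map_one] at hed; exact hed.1.false
    have h1 : √x < 1 := (Real.sqrt_lt' one_pos).2 (by simpa using hx1)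
    have := hlt (1 - √x) ⟨by linarith, by linarith [Real.sqrt_nonneg x]⟩
    rw [minOpening, sub_sub_cancel, Real.sq_sqrt hx.1] at this
    exact this.le
  refine le_antisymm ?_ (le_g₀ fun α β hU => ?_)
  -- Any fixed value in (0, 1) would do: its opening is a positive lower bound for the openings at
  -- smaller minima, so that the term s² c / (2 A) tends to 0 with c.
  · set μ₀ : ℝ := 1 / 2
    have hμ₀ : μ₀ ∈ Ioc (0 : ℝ) 1 := ⟨by norm_num [μ₀], by norm_num [μ₀]⟩
    set A₀ := minOpening h μ₀
    have hA₀ : 0 < A₀ := by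
      have := H.strictAntiOn_minOpening hμ₀ ⟨one_pos, le_rfl⟩ (by norm_num [μ₀])
      rwa [H.minOpening_one] at this
    set c : ℝ → ℝ := fun μ => h ((1 - μ) ^ 2)
    have hlim : Tendsto (fun μ => (s : ℝ) ^ 2 * c μ / (2 * A₀) + c μ * s / 2 + 1) (𝓝[>] 0)
        (𝓝 1) := by
      have hcont : Continuous fun μ => (s : ℝ) ^ 2 * c μ / (2 * A₀) + c μ * s / 2 + 1 := by
        have : Continuous c := H.continuous.comp (by fun_prop)
        fun_prop
      have h1 := (hcont.tendsto 0).mono_left (nhdsWithin_le_nhds (s := Ioi 0))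
      simpa [c, H.map_one] using h1
    have hlim' := ENNReal.tendsto_ofReal hlim
    rw [ENNReal.ofReal_one] at hlim'
    refine ge_of_tendsto hlim' ?_
    filter_upwards [Ioo_mem_nhdsGT hμ₀.1] with μ hμ
    have hμ' : μ ∈ Ioo (0 : ℝ) 1 := ⟨hμ.1, hμ.2.trans_le hμ₀.2⟩
    obtain ⟨α, β, hU, hG⟩ := exists_U₁_G_eq hf H hfh (sq_mem_Ioo hμ')
    refine (g₀_le hU).trans ((hG s).trans_le (ENNReal.ofReal_le_ofReal ?_))
    have hcm := H.apply_sq_mem (Ioo_subset_Ioc_self hμ')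
    have h1 : A₀ ≤ opening h (c μ) :=
      H.strictAntiOn_minOpening.antitoneOn (Ioo_subset_Ioc_self hμ') hμ₀ hμ.2.le
    have h2 := hA _ hcm
    have h3 := H.phaseEnergy_le_one hcm.1.le
    have h4 : 0 < c μ := hcm.1
    change (s : ℝ) ^ 2 * c μ / (2 * opening h (c μ)) + c μ * opening h (c μ) / 2 +
      phaseEnergy h (c μ) ≤ _
    gcongr
  · obtain ⟨t₀, ht₀⟩ := hU.exists_forall_le
    refine le_trans ?_ (hU.le_G hf H hfh hs ht₀)
    rw [← ENNReal.ofReal_one]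
    exact ENNReal.ofReal_le_ofReal
      (H.one_le_mul_add_phaseEnergy hs'.le hA (H.apply_min_mem hU t₀))

theorem lt_sFrac_iff (H : Profile h) (hf : Admissible f)
    (hfh : ∀ y ∈ Ico (0 : ℝ) 1, h ((1 - y) ^ 2) = (1 - y) * f y) (s : ℝ≥0) :
    (s : ℝ≥0∞) < sFrac f ↔ ∃ μ ∈ Ioc (0 : ℝ) 1, minOpening h μ = s := by
  constructor
  · intro hlt
    simp only [sFrac, lt_iSup_iff] at hlt
    obtain ⟨s', hs', hlt⟩ := hlt
    have hgood : ∃ μ ∈ Ioc (0 : ℝ) 1, minOpening h μ = s' := by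
      by_contra hn
      rw [H.g₀_eq_one hf hfh hn] at hs'
      exact hs'.false
    obtain ⟨μ, hμ, he⟩ := hgood
    refine H.exists_minOpening_eq hμ s.coe_nonneg ?_
    rw [he]
    exact_mod_cast hlt.le
  · rintro ⟨μ, hμ, he⟩
    -- A smaller minimum has a strictly larger opening, still with energy below 1; this makes the
    -- inequality with the supremum strict.
    have hμ2 : μ / 2 ∈ Ioc (0 : ℝ) 1 := ⟨by linarith [hμ.1], by linarith [hμ.1, hμ.2]⟩
    have h1 := H.strictAntiOn_minOpening hμ2 hμ (by linarith [hμ.1])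
    set s' : ℝ≥0 := ⟨minOpening h (μ / 2), H.minOpening_nonneg hμ2⟩
    have h2 : s < s' := by
      rw [← NNReal.coe_lt_coe, ← he]; exact h1
    have h3 := (H.g₀_lt_one hf hfh (s := s') hμ2 rfl).1
    calc (s : ℝ≥0∞) < s' := by exact_mod_cast h2
      _ ≤ sFrac f := le_iSup₂_of_le s' h3 le_rfl

/-! ### The minimum value as a function of s. -/

open Classical in
/-- The minimum value of the optimal profile with opening `s`. -/
noncomputable def minValue (h : ℝ → ℝ) (s : ℝ≥0) : ℝ :=
  if hs : ∃ μ ∈ Ioc (0 : ℝ) 1, minOpening h μ = s then hs.choose else 0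

theorem minValue_eq (H : Profile h) {μ : ℝ} {s : ℝ≥0} (hμ : μ ∈ Ioc (0 : ℝ) 1)
    (he : minOpening h μ = s) : minValue h s = μ := by
  have hs : ∃ μ ∈ Ioc (0 : ℝ) 1, minOpening h μ = s := ⟨μ, hμ, he⟩
  rw [minValue, dif_pos hs]
  exact H.strictAntiOn_minOpening.injOn hs.choose_spec.1 hμ (hs.choose_spec.2.trans he.symm)

theorem minValue_eq_zero {s : ℝ≥0} (hn : ¬ ∃ μ ∈ Ioc (0 : ℝ) 1, minOpening h μ = s) :
    minValue h s = 0 := dif_neg hn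

theorem minValue_mem (H : Profile h) (s : ℝ≥0) : minValue h s ∈ Icc (0 : ℝ) 1 := by
  by_cases hs : ∃ μ ∈ Ioc (0 : ℝ) 1, minOpening h μ = s
  · obtain ⟨μ, hμ, he⟩ := hs
    rw [H.minValue_eq hμ he]; exact Ioc_subset_Icc_self hμ
  · rw [minValue_eq_zero hs]; exact ⟨le_rfl, zero_le_one⟩

theorem antitone_minValue (H : Profile h) : Antitone (minValue h) := by
  intro s t hst
  by_cases ht : ∃ μ ∈ Ioc (0 : ℝ) 1, minOpening h μ = t
  · obtain ⟨μ, hμ, he⟩ := ht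
    obtain ⟨ν, hν, he'⟩ := H.exists_minOpening_eq hμ s.coe_nonneg (by rw [he]; exact_mod_cast hst)
    rw [H.minValue_eq hμ he, H.minValue_eq hν he']
    refine (H.strictAntiOn_minOpening.le_iff_ge hν hμ).1 ?_
    rw [he, he']; exact_mod_cast hst
  · rw [minValue_eq_zero ht]; exact (H.minValue_mem s).1

/-- A monotone function with dense range in [0, 1] is continuous. Here 1 - m takes every value in
[0, 1), since each minimum in (0, 1] is realized by its own opening; this also covers continuity
across s_frac. -/
theorem continuous_minValue (H : Profile h) : Continuous (minValue h) := by
  have hmem : ∀ s, 1 - minValue h s ∈ unitInterval := fun s =>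
    ⟨by linarith [(H.minValue_mem s).2], by linarith [(H.minValue_mem s).1]⟩
  set F : ℝ≥0 → unitInterval := fun s => ⟨1 - minValue h s, hmem s⟩
  have hmono : Monotone F := fun s t hst => Subtype.mk_le_mk.2 (by
    linarith [H.antitone_minValue hst])
  have hdense : DenseRange F := by
    refine (dense_compl_singleton (1 : unitInterval)).mono fun x hx => ?_
    have hx1 : (x : ℝ) < 1 := x.2.2.lt_of_ne fun h1 => hx (Subtype.ext h1)
    have hμ : 1 - (x : ℝ) ∈ Ioc (0 : ℝ) 1 := ⟨by linarith, by linarith [x.2.1]⟩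
    set s : ℝ≥0 := ⟨minOpening h (1 - x), H.minOpening_nonneg hμ⟩
    have hs : minOpening h (1 - x) = s := rfl
    refine ⟨s, Subtype.ext ?_⟩
    change 1 - minValue h s = x
    rw [H.minValue_eq hμ hs, sub_sub_cancel]
  have hc := continuous_const (y := (1 : ℝ)).sub
    (continuous_subtype_val.comp (hmono.continuous_of_denseRange hdense))
  refine hc.congr fun s => ?_
  simp [F]

end Profile

end CohesiveFracture

/-! ### The theorem. -/

open CohesiveFracture in
theorem theorem6p2 (f : ℝ → ℝ) (hf : Admissible f) :
    -- below the threshold: existence, and uniqueness up to translations and the sign of `α`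
    (∀ s : ℝ≥0, (s : ℝ≥0∞) < sFrac f →
      g₀ f s < 1 ∧ ∃ α β : ℝ → ℝ, IsMinimizer f s α β) ∧
    (∀ s : ℝ≥0, 0 < s → (s : ℝ≥0∞) < sFrac f →
      ∀ α β α₂ β₂ : ℝ → ℝ, IsMinimizer f s α β → IsMinimizer f s α₂ β₂ →
        ∃ a₁ t₁ σ : ℝ, (σ = 1 ∨ σ = -1) ∧
          ∀ t, α t = a₁ + σ * α₂ (t - t₁) ∧ β t = β₂ (t - t₁)) ∧
    -- above the threshold
    (∀ s : ℝ≥0, sFrac f ≤ (s : ℝ≥0∞) →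
      g₀ f s = 1 ∧ g₀ f s = G f s 0 brittleProfile) ∧
    -- the minimum value `m s` of the optimal profile
    ∃ m : ℝ≥0 → ℝ,
      (∀ s : ℝ≥0, (s : ℝ≥0∞) < sFrac f →
        ∀ α β : ℝ → ℝ, IsMinimizer f s α β → IsLeast (range β) (m s)) ∧
      (∀ s : ℝ≥0, sFrac f ≤ (s : ℝ≥0∞) → IsLeast (range brittleProfile) (m s)) ∧
      Continuous m ∧
      StrictAntiOn m {s : ℝ≥0 | (s : ℝ≥0∞) < sFrac f} ∧
      m 0 = 1 ∧
      ∀ s : ℝ≥0, sFrac f ≤ (s : ℝ≥0∞) → m s = 0 := by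
  obtain ⟨h, H, hfh⟩ := hf.exists_profile
  have hlt := H.lt_sFrac_iff hf hfh
  have hge : ∀ s : ℝ≥0, sFrac f ≤ s → ¬ ∃ μ ∈ Ioc (0 : ℝ) 1, minOpening h μ = s :=
    fun s hs hex => absurd ((hlt s).2 hex) (not_lt.2 hs)
  refine ⟨fun s hs => ?_, fun s hs0 hs α β α₂ β₂ hm hm₂ => ?_, fun s hs => ?_,
    Profile.minValue h, fun s hs α β hm => ?_, fun s hs => ?_, H.continuous_minValue,
    fun s hs t ht hst => ?_, ?_, fun s hs => Profile.minValue_eq_zero (hge s hs)⟩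
  · obtain ⟨μ, hμ, he⟩ := (hlt s).1 hs
    exact H.g₀_lt_one hf hfh hμ he
  · obtain ⟨μ, hμ, he⟩ := (hlt s).1 hs
    have hX := Profile.sq_mem_Ioo (H.lt_one_of_minOpening_eq hμ hs0 he)
    obtain ⟨Z, D⟩ := H.exists_isDecay hX
    have key : ∀ {α β : ℝ → ℝ}, IsMinimizer f s α β → ∃ t₀, (∀ t, (1 - β t) ^ 2 = Z |t - t₀|) ∧
        ∃ σ : ℝ, (σ = 1 ∨ σ = -1) ∧ ∀ᵐ t, weakDeriv α t = σ * ((s : ℝ)⁻¹ *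
          (h ((1 - μ) ^ 2) * Z |t - t₀| / (2 * h (Z |t - t₀|) ^ 2))) := by
      intro α β hm
      obtain ⟨t₀, ht₀⟩ := hm.1.exists_forall_le
      have hβ := H.apply_min_eq hf hfh hμ hs0 he hm ht₀
      exact ⟨t₀, hm.1.sq_eq_decay hf H hfh ht₀ hX (by rw [hβ]) D hs0 he.symm
        (hm.2.trans (H.g₀_eq hf hfh hμ hs0 he).1)⟩
    obtain ⟨t₀, h1, σ, hσ, ha⟩ := key hm
    obtain ⟨t₂, h2, σ₂, hσ₂, ha₂⟩ := key hm₂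
    exact hm.1.eq_of_decay (S := fun τ => h ((1 - μ) ^ 2) * Z τ / (2 * h (Z τ) ^ 2)) hm₂.1
      hσ hσ₂ h1 h2 ha ha₂
  · have h1 := H.g₀_eq_one hf hfh (hge s hs)
    exact ⟨h1, by rw [h1, G_zero_brittleProfile]⟩
  · obtain ⟨μ, hμ, he⟩ := (hlt s).1 hs
    obtain ⟨t₀, ht₀⟩ := hm.1.exists_forall_le
    have hβ : β t₀ = μ := by
      -- The calibration needs s > 0. For s = 0 the minimal energy is 0, which forces β = 1, the
      -- point where the opening vanishes.
      rcases (zero_le : 0 ≤ s).eq_or_lt with rfl | hs0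
      · have h1 := eq_one_of_G_eq_zero H hfh hm.1 (hm.2.trans (H.g₀_zero hf hfh).1) t₀
        rw [h1]
        exact H.strictAntiOn_minOpening.injOn ⟨one_pos, le_rfl⟩ hμ
          (by rw [H.minOpening_one, he]; rfl)
      · exact H.apply_min_eq hf hfh hμ hs0 he hm ht₀
    rw [H.minValue_eq hμ he, ← hβ]
    exact ⟨mem_range_self t₀, by rintro _ ⟨t, rfl⟩; exact ht₀ t⟩
  · rw [Profile.minValue_eq_zero (hge s hs)]
    exact isLeast_range_brittleProfile
  · obtain ⟨μ, hμ, he⟩ := (hlt s).1 hs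
    obtain ⟨ν, hν, he'⟩ := (hlt t).1 ht
    rw [H.minValue_eq hμ he, H.minValue_eq hν he']
    refine (H.strictAntiOn_minOpening.lt_iff_gt hμ hν).1 ?_
    rw [he, he']; exact_mod_cast hst
  · exact H.minValue_eq ⟨one_pos, le_rfl⟩ (by rw [H.minOpening_one]; rfl)
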